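/- Let $n\ge 2$ and let $\mathcal{C}\ell(n)=\{\sum_A a_Ae_A\}$ be the real Clifford algebra of $\mathbb{R}^n$ ($e_ie_j+e_je_i=-2\delta_{ij}$), with norm $|a|=(\sum_A a_A^2)^{1/2}$. Let $\Omega^+\subset\mathbb{R}^n$ be a Jordan domain with boundary $\mathcal{S}$, that is, a bounded domain such that $\mathcal{S}=\partial\Omega^+$ is also the boundary of $\Omega^-=\mathbb{R}^n\setminus\overline{\Omega^+}$. (This includes every bounded domain whose boundary is a compact topological hypersurface; no other regularity of $\mathcal{S}$ is required.) Let $I_p(D)=\int_D \mathrm{dist}(x,\mathcal{S})^{-p}\,dV(x)$ and let $\mathfrak{m}(\mathcal{S})=\max\{\mathfrak{m}^+(\mathcal{S}),\mathfrak{m}^-(\mathcal{S})\}$ be the Marcinkiewicz exponent of $\mathcal{S}$, where $\mathfrak{m}^+(\mathcal{S})=\sup\{p: I_p(\Omega^+)<\infty\}$ and $\mathfrak{m}^-(\mathcal{S})=\sup\{p: I_p(\Omega^-\cap\{|x|<r\})<\infty\}$, with $r$ any radius such that $\mathcal{S}\subset\{|x|<r\}$. Let $\dim_H$ denote the Hausdorff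 dimension. For $0<\alpha\le 1$ let $C^{0,\alpha}(E)$ be the class of functions $f:E\to\mathcal{C}\ell(n)$ with $|f(x)-f(y)|\le M|x-y|^\alpha$ on $E$ for some $M$. Let $0<\nu\le 1$, $\mu>0$ and $g\in C^{0,\nu}(\mathcal{S})$, and suppose that $$\nu>1-\frac{\mathfrak{m}(\mathcal{S})}{n},\qquad \dim_H\mathcal{S}-(n-1)<\mu<1-\frac{n(1-\nu)}{\mathfrak{m}(\mathcal{S})}.$$ Then for every prescribed constant $c\in\mathcal{C}\ell(n)$ the scalar additive jump problem $$\Phi^+(x)-\Phi^-(x)=g(x)\quad(x\in\mathcal{S}),\qquad \Phi(\infty)=c,$$ has one and only one solution $\Phi$ in the classes $C^{0,\mu}(\overline{\Omega^+})$ and $C^{0,\mu}(\overline{\Omega^-})$. Here a solution in these classes is a function $\Phi$ that is left monogenic in $\mathbb{R}^n\setminus\mathcal{S}$ (that is, of class $C^1$ with $\sum_{j=1}^n e_j\,\partial\Phi/\partial x_j=0$), whose restrictions to $\Omega^+$ and $\Omega^-$ extend to functions $\Phi^+\in C^{0,\mu}(\overline{\Omega^+})$ and $\Phi^-\in C^{0,\mu}(\overline{\Omega^-})$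 satisfying the jump condition on $\mathcal{S}$, and with $\Phi(x)\to c$ as $|x|\to\infty$. -/

import Mathlib

open Set Filter Topology MeasureTheory
open scoped NNReal ENNReal

noncomputable section

namespace CliffordJump

/-- `ℝⁿ` with its Euclidean norm. -/
abbrev Euc (n : ℕ) : Type := EuclideanSpace ℝ (Fin n)

/-! ### The Clifford algebra of `ℝⁿ` and its Euclidean norm -/

/-- The quadratic form `x ↦ -|x|²` on `ℝⁿ`. -/
def negNormSq (n : ℕ) : QuadraticForm ℝ (Euc n) :=
  -(LinearMap.BilinMap.toQuadraticMap (innerₗ (Euc n)))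

theorem negNormSq_apply (n : ℕ) (x : Euc n) : negNormSq n x = -‖x‖ ^ 2 := by
  simp [negNormSq]

/-- The real Clifford algebra generated by `ℝⁿ` subject to `x² = -|x|²`. -/
abbrev Cl (n : ℕ) : Type := CliffordAlgebra (negNormSq n)

/-- The `j`-th standard unit vector of `ℝⁿ`. -/
def stdVec (n : ℕ) (j : Fin n) : Euc n := EuclideanSpace.single j 1

/-- The generator `e_j` of the Clifford algebra. -/
def gen (n : ℕ) (j : Fin n) : Cl n := CliffordAlgebra.ι (negNormSq n) (stdVec n j)

/-- `e_A = e_{β₁} ⋯ e_{β_k}` for `A = {β₁ < ⋯ < β_k}` (and `e_∅ = 1`). -/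
def blade (n : ℕ) (A : Finset (Fin n)) : Cl n := (A.sort.map (gen n)).prod

theorem contractLeft_prod_eq_zero {M : Type*} [AddCommGroup M] [Module ℝ M]
    {Q : QuadraticForm ℝ M} (d : Module.Dual ℝ M) (l : List M) (h : ∀ v ∈ l, d v = 0) :
    CliffordAlgebra.contractLeft d (l.map (CliffordAlgebra.ι Q)).prod = 0 := by
  induction l with
  | nil => simp
  | cons a l ih =>
    rw [List.map_cons, List.prod_cons, CliffordAlgebra.contractLeft_ι_mul,
      ih fun v hv => h v (List.mem_cons_of_mem _ hv), h a List.mem_cons_self]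
    simp

theorem changeForm_prod {M : Type*} [AddCommGroup M] [Module ℝ M]
    {Q Q' : QuadraticForm ℝ M} {B : LinearMap.BilinForm ℝ M} (h : B.toQuadraticMap = Q' - Q)
    (l : List M) (hl : l.Pairwise fun v w => B v w = 0) :
    CliffordAlgebra.changeForm h (l.map (CliffordAlgebra.ι Q)).prod =
      (l.map (CliffordAlgebra.ι Q')).prod := by
  induction l with
  | nil => simp
  | cons a l ih =>
    rw [List.pairwise_cons] at hl
    rw [List.map_cons, List.prod_cons, CliffordAlgebra.changeForm_ι_mul, ih hl.2,
      contractLeft_prod_eq_zero _ _ hl.1]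
    simp

theorem inner_toQuadraticMap (n : ℕ) :
    (LinearMap.BilinMap.toQuadraticMap (innerₗ (Euc n))) = 0 - negNormSq n := by
  simp [negNormSq]

theorem blade_eq (n : ℕ) :
    blade n = ((EuclideanSpace.basisFun (Fin n) ℝ).toBasis.ExteriorAlgebra.map
      (CliffordAlgebra.changeFormEquiv (inner_toQuadraticMap n)).symm) := by
  funext A
  rw [Module.Basis.map_apply, LinearEquiv.eq_symm_apply, CliffordAlgebra.changeFormEquiv_apply]
  have h1 : blade n A = ((A.sort.map (stdVec n)).map (CliffordAlgebra.ι (negNormSq n))).prod := by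
    rw [List.map_map]; rfl
  rw [h1, changeForm_prod, ExteriorAlgebra.basis_apply_ofCard (n := A.card) _ rfl,
    ExteriorAlgebra.ιMulti_family, ExteriorAlgebra.ιMulti_apply]
  · congr 1
    apply List.ext_getElem
    · simp
    · intro i hi hi'
      simp [stdVec, Set.powersetCard.ofFinEmbEquiv_symm_apply, Set.powersetCard.ofCard]
      rfl
  · rw [List.pairwise_map]
    refine (Finset.sort_nodup A (· ≤ ·)).imp ?_
    intro i j hij
    change inner ℝ (stdVec n i) (stdVec n j) = 0
    rw [stdVec, stdVec, EuclideanSpace.inner_single_left]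
    simp [hij]

/-- The `2ⁿ` elements `e_A` form a basis of the Clifford algebra. -/
def bladeBasis (n : ℕ) : Module.Basis (Finset (Fin n)) ℝ (Cl n) :=
  Module.Basis.mk (v := blade n) (by rw [blade_eq]; exact Module.Basis.linearIndependent _)
    (by rw [blade_eq]; exact (Module.Basis.span_eq _).ge)

/-- The coordinates `a ↦ (a_A)_A`, where `a = ∑_A a_A e_A`. -/
def coords (n : ℕ) : Cl n ≃ₗ[ℝ] EuclideanSpace ℝ (Finset (Fin n)) :=
  (bladeBasis n).equivFun ≪≫ₗ (WithLp.linearEquiv 2 ℝ (Finset (Fin n) → ℝ)).symm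

/-- The Clifford algebra with the norm `|a| = (∑_A a_A²)^{1/2}`. -/
instance instNormedAddCommGroupCl (n : ℕ) : NormedAddCommGroup (Cl n) :=
  NormedAddCommGroup.induced (Cl n) (EuclideanSpace ℝ (Finset (Fin n))) (coords n)
    (coords n).injective

instance instNormedSpaceCl (n : ℕ) : NormedSpace ℝ (Cl n) :=
  NormedSpace.induced ℝ (Cl n) (EuclideanSpace ℝ (Finset (Fin n))) (coords n)

theorem norm_eq (n : ℕ) (a : Cl n) : ‖a‖ = √(∑ A, (bladeBasis n).repr a A ^ 2) := by
  change ‖coords n a‖ = _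
  simp [EuclideanSpace.norm_eq, coords]

/-! ### Monogenic functions -/

/-- The Dirac operator `∂ₙ u = ∑_j e_j ∂u/∂x_j`, acting from the left. -/
def dirac {n : ℕ} (u : Euc n → Cl n) (x : Euc n) : Cl n :=
  ∑ j : Fin n, gen n j * fderiv ℝ u x (stdVec n j)

/-- `u` is (left) monogenic in the open set `U`: it is `C¹` there and `∂ₙ u = 0`. -/
def IsMonogenicOn {n : ℕ} (u : Euc n → Cl n) (U : Set (Euc n)) : Prop :=
  ContDiffOn ℝ 1 u U ∧ ∀ x ∈ U, dirac u x = 0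

/-! ### Domains, Marcinkiewicz exponents, Hölder classes -/

/-- The exterior domain `Ω⁻ = ℝⁿ \ (Ω ∪ ∂Ω)`. -/
def exteriorOf {n : ℕ} (Ω : Set (Euc n)) : Set (Euc n) := (closure Ω)ᶜ

/-- A Jordan domain: a bounded domain whose boundary is the common boundary of the domain and of
its exterior. By the Jordan-Brouwer theorem, every bounded domain whose boundary is a compact
topological hypersurface is one; no further regularity of the boundary is required. -/
structure IsJordanDomain {n : ℕ} (Ω : Set (Euc n)) : Prop where
  isOpen : IsOpen Ω
  isConnected : IsConnected Ω
  isBounded : Bornology.IsBounded Ω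
  frontier_exterior : frontier (exteriorOf Ω) = frontier Ω

/-- `I_p(D) = ∫_D dist(x, S)^{-p} dV(x)`, with values in `[0, ∞]`. -/
def distIntegral {n : ℕ} (S D : Set (Euc n)) (p : ℝ) : ℝ≥0∞ :=
  ∫⁻ x in D, ENNReal.ofReal (1 / Metric.infDist x S ^ p)

/-- The inner Marcinkiewicz exponent of `S = ∂Ω`. -/
def innerMarcinkiewicz {n : ℕ} (Ω : Set (Euc n)) : ℝ :=
  sSup {p : ℝ | distIntegral (frontier Ω) Ω p < ∞}

/-- The outer Marcinkiewicz exponent of `S = ∂Ω`, computed in `Ω* = Ω⁻ ∩ {|x| < r}`, where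
`r` is any radius such that `S ⊆ {|x| < r}`. -/
def outerMarcinkiewicz {n : ℕ} (Ω : Set (Euc n)) (r : ℝ) : ℝ :=
  sSup {p : ℝ | distIntegral (frontier Ω) (exteriorOf Ω ∩ Metric.ball 0 r) p < ∞}

/-- The (absolute) Marcinkiewicz exponent of `S = ∂Ω`. -/
def marcinkiewicz {n : ℕ} (Ω : Set (Euc n)) (r : ℝ) : ℝ :=
  max (innerMarcinkiewicz Ω) (outerMarcinkiewicz Ω r)

/-- `f` belongs to the Hölder class `C^{0,ν}(E)`. -/
def IsHolderOn {n : ℕ} (ν : ℝ≥0) (f : Euc n → Cl n) (E : Set (Euc n)) : Prop :=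
  ∃ M : ℝ≥0, HolderOnWith M ν f E

/-! ### The jump problem -/

/-- `Φ` (whose values on `S = ∂Ω` are irrelevant) is a solution of the jump problem
`Φ⁺ - Φ⁻ = g` on `S`, `Φ(∞) = c`, belonging to `C^{0,μ}` of the closures of `Ω⁺ = Ω` and `Ω⁻`:
it is monogenic off `S`, and `Φ|Ω⁺`, `Φ|Ω⁻` have extensions `Φ⁺`, `Φ⁻` of class `C^{0,μ}` to the
closures, whose values on `S` satisfy the jump condition. -/
structure IsJumpSolution {n : ℕ} (Ω : Set (Euc n)) (g : Euc n → Cl n) (c : Cl n) (μ : ℝ≥0)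
    (Φ : Euc n → Cl n) : Prop where
  monogenic : IsMonogenicOn Φ (frontier Ω)ᶜ
  at_infinity : Tendsto Φ (cocompact (Euc n)) (𝓝 c)
  jump : ∃ Φp Φm : Euc n → Cl n,
    EqOn Φp Φ Ω ∧ EqOn Φm Φ (exteriorOf Ω) ∧
    IsHolderOn μ Φp (closure Ω) ∧ IsHolderOn μ Φm (closure (exteriorOf Ω)) ∧
    ∀ x ∈ frontier Ω, Φp x - Φm x = g x

end CliffordJump

end

/-!
The proof uses no boundary regularity because everything is done with Lipschitz functions and volume
integrals.

The basic tool is the Cauchy–Pompeiu formula `v = T(∂v)` for Lipschitz functions `v` of compact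
support (`cauchy_pompeiu`), where `T f (x) = ∫ E(x - y) f(y) dy` and `E(x) = -x / (σ |x|ⁿ)`. It is
obtained by integrating by parts against the regularised kernel with `(|x|² + ε)^{n/2}` in place of
`|x|ⁿ`, whose Dirac derivative is an approximate identity; no surface integral occurs. Extensions
are McShane extensions: if `F(x) = inf_{s ∈ K} (f(s) + ω(|x - s|))` for a modulus `ω` with `ω(t)/t`
nonincreasing, then `F` has the local Lipschitz constant `ω(d)/d` at distance `d` from `K`
(`exists_mcShane_extension`). In particular a `ν`-Hölder function on `S` extends with gradient
`O(dist(·, S)^{ν-1})`, which is what a Whitney extension would give.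

*Existence* (`exists_jump_potential`, `exists_isJumpSolution`). Let `D` be the side of `S` on which
the Marcinkiewicz exponent is attained, `u` a compactly supported extension of `g` as above, and
`f = χ_D ∂u`. Finiteness of `I_p(D)` for a `p > n (1-ν) / (1-s)` puts `f` into `L^q` with
`q = n / (1-s)`, where `μ < s < 1`, and then `T f` is `μ`-Hölder on the whole space, because `E` is
`μ`-Hölder with weights of order `1-n-μ`. So `χ_D u - T f` has the right jump. It is monogenic off
`S`: near a point it equals `T(∂v - f)` for a localisation `v` of `χ_D u`, and there the density
`∂v - f` vanishes. A ball touching `S` shows `p ≤ n`, hence `μ < ν`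
(`le_of_distIntegral_frontier_lt_top`).

*Uniqueness* (`eq_zero_of_monogenic_of_hausdorffMeasure`). The difference `w` of two solutions is
`μ`-Hölder across `S`, monogenic off `S` and vanishes at infinity. Cover `S` by balls with
`∑ rᵢ^{n-1+μ}` small and replace `w` inside the balls by a McShane extension `F` of its values
outside. Then `|∇F| ≤ C (rᵢ - |x - xᵢ|)^{μ-1}` in the `i`-th ball, so that
`∫ |∂F| ≤ C ∑ rᵢ^{n-1+μ}`, and the Cauchy–Pompeiu formula for `F`, cut off at a large radius, shows
that `w` is arbitrarily small at every point off `S`.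
-/

noncomputable section

namespace CliffordJump

/-! ### Bounded bilinear structure of the Clifford algebra -/

instance instFiniteDimensionalCl (n : ℕ) : FiniteDimensional ℝ (Cl n) :=
  (bladeBasis n).finiteDimensional_of_finite

instance instCompleteSpaceCl (n : ℕ) : CompleteSpace (Cl n) :=
  FiniteDimensional.complete ℝ (Cl n)

/-- The inclusion `ι` of vectors into the Clifford algebra, as a bounded operator. -/
def vecCLM (n : ℕ) : Euc n →L[ℝ] Cl n :=
  LinearMap.toContinuousLinearMap (CliffordAlgebra.ι (negNormSq n))

@[simp] theorem vecCLM_apply (n : ℕ) (x : Euc n) :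
    vecCLM n x = CliffordAlgebra.ι (negNormSq n) x := rfl

/-- Clifford multiplication as a bounded bilinear map; the Euclidean norm of the Clifford algebra
is submultiplicative only up to the constant `‖mulCLM n‖`. -/
def mulCLM (n : ℕ) : Cl n →L[ℝ] Cl n →L[ℝ] Cl n :=
  LinearMap.toContinuousLinearMap
    ((LinearMap.toContinuousLinearMap (𝕜 := ℝ) (E := Cl n) (F' := Cl n)).toLinearMap ∘ₗ
      LinearMap.mul ℝ (Cl n))

@[simp] theorem mulCLM_apply (n : ℕ) (a b : Cl n) : mulCLM n a b = a * b := rfl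

theorem norm_mul_le_mulCLM {n : ℕ} (a b : Cl n) : ‖a * b‖ ≤ ‖mulCLM n‖ * ‖a‖ * ‖b‖ := by
  simpa using (mulCLM n).le_opNorm₂ a b

theorem stdVec_norm {n : ℕ} (j : Fin n) : ‖stdVec n j‖ = 1 := by simp [stdVec]

theorem inner_stdVec {n : ℕ} (x : Euc n) (j : Fin n) : inner ℝ x (stdVec n j) = x j := by
  simp [stdVec, EuclideanSpace.inner_single_right]

theorem sum_smul_stdVec {n : ℕ} (x : Euc n) : ∑ j, x j • stdVec n j = x := by
  simpa [stdVec] using (EuclideanSpace.basisFun (Fin n) ℝ).sum_repr x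

theorem sum_smul_gen {n : ℕ} (x : Euc n) : ∑ j, x j • gen n j = vecCLM n x := by
  conv_rhs => rw [← sum_smul_stdVec x]
  simp [gen]

theorem gen_mul_gen_self {n : ℕ} (j : Fin n) : gen n j * gen n j = -1 := by
  rw [gen, CliffordAlgebra.ι_sq_scalar, negNormSq_apply, stdVec_norm]; simp

theorem vecCLM_mul_self {n : ℕ} (x : Euc n) :
    vecCLM n x * vecCLM n x = -(‖x‖ ^ 2) • (1 : Cl n) := by
  rw [vecCLM_apply, CliffordAlgebra.ι_sq_scalar, negNormSq_apply, Algebra.algebraMap_eq_smul_one]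

/-- The Dirac operator as a bounded operator on derivatives: `L ↦ ∑ⱼ eⱼ L(eⱼ)`. -/
def symbolCLM (n : ℕ) : (Euc n →L[ℝ] Cl n) →L[ℝ] Cl n :=
  ∑ j : Fin n, mulCLM n (gen n j) ∘L ContinuousLinearMap.apply ℝ (Cl n) (stdVec n j)

theorem symbolCLM_apply {n : ℕ} (L : Euc n →L[ℝ] Cl n) :
    symbolCLM n L = ∑ j : Fin n, gen n j * L (stdVec n j) := by
  simp [symbolCLM]

theorem dirac_eq {n : ℕ} (u : Euc n → Cl n) (x : Euc n) :
    dirac u x = symbolCLM n (fderiv ℝ u x) := by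
  rw [symbolCLM_apply]; rfl

theorem norm_dirac_le {n : ℕ} (u : Euc n → Cl n) (x : Euc n) :
    ‖dirac u x‖ ≤ ‖symbolCLM n‖ * ‖fderiv ℝ u x‖ := by
  rw [dirac_eq]; exact (symbolCLM n).le_opNorm _

theorem stronglyMeasurable_dirac {n : ℕ} (u : Euc n → Cl n) : StronglyMeasurable (dirac u) := by
  have h : StronglyMeasurable (fderiv ℝ u) := (measurable_fderiv ℝ u).stronglyMeasurable
  have := (symbolCLM n).continuous.comp_stronglyMeasurable h
  exact (funext (dirac_eq u) : dirac u = _) ▸ this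

theorem dirac_congr {n : ℕ} {u v : Euc n → Cl n} {x : Euc n} (h : u =ᶠ[𝓝 x] v) :
    dirac u x = dirac v x := by
  rw [dirac_eq, dirac_eq, h.fderiv_eq]

/-! ### The Cauchy kernel -/

/-- The regularised vector kernel `(|x|² + ε)^{-n/2} x`; for `ε = 0` it is, up to a constant and a
sign, the fundamental solution of the Dirac operator. -/
def kernelVec (n : ℕ) (ε : ℝ) (x : Euc n) : Euc n := (‖x‖ ^ 2 + ε) ^ (-(n : ℝ) / 2) • x

/-- The derivative of `kernelVec`. -/
def kernelDeriv (n : ℕ) (ε : ℝ) (x : Euc n) : Euc n →L[ℝ] Euc n :=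
  (‖x‖ ^ 2 + ε) ^ (-(n : ℝ) / 2) • ContinuousLinearMap.id ℝ (Euc n) -
    (n * (‖x‖ ^ 2 + ε) ^ (-(n : ℝ) / 2 - 1)) • (innerSL ℝ x).smulRight x

theorem kernelDeriv_apply {n : ℕ} (ε : ℝ) (x h : Euc n) : kernelDeriv n ε x h =
    (‖x‖ ^ 2 + ε) ^ (-(n : ℝ) / 2) • h -
      (n * (‖x‖ ^ 2 + ε) ^ (-(n : ℝ) / 2 - 1)) • inner ℝ x h • x := by
  simp [kernelDeriv]

theorem hasFDerivAt_kernelVec {n : ℕ} {ε : ℝ} {x : Euc n} (h : 0 < ‖x‖ ^ 2 + ε) :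
    HasFDerivAt (kernelVec n ε) (kernelDeriv n ε x) x := by
  have h1 : HasFDerivAt (fun x : Euc n => ‖x‖ ^ 2 + ε) (2 • innerSL ℝ x) x :=
    ((hasStrictFDerivAt_norm_sq x).hasFDerivAt).add_const ε
  have h2 := (h1.rpow_const (p := -(n : ℝ) / 2) (Or.inl h.ne')).smul (hasFDerivAt_id x)
  refine h2.congr_fderiv ?_
  ext1 y
  simp only [kernelDeriv_apply]
  simp [sub_eq_add_neg, smul_smul, ← neg_smul]
  congr 1
  ring

theorem continuousAt_kernelDeriv {n : ℕ} {ε : ℝ} {x : Euc n} (h : 0 < ‖x‖ ^ 2 + ε) :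
    ContinuousAt (kernelDeriv n ε) x := by
  have h1 : ContinuousAt (fun x : Euc n => ‖x‖ ^ 2 + ε) x := by fun_prop
  have h2 (p : ℝ) : ContinuousAt (fun x : Euc n => (‖x‖ ^ 2 + ε) ^ p) x :=
    h1.rpow_const (Or.inl h.ne')
  have h3 : Continuous fun x : Euc n => (innerSL ℝ x).smulRight x := by
    have : Continuous fun x : Euc n =>
      ContinuousLinearMap.smulRightL ℝ (Euc n) (Euc n) (innerSL ℝ x) x := by fun_prop
    exact this
  exact ((h2 _).smul continuousAt_const).sub
    ((continuousAt_const.mul (h2 _)).smul h3.continuousAt)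

theorem sum_gen_mul_kernelDeriv {n : ℕ} {ε : ℝ} {x : Euc n} (h : 0 < ‖x‖ ^ 2 + ε) :
    ∑ j, gen n j * vecCLM n (kernelDeriv n ε x (stdVec n j)) =
      -(n * (ε * (‖x‖ ^ 2 + ε) ^ (-(n : ℝ) / 2 - 1))) • (1 : Cl n) := by
  have h1 : ∀ j, gen n j * vecCLM n (kernelDeriv n ε x (stdVec n j)) =
      (‖x‖ ^ 2 + ε) ^ (-(n : ℝ) / 2) • (-1 : Cl n) -
      (n * (‖x‖ ^ 2 + ε) ^ (-(n : ℝ) / 2 - 1)) • ((x j • gen n j) * vecCLM n x) := by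
    intro j
    rw [kernelDeriv_apply, map_sub, map_smul, map_smul, map_smul, mul_sub, mul_smul_comm,
      mul_smul_comm, mul_smul_comm, inner_stdVec, smul_mul_assoc]
    congr 2
    exact gen_mul_gen_self j
  rw [Finset.sum_congr rfl fun j _ => h1 j, Finset.sum_sub_distrib, ← Finset.smul_sum,
    ← Finset.smul_sum, ← Finset.sum_mul, sum_smul_gen, vecCLM_mul_self]
  have h2 : (‖x‖ ^ 2 + ε) ^ (-(n : ℝ) / 2) =
      (‖x‖ ^ 2 + ε) ^ (-(n : ℝ) / 2 - 1) * (‖x‖ ^ 2 + ε) := by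
    rw [Real.rpow_sub_one h.ne']; field_simp
  rw [h2]
  simp only [Finset.sum_const, Finset.card_univ, Fintype.card_fin, smul_smul, smul_neg,
    ← Nat.cast_smul_eq_nsmul ℝ, ← neg_smul, ← sub_smul]
  congr 1
  ring

/-- Since `kernelDeriv` is a symmetric matrix, the right and the left Dirac operator agree on
`kernelVec`. -/
theorem sum_sum_gen_mul_kernelDeriv {n : ℕ} {ε : ℝ} {x : Euc n} (h : 0 < ‖x‖ ^ 2 + ε) :
    ∑ i, ∑ j, (kernelDeriv n ε x (stdVec n j) i) • (gen n i * gen n j) =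
      -(n * (ε * (‖x‖ ^ 2 + ε) ^ (-(n : ℝ) / 2 - 1))) • (1 : Cl n) := by
  rw [← sum_gen_mul_kernelDeriv h]
  refine Finset.sum_congr rfl fun i _ => ?_
  rw [← sum_smul_gen, Finset.mul_sum]
  refine Finset.sum_congr rfl fun j _ => ?_
  rw [mul_smul_comm]
  congr 1
  simp only [kernelDeriv_apply, inner_stdVec, PiLp.sub_apply, PiLp.smul_apply, smul_eq_mul]
  have : stdVec n j i = stdVec n i j := by
    simp [stdVec, eq_comm]
  rw [this]; ring

theorem norm_kernelVec_le {n : ℕ} {ε : ℝ} (hε : 0 ≤ ε) (x : Euc n) :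
    ‖kernelVec n ε x‖ ≤ ‖x‖ ^ (1 - (n : ℝ)) := by
  rcases eq_or_ne x 0 with rfl | hx
  · simp only [kernelVec, smul_zero, norm_zero]; positivity
  have hx' : 0 < ‖x‖ := norm_pos_iff.2 hx
  rw [kernelVec, norm_smul, Real.norm_of_nonneg (by positivity)]
  have h1 : (‖x‖ ^ 2 + ε) ^ (-(n : ℝ) / 2) ≤ (‖x‖ ^ 2) ^ (-(n : ℝ) / 2) :=
    Real.rpow_le_rpow_of_nonpos (by positivity) (by linarith)
      (by have : (0 : ℝ) ≤ n := by positivity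
          linarith)
  have h2 : (‖x‖ ^ 2) ^ (-(n : ℝ) / 2) = ‖x‖ ^ (-(n : ℝ)) := by
    rw [← Real.rpow_natCast, ← Real.rpow_mul hx'.le]; congr 1; push_cast; ring
  rw [h2] at h1
  calc _ ≤ ‖x‖ ^ (-(n : ℝ)) * ‖x‖ := by gcongr
    _ = _ := by rw [show 1 - (n : ℝ) = -n + 1 by ring, Real.rpow_add_one hx'.ne']

theorem norm_kernelDeriv_le {n : ℕ} {ε : ℝ} {x : Euc n} (h : 0 < ‖x‖ ^ 2 + ε) (hε : 0 ≤ ε) :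
    ‖kernelDeriv n ε x‖ ≤ (n + 1) * (‖x‖ ^ 2 + ε) ^ (-(n : ℝ) / 2) := by
  refine ContinuousLinearMap.opNorm_le_bound _ (by positivity) fun y => ?_
  rw [kernelDeriv_apply]
  have h2 : (‖x‖ ^ 2 + ε) ^ (-(n : ℝ) / 2) =
      (‖x‖ ^ 2 + ε) ^ (-(n : ℝ) / 2 - 1) * (‖x‖ ^ 2 + ε) := by
    rw [Real.rpow_sub_one h.ne']; field_simp
  refine (norm_sub_le _ _).trans ?_
  rw [norm_smul, norm_smul, norm_smul, Real.norm_of_nonneg (by positivity),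
    Real.norm_of_nonneg (by positivity)]
  have h3 : ‖inner ℝ x y‖ * ‖x‖ ≤ (‖x‖ ^ 2 + ε) * ‖y‖ := by
    have := mul_le_mul_of_nonneg_right (norm_inner_le_norm (𝕜 := ℝ) x y) (norm_nonneg x)
    nlinarith [mul_nonneg hε (norm_nonneg y)]
  calc _ ≤ (‖x‖ ^ 2 + ε) ^ (-(n : ℝ) / 2) * ‖y‖ +
        n * (‖x‖ ^ 2 + ε) ^ (-(n : ℝ) / 2 - 1) * ((‖x‖ ^ 2 + ε) * ‖y‖) := by gcongr
    _ = _ := by rw [h2]; ring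

theorem norm_kernelDeriv_zero_le {n : ℕ} {x : Euc n} (h : x ≠ 0) :
    ‖kernelDeriv n 0 x‖ ≤ (n + 1) * ‖x‖ ^ (-(n : ℝ)) := by
  have hx' : 0 < ‖x‖ := norm_pos_iff.2 h
  have := norm_kernelDeriv_le (ε := 0) (x := x) (by positivity) le_rfl
  rwa [add_zero, ← Real.rpow_natCast, ← Real.rpow_mul hx'.le,
    show ((2 : ℕ) : ℝ) * (-(n : ℝ) / 2) = -n by push_cast; ring] at this

/-- For `ε > 0` the regularised kernel is globally Lipschitz. -/
theorem exists_lipschitzWith_kernelVec (n : ℕ) {ε : ℝ} (hε : 0 < ε) :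
    ∃ C, LipschitzWith C (kernelVec n ε) := by
  have hpos : ∀ x : Euc n, 0 < ‖x‖ ^ 2 + ε := fun x => by positivity
  refine ⟨((n + 1) * ε ^ (-(n : ℝ) / 2)).toNNReal, ?_⟩
  refine lipschitzWith_of_nnnorm_fderiv_le (𝕜 := ℝ)
    (fun x => (hasFDerivAt_kernelVec (hpos x)).differentiableAt) fun x => ?_
  rw [(hasFDerivAt_kernelVec (hpos x)).fderiv, ← NNReal.coe_le_coe, coe_nnnorm,
    Real.coe_toNNReal _ (by positivity)]
  refine (norm_kernelDeriv_le (hpos x) hε.le).trans ?_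
  gcongr ?_ * ?_
  exact Real.rpow_le_rpow_of_nonpos hε (by nlinarith [norm_nonneg x])
      (by have : (0 : ℝ) ≤ n := by positivity
          linarith)

/-- The Hölder estimate for the Cauchy kernel, in the case of two points that are close to each
other compared with their distance to the origin. -/
theorem norm_kernelVec_sub_le_of_near {n : ℕ} {s : ℝ} (hs1 : s ≤ 1) {a b : Euc n}
    (ha : a ≠ 0) (hab : ‖a - b‖ ≤ ‖a‖ / 2) :
    ‖kernelVec n 0 a - kernelVec n 0 b‖ ≤
      (n + 1) * 2 ^ n * ‖a - b‖ ^ s * ‖a‖ ^ (1 - (n : ℝ) - s) := by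
  have ha' : 0 < ‖a‖ := norm_pos_iff.2 ha
  rcases eq_or_ne a b with rfl | hne
  · simp only [sub_self, norm_zero]; positivity
  have hab' : 0 < ‖a - b‖ := norm_pos_iff.2 (sub_ne_zero.2 hne)
  have hball : ∀ x ∈ Metric.closedBall a (‖a‖ / 2), ‖a‖ / 2 ≤ ‖x‖ := by
    intro x hx
    rw [Metric.mem_closedBall, dist_eq_norm] at hx
    have := norm_sub_norm_le a x
    rw [norm_sub_rev] at this
    linarith
  have hmv := (convex_closedBall a (‖a‖ / 2)).norm_image_sub_le_of_norm_hasFDerivWithin_le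
    (f := kernelVec n 0) (f' := kernelDeriv n 0) (C := (n + 1) * (‖a‖ / 2) ^ (-(n : ℝ)))
    (x := b) (y := a) (fun x hx => (hasFDerivAt_kernelVec (by
      have := hball x hx
      have : 0 < ‖x‖ := by linarith
      positivity)).hasFDerivWithinAt) (fun x hx => by
      have h1 := hball x hx
      have h2 : 0 < ‖x‖ := by linarith
      refine (norm_kernelDeriv_zero_le (norm_pos_iff.1 h2)).trans ?_
      gcongr ?_ * ?_
      exact Real.rpow_le_rpow_of_nonpos (by positivity) h1 (by simp))
    (by rw [Metric.mem_closedBall, dist_comm, dist_eq_norm]; exact hab)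
    (Metric.mem_closedBall_self (by positivity))
  refine hmv.trans ?_
  have h3 : ‖a - b‖ = ‖a - b‖ ^ s * ‖a - b‖ ^ (1 - s) := by
    rw [← Real.rpow_add hab']; simp
  have h4 : ‖a - b‖ ^ (1 - s) ≤ ‖a‖ ^ (1 - s) :=
    Real.rpow_le_rpow hab'.le (by linarith) (by linarith)
  have h5 : (‖a‖ / 2) ^ (-(n : ℝ)) = 2 ^ n * ‖a‖ ^ (-(n : ℝ)) := by
    rw [Real.div_rpow ha'.le (by norm_num), Real.rpow_neg (x := 2) (by norm_num),
      Real.rpow_natCast]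
    field_simp
  calc _ = (n + 1) * (‖a‖ / 2) ^ (-(n : ℝ)) * (‖a - b‖ ^ s * ‖a - b‖ ^ (1 - s)) := by rw [← h3]
    _ ≤ (n + 1) * (‖a‖ / 2) ^ (-(n : ℝ)) * (‖a - b‖ ^ s * ‖a‖ ^ (1 - s)) := by gcongr
    _ = _ := by
      rw [h5, show 1 - (n : ℝ) - s = -n + (1 - s) by ring, Real.rpow_add ha']; ring

theorem norm_kernelVec_le_of_far {n : ℕ} {s : ℝ} (hs0 : 0 ≤ s) {a b : Euc n}
    (ha : a ≠ 0) (hab : ‖a‖ / 2 ≤ ‖a - b‖) :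
    ‖kernelVec n 0 a‖ ≤ 2 ^ s * ‖a - b‖ ^ s * ‖a‖ ^ (1 - (n : ℝ) - s) := by
  have ha' : 0 < ‖a‖ := norm_pos_iff.2 ha
  refine (norm_kernelVec_le le_rfl a).trans ?_
  have h1 : ‖a‖ ^ s ≤ (2 * ‖a - b‖) ^ s := Real.rpow_le_rpow ha'.le (by linarith) hs0
  rw [Real.mul_rpow (by norm_num) (norm_nonneg _)] at h1
  calc ‖a‖ ^ (1 - (n : ℝ)) = ‖a‖ ^ s * ‖a‖ ^ (1 - (n : ℝ) - s) := by
        rw [← Real.rpow_add ha']; congr 1; ring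
    _ ≤ _ := by gcongr

/-- Hölder continuity of the Cauchy kernel away from its pole, with the natural weights. -/
theorem norm_kernelVec_sub_le {n : ℕ} {s : ℝ} (hs0 : 0 ≤ s) (hs1 : s ≤ 1) {a b : Euc n}
    (ha : a ≠ 0) (hb : b ≠ 0) :
    ‖kernelVec n 0 a - kernelVec n 0 b‖ ≤ (n + 2) * 2 ^ (n + 1) * ‖a - b‖ ^ s *
      (‖a‖ ^ (1 - (n : ℝ) - s) + ‖b‖ ^ (1 - (n : ℝ) - s)) := by
  have h2s : (2 : ℝ) ^ s ≤ (n + 2) * 2 ^ (n + 1) := by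
    calc (2 : ℝ) ^ s ≤ 2 ^ (1 : ℝ) := Real.rpow_le_rpow_of_exponent_le (by norm_num) hs1
      _ = 1 * 2 ^ 1 := by norm_num
      _ ≤ _ := by gcongr <;> linarith [(Nat.cast_nonneg n : (0 : ℝ) ≤ n)]
  have hc : ((n : ℝ) + 1) * 2 ^ n ≤ (n + 2) * 2 ^ (n + 1) := by
    gcongr <;> norm_num
  have hA : 0 ≤ ‖a‖ ^ (1 - (n : ℝ) - s) := by positivity
  have hB : 0 ≤ ‖b‖ ^ (1 - (n : ℝ) - s) := by positivity
  rcases le_total ‖a - b‖ (‖a‖ / 2) with h | h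
  · refine (norm_kernelVec_sub_le_of_near hs1 ha h).trans ?_
    gcongr
    linarith
  rcases le_total ‖b - a‖ (‖b‖ / 2) with h' | h'
  · rw [norm_sub_rev, norm_sub_rev a b]
    refine (norm_kernelVec_sub_le_of_near hs1 hb h').trans ?_
    gcongr
    linarith
  refine (norm_sub_le _ _).trans ?_
  have e1 := norm_kernelVec_le_of_far (n := n) hs0 ha h
  have e2 := norm_kernelVec_le_of_far (n := n) hs0 hb h'
  rw [norm_sub_rev b a] at e2
  calc _ ≤ 2 ^ s * ‖a - b‖ ^ s * (‖a‖ ^ (1 - (n : ℝ) - s) + ‖b‖ ^ (1 - (n : ℝ) - s)) := by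
        rw [mul_add]; exact add_le_add e1 e2
    _ ≤ _ := by gcongr

theorem measurable_kernelVec (n : ℕ) (ε : ℝ) : Measurable (kernelVec n ε) := by
  unfold kernelVec; fun_prop

/-! ### Radial integrals -/

theorem nontrivial_euc {n : ℕ} (hn : 2 ≤ n) : Nontrivial (Euc n) :=
  Module.nontrivial_of_finrank_pos (R := ℝ) (by rw [finrank_euclideanSpace_fin]; omega)

theorem integrableOn_norm_rpow {n : ℕ} (hn : 2 ≤ n) {t : ℝ} (ht : t < n) (r : ℝ) :
    IntegrableOn (fun y : Euc n => ‖y‖ ^ (-t)) (Metric.ball 0 r) := by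
  have := nontrivial_euc hn
  rw [integrableOn_fun_norm_addHaar volume (f := fun s : ℝ => s ^ (-t)), finrank_euclideanSpace_fin]
  have h : IntegrableOn (fun y : ℝ => y ^ (n - 1 - t)) (Ioo 0 r) := by
    rcases le_or_gt r 0 with hr | hr
    · simp [Ioo_eq_empty_of_le hr]
    · exact ((intervalIntegral.intervalIntegrable_rpow' (a := 0) (b := r) (by linarith)).1).mono_set
        Ioo_subset_Ioc_self
  refine h.congr_fun (fun y hy => ?_) measurableSet_Ioo
  have hy0 : 0 < y := hy.1
  simp only [smul_eq_mul]
  rw [← Real.rpow_natCast, ← Real.rpow_add hy0]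
  congr 1
  rw [Nat.cast_sub (by omega)]; push_cast; ring

/-- The Riesz-type potentials `∫_D |x - y|^{-t} dy`, `t < n`, of a set of finite volume are bounded
uniformly in `x`. -/
theorem exists_bound_integral_norm_sub_rpow {n : ℕ} (hn : 2 ≤ n) {t : ℝ} (ht0 : 0 ≤ t) (ht : t < n)
    {D : Set (Euc n)} (hD : volume D < ∞) :
    ∃ C : ℝ, ∀ x : Euc n, IntegrableOn (fun y => ‖x - y‖ ^ (-t)) D ∧
      ∫ y in D, ‖x - y‖ ^ (-t) ≤ C := by
  set F : Euc n → ℝ := (Metric.ball 0 1).indicator fun y => ‖y‖ ^ (-t) with hF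
  have hFi : Integrable F :=
    (integrableOn_norm_rpow hn ht 1).integrable_indicator measurableSet_ball
  have hF0 : ∀ y, 0 ≤ F y := fun y => indicator_nonneg (fun _ _ => by positivity) y
  have hle : ∀ x y : Euc n, ‖x - y‖ ^ (-t) ≤ F (x - y) + 1 := by
    intro x y
    by_cases h : ‖x - y‖ < 1
    · rw [hF, indicator_of_mem (by simpa using h)]; linarith
    · rw [hF, indicator_of_notMem (by simpa using h)]
      have := Real.rpow_le_one_of_one_le_of_nonpos (not_lt.1 h) (by linarith : -t ≤ 0)
      linarith
  have hint : ∀ x, IntegrableOn (fun y => F (x - y) + 1) D := fun x =>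
    ((hFi.comp_sub_left x).integrableOn).add (integrableOn_const hD.ne)
  have hmeas : ∀ x : Euc n, Measurable fun y => ‖x - y‖ ^ (-t) := fun x => by fun_prop
  have hI : ∀ x : Euc n, IntegrableOn (fun y => ‖x - y‖ ^ (-t)) D := fun x =>
    (hint x).mono' (hmeas x).aestronglyMeasurable (Eventually.of_forall fun y => by
      rw [Real.norm_of_nonneg (by positivity)]; exact hle x y)
  refine ⟨(∫ y, F y) + ∫ y in D, (1 : ℝ), fun x => ⟨hI x, ?_⟩⟩
  refine (integral_mono (hI x) (hint x) (hle x)).trans ?_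
  have e : ∫ y in D, (F (x - y) + 1) = (∫ y in D, F (x - y)) + ∫ y in D, (1 : ℝ) :=
    integral_add (hFi.comp_sub_left x).integrableOn (integrableOn_const hD.ne)
  have e2 : ∫ y in D, F (x - y) ≤ ∫ y, F (x - y) :=
    setIntegral_le_integral (hFi.comp_sub_left x) (Eventually.of_forall fun y => hF0 _)
  rw [integral_sub_left_eq_self F volume x] at e2
  linarith

/-- The profile of a boundary layer: `(1 - |y|)^{μ-1}` in the unit ball and `0` outside. -/
def layer (n : ℕ) (μ : ℝ) (y : Euc n) : ℝ :=
  (Metric.ball 0 1).indicator (fun y => (1 - ‖y‖) ^ (μ - 1)) y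

theorem layer_nonneg {n : ℕ} {μ : ℝ} (y : Euc n) : 0 ≤ layer n μ y := by
  refine indicator_nonneg (fun y hy => ?_) y
  rw [mem_ball_zero_iff] at hy
  exact Real.rpow_nonneg (by linarith) _

theorem integrable_layer {n : ℕ} (hn : 2 ≤ n) {μ : ℝ} (hμ : 0 < μ) : Integrable (layer n μ) := by
  have := nontrivial_euc hn
  change Integrable ((Metric.ball 0 1).indicator fun y : Euc n => (1 - ‖y‖) ^ (μ - 1))
  rw [integrable_indicator_iff measurableSet_ball,
    integrableOn_fun_norm_addHaar volume (f := fun s : ℝ => (1 - s) ^ (μ - 1))]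
  have h : IntegrableOn (fun y : ℝ => (1 - y) ^ (μ - 1)) (Ioo 0 1) := by
    have h1 := (intervalIntegral.intervalIntegrable_rpow' (a := 0) (b := 1)
      (by linarith : -1 < μ - 1)).comp_sub_left 1
    simp only [sub_zero, sub_self] at h1
    exact h1.2.mono_set Ioo_subset_Ioc_self
  refine h.mono' (by fun_prop) ?_
  filter_upwards [ae_restrict_mem measurableSet_Ioo] with y hy
  have h2 : 0 ≤ (1 - y) ^ (μ - 1) := Real.rpow_nonneg (by linarith [hy.2]) _
  rw [norm_smul, Real.norm_of_nonneg h2, norm_pow, Real.norm_of_nonneg hy.1.le]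
  exact mul_le_of_le_one_left h2 (pow_le_one₀ hy.1.le hy.2.le)

/-- `r^{μ-1} layer ((y-a)/r)` is `(r - |y - a|)^{μ-1}` in the ball of centre `a` and radius `r`. -/
theorem scaled_layer_apply {n : ℕ} {μ r : ℝ} (hr : 0 < r) {a y : Euc n}
    (hy : y ∈ Metric.ball a r) :
    r ^ (μ - 1) * layer n μ (r⁻¹ • (y - a)) = (r - dist y a) ^ (μ - 1) := by
  rw [Metric.mem_ball] at hy
  have h1 : ‖r⁻¹ • (y - a)‖ = dist y a / r := by
    rw [norm_smul, Real.norm_of_nonneg (by positivity), dist_eq_norm]; field_simp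
  have h2 : dist y a / r < 1 := by rwa [div_lt_one hr]
  rw [layer, indicator_of_mem (by rw [mem_ball_zero_iff, h1]; exact h2), h1,
    ← Real.mul_rpow hr.le (by linarith)]
  congr 1; field_simp

theorem integrable_scaled_layer {n : ℕ} (hn : 2 ≤ n) {μ : ℝ} (hμ : 0 < μ) {r : ℝ} (hr : 0 < r)
    (a : Euc n) : Integrable fun y => r ^ (μ - 1) * layer n μ (r⁻¹ • (y - a)) :=
  (((integrable_layer hn hμ).comp_smul (inv_ne_zero hr.ne')).comp_sub_right a).const_mul _

theorem integral_scaled_layer {n : ℕ} {μ : ℝ} {r : ℝ} (hr : 0 < r)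
    (a : Euc n) : ∫ y, r ^ (μ - 1) * layer n μ (r⁻¹ • (y - a)) =
      r ^ (n - 1 + μ) * ∫ y, layer n μ y := by
  rw [integral_const_mul, integral_sub_right_eq_self (fun y => layer n μ (r⁻¹ • y)),
    Measure.integral_comp_smul, finrank_euclideanSpace_fin, smul_eq_mul, ← mul_assoc,
    abs_of_nonneg (by positivity), inv_pow, inv_inv, ← Real.rpow_natCast, ← Real.rpow_add hr]
  congr 2
  ring

/-! ### The Cauchy–Pompeiu formula for Lipschitz functions -/

theorem integrable_of_bound_on_compact {X F : Type*} [TopologicalSpace X] [T2Space X]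
    [MeasurableSpace X] [BorelSpace X] [NormedAddCommGroup F] {ρ : Measure X} {f : X → F}
    {g : X → ℝ} {K : Set X} (hK : IsCompact K) (hf : AEStronglyMeasurable f ρ)
    (h0 : ∀ x ∉ K, f x = 0) (hg : IntegrableOn g K ρ) (hfg : ∀ x ∈ K, ‖f x‖ ≤ g x) :
    Integrable f ρ := by
  rw [← integrableOn_iff_integrable_of_support_subset (s := K)
    (fun x hx => by by_contra h; exact hx (h0 x h))]
  refine hg.mono' hf.restrict ?_
  filter_upwards [ae_restrict_mem hK.measurableSet] with x hx using hfg x hx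

theorem integrable_smul_fderiv {n : ℕ} {V : Type*} [NormedAddCommGroup V] [NormedSpace ℝ V]
    [FiniteDimensional ℝ V] {a : Euc n → ℝ} (ha : Continuous a) {v : Euc n → V} {C : ℝ≥0}
    (hv : LipschitzWith C v) (hc : HasCompactSupport v) (w : Euc n) :
    Integrable fun y => a y • fderiv ℝ v y w := by
  have : CompleteSpace V := FiniteDimensional.complete ℝ V
  have hm : StronglyMeasurable fun y => fderiv ℝ v y w := by
    have h : StronglyMeasurable (fderiv ℝ v) := (measurable_fderiv ℝ v).stronglyMeasurable
    exact (ContinuousLinearMap.apply ℝ V w).continuous.comp_stronglyMeasurable h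
  refine integrable_of_bound_on_compact (K := tsupport v) hc
    (ha.stronglyMeasurable.smul hm).aestronglyMeasurable (fun x hx => ?_)
    (g := fun y => ‖a y‖ * (C * ‖w‖)) ?_ fun x _ => ?_
  · have : fderiv ℝ v x = 0 := by
      by_contra h
      exact hx (support_fderiv_subset ℝ h)
    simp [this]
  · exact ((ha.norm.mul continuous_const).continuousOn).integrableOn_compact hc
  · rw [norm_smul]
    gcongr
    exact ((fderiv ℝ v x).le_opNorm w).trans (by gcongr; exact norm_fderiv_le_of_lipschitz ℝ hv)

/-- Integration by parts against a vector-valued Lipschitz function of compact support. -/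
theorem integral_smul_fderiv_of_lipschitz {n : ℕ} {V : Type*} [NormedAddCommGroup V]
    [NormedSpace ℝ V] [FiniteDimensional ℝ V] {a : Euc n → ℝ} {a' : Euc n → Euc n →L[ℝ] ℝ} {A : ℝ≥0}
    (hA : LipschitzWith A a) (ha : ∀ y, HasFDerivAt a (a' y) y) (ha' : Continuous a')
    {v : Euc n → V} {C : ℝ≥0} (hv : LipschitzWith C v) (hc : HasCompactSupport v) (w : Euc n) :
    ∫ y, a y • fderiv ℝ v y w = -∫ y, a' y w • v y := by
  have : CompleteSpace V := FiniteDimensional.complete ℝ V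
  have hi1 := integrable_smul_fderiv hA.continuous hv hc w
  have hi2 : Integrable fun y => a' y w • v y :=
    ((ha'.clm_apply continuous_const).smul hv.continuous).integrable_of_hasCompactSupport
      hc.smul_left
  refine (SeparatingDual.eq_iff_forall_dual_eq (R := ℝ)).2 fun l => ?_
  rw [map_neg, ← ContinuousLinearMap.integral_comp_comm l hi1,
    ← ContinuousLinearMap.integral_comp_comm l hi2]
  have hl : LipschitzWith (‖l‖₊ * C) (l ∘ v) := l.lipschitz.comp hv
  have hlc : HasCompactSupport (l ∘ v) := hc.comp_left (map_zero l)
  have key := LipschitzWith.integral_lineDeriv_mul_eq (μ := volume) hA hl hlc w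
  have e1 : ∀ y, lineDeriv ℝ a y w = a' y w := fun y => ((ha y).hasLineDerivAt w).lineDeriv
  simp only [map_smul, smul_eq_mul]
  simp only [e1, Function.comp_apply] at key
  rw [key, ← integral_neg]
  refine integral_congr_ae ?_
  filter_upwards [hv.ae_differentiableAt (μ := volume)] with y hy
  have : HasFDerivAt (l ∘ v) (l ∘L fderiv ℝ v y) y := l.hasFDerivAt.comp y hy.hasFDerivAt
  rw [(this.hasLineDerivAt _).lineDeriv]
  simp [mul_comm]

/-- The Cauchy–Pompeiu formula with the regularised kernel, in which the pole is smeared out. -/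
theorem integral_kernelVec_mul_dirac {n : ℕ} {ε : ℝ} (hε : 0 < ε) {v : Euc n → Cl n} {C : ℝ≥0}
    (hv : LipschitzWith C v) (hc : HasCompactSupport v) (x : Euc n) :
    ∫ y, vecCLM n (kernelVec n ε (x - y)) * dirac v y =
      -∫ y, (n * (ε * (‖x - y‖ ^ 2 + ε) ^ (-(n : ℝ) / 2 - 1))) • v y := by
  have hpos : ∀ z : Euc n, 0 < ‖z‖ ^ 2 + ε := fun z => by positivity
  obtain ⟨A, hA⟩ := exists_lipschitzWith_kernelVec n hε
  have hKc : Continuous fun y => kernelVec n ε (x - y) :=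
    hA.continuous.comp (continuous_const.sub continuous_id)
  have hK'c : Continuous fun y => kernelDeriv n ε (x - y) :=
    (continuous_iff_continuousAt.2 fun z => continuousAt_kernelDeriv (hpos z)).comp
      (continuous_const.sub continuous_id)
  let P (i : Fin n) : Euc n →L[ℝ] ℝ := EuclideanSpace.proj i
  have hcoord (i : Fin n) : Continuous fun y => kernelVec n ε (x - y) i :=
    (P i).continuous.comp hKc
  have hparts (i j : Fin n) : ∫ y, kernelVec n ε (x - y) i • fderiv ℝ v y (stdVec n j) =
      ∫ y, kernelDeriv n ε (x - y) (stdVec n j) i • v y := by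
    have h1 := integral_smul_fderiv_of_lipschitz (a := fun y => kernelVec n ε (x - y) i)
      (a' := fun y => -(P i ∘L kernelDeriv n ε (x - y)))
      (((P i).lipschitz.comp hA).comp
        ((LipschitzWith.const x).sub LipschitzWith.id)) (fun y => by
        have h2 : HasFDerivAt (fun y : Euc n => x - y) (-ContinuousLinearMap.id ℝ (Euc n)) y := by
          simpa using (hasFDerivAt_id y).const_sub x
        refine ((P i).hasFDerivAt.comp y
          ((hasFDerivAt_kernelVec (hpos (x - y))).comp y h2)).congr_fderiv ?_
        ext; simp) (by fun_prop) hv hc (stdVec n j)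
    rw [h1, ← integral_neg]
    simp [P]
  have hi1 (i j : Fin n) : Integrable fun y =>
      kernelVec n ε (x - y) i • fderiv ℝ v y (stdVec n j) :=
    integrable_smul_fderiv (hcoord i) hv hc _
  have hi2 (i j : Fin n) : Integrable fun y =>
      kernelDeriv n ε (x - y) (stdVec n j) i • v y :=
    (Continuous.smul ((P i).continuous.comp (hK'c.clm_apply continuous_const))
      hv.continuous).integrable_of_hasCompactSupport hc.smul_left
  have e1 : ∀ y, vecCLM n (kernelVec n ε (x - y)) * dirac v y = ∑ i, ∑ j,
      mulCLM n (gen n i * gen n j) (kernelVec n ε (x - y) i • fderiv ℝ v y (stdVec n j)) := by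
    intro y
    rw [← sum_smul_gen, dirac, Finset.sum_mul_sum]
    simp [mul_assoc]
  have e2 : ∀ y, -((n * (ε * (‖x - y‖ ^ 2 + ε) ^ (-(n : ℝ) / 2 - 1))) • v y) = ∑ i, ∑ j,
      mulCLM n (gen n i * gen n j) (kernelDeriv n ε (x - y) (stdVec n j) i • v y) := by
    intro y
    have h3 := congrArg (· * v y) (sum_sum_gen_mul_kernelDeriv (hpos (x - y)))
    simp only [smul_mul_assoc, one_mul, neg_mul, neg_smul, Finset.sum_mul] at h3
    rw [← h3]
    simp
  rw [← integral_neg]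
  simp_rw [e1, e2]
  rw [integral_finsetSum _ fun i _ => integrable_finsetSum _ fun j _ =>
      (mulCLM n _).integrable_comp (hi1 i j),
    integral_finsetSum _ fun i _ => integrable_finsetSum _ fun j _ =>
      (mulCLM n _).integrable_comp (hi2 i j)]
  refine Finset.sum_congr rfl fun i _ => ?_
  rw [integral_finsetSum _ fun j _ => (mulCLM n _).integrable_comp (hi1 i j),
    integral_finsetSum _ fun j _ => (mulCLM n _).integrable_comp (hi2 i j)]
  refine Finset.sum_congr rfl fun j _ => ?_
  rw [ContinuousLinearMap.integral_comp_comm _ (hi1 i j),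
    ContinuousLinearMap.integral_comp_comm _ (hi2 i j), hparts]

/-- The normalising constant of the Cauchy kernel (the area of the unit sphere, although only the
following expression for it is used). -/
def cauchyConst (n : ℕ) : ℝ := ∫ x : Euc n, n * (1 + ‖x‖ ^ 2) ^ (-(n : ℝ) / 2 - 1)

theorem integrable_cauchyConst (n : ℕ) :
    Integrable fun x : Euc n => (1 + ‖x‖ ^ 2) ^ (-(n : ℝ) / 2 - 1) := by
  have := integrable_rpow_neg_one_add_norm_sq (E := Euc n) (μ := volume) (r := n + 2)
    (by rw [finrank_euclideanSpace_fin]; linarith)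
  convert this using 3
  ring

theorem cauchyConst_pos {n : ℕ} (hn : 2 ≤ n) : 0 < cauchyConst n := by
  have hn' : (0 : ℝ) < n := by positivity
  have := nontrivial_euc hn
  refine (integral_pos_iff_support_of_nonneg (fun x => by positivity)
    ((integrable_cauchyConst n).const_mul _)).2 ?_
  have : Function.support (fun x : Euc n => (n : ℝ) * (1 + ‖x‖ ^ 2) ^ (-(n : ℝ) / 2 - 1)) = univ :=
    eq_univ_of_forall fun x => ne_of_gt (by positivity)
  rw [this]
  exact Measure.measure_univ_pos.2 (NeZero.ne _)

/-- The Cauchy kernel `-x / (σ |x|ⁿ)`, the fundamental solution of the Dirac operator. -/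
def cauchyKernel (n : ℕ) (x : Euc n) : Cl n :=
  -(cauchyConst n)⁻¹ • vecCLM n (kernelVec n 0 x)

theorem norm_cauchyKernel_le {n : ℕ} (hn : 2 ≤ n) (x : Euc n) :
    ‖cauchyKernel n x‖ ≤ (cauchyConst n)⁻¹ * ‖vecCLM n‖ * ‖x‖ ^ (1 - (n : ℝ)) := by
  have hσ := cauchyConst_pos hn
  rw [cauchyKernel, norm_smul, norm_neg, Real.norm_of_nonneg (by positivity), mul_assoc]
  gcongr
  exact ((vecCLM n).le_opNorm _).trans (by gcongr; exact norm_kernelVec_le le_rfl x)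

/-- As `c → ∞`, the smeared pole with `ε = c⁻²` concentrates at the point `x`. -/
theorem tendsto_integral_pole {n : ℕ} (hn : 2 ≤ n) {v : Euc n → Cl n} (hv : Continuous v)
    (hc : HasCompactSupport v) (x : Euc n) :
    Tendsto (fun c : ℝ => (cauchyConst n)⁻¹ • ∫ y, (n * ((c ^ 2)⁻¹ *
      (‖x - y‖ ^ 2 + (c ^ 2)⁻¹) ^ (-(n : ℝ) / 2 - 1))) • v y) atTop (𝓝 (v x)) := by
  have hσ := cauchyConst_pos hn
  set φ : Euc n → ℝ := fun x => (cauchyConst n)⁻¹ * (n * (1 + ‖x‖ ^ 2) ^ (-(n : ℝ) / 2 - 1))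
    with hφ
  have hφ0 : ∀ x, 0 ≤ φ x := fun x => by positivity
  have hφ1 : ∫ x, φ x = 1 := by
    rw [integral_const_mul]; exact inv_mul_cancel₀ hσ.ne'
  have hφt : Tendsto (fun x => ‖x‖ ^ Module.finrank ℝ (Euc n) * φ x)
      (Bornology.cobounded (Euc n)) (𝓝 0) := by
    rw [finrank_euclideanSpace_fin]
    have hup : Tendsto (fun x : Euc n => (cauchyConst n)⁻¹ * n * ‖x‖⁻¹)
        (Bornology.cobounded (Euc n)) (𝓝 0) := by
      simpa using (tendsto_inv_atTop_zero.comp tendsto_norm_cobounded_atTop).const_mul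
        ((cauchyConst n)⁻¹ * n)
    refine tendsto_of_tendsto_of_tendsto_of_le_of_le' tendsto_const_nhds hup
      (Eventually.of_forall fun x => by positivity) ?_
    filter_upwards [tendsto_norm_cobounded_atTop.eventually_ge_atTop 1] with x hx
    have hx0 : 0 < ‖x‖ := by linarith
    have h1 : (1 + ‖x‖ ^ 2) ^ (-(n : ℝ) / 2 - 1) ≤ (‖x‖ ^ 2) ^ (-(n : ℝ) / 2 - 1) :=
      Real.rpow_le_rpow_of_nonpos (by positivity) (by linarith)
        (by have : (0 : ℝ) ≤ n := by positivity
            linarith)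
    have h2 : (‖x‖ ^ 2) ^ (-(n : ℝ) / 2 - 1) = ‖x‖ ^ (-(n : ℝ)) * ‖x‖ ^ (-2 : ℝ) := by
      rw [← Real.rpow_add hx0, ← Real.rpow_natCast, ← Real.rpow_mul hx0.le]
      congr 1; push_cast; ring
    have h3 : ‖x‖ ^ n * ‖x‖ ^ (-(n : ℝ)) = 1 := by
      rw [Real.rpow_neg hx0.le, Real.rpow_natCast]; field_simp
    have h4 : ‖x‖ ^ (-2 : ℝ) ≤ ‖x‖⁻¹ := by
      rw [← Real.rpow_neg_one]
      exact Real.rpow_le_rpow_of_exponent_le hx (by norm_num)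
    calc ‖x‖ ^ n * φ x ≤ ‖x‖ ^ n *
          ((cauchyConst n)⁻¹ * (n * (‖x‖ ^ (-(n : ℝ)) * ‖x‖ ^ (-2 : ℝ)))) := by
            rw [← h2]; simp only [hφ]; gcongr
      _ = (cauchyConst n)⁻¹ * n * (‖x‖ ^ n * ‖x‖ ^ (-(n : ℝ))) * ‖x‖ ^ (-2 : ℝ) := by ring
      _ ≤ (cauchyConst n)⁻¹ * n * 1 * ‖x‖⁻¹ := by rw [h3]; gcongr
      _ = _ := by ring
  have hg : Continuous fun y => v (x - y) := hv.comp (continuous_const.sub continuous_id)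
  have hgi : Integrable fun y => v (x - y) :=
    (hv.integrable_of_hasCompactSupport hc).comp_sub_left x
  have key := tendsto_integral_comp_smul_smul_of_integrable (μ := volume) hφ0 hφ1 hφt hgi
    hg.continuousAt
  simp only [sub_zero] at key
  refine key.congr' ?_
  filter_upwards [eventually_gt_atTop 0] with c hc0
  rw [← integral_smul, ← integral_sub_left_eq_self
    (fun y => (cauchyConst n)⁻¹ • (n * ((c ^ 2)⁻¹ *
      (‖x - y‖ ^ 2 + (c ^ 2)⁻¹) ^ (-(n : ℝ) / 2 - 1))) • v y) volume x]
  refine integral_congr_ae (Eventually.of_forall fun y => ?_)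
  simp only [smul_smul, sub_sub_cancel, finrank_euclideanSpace_fin]
  congr 1
  have h5 : ‖y‖ ^ 2 + (c ^ 2)⁻¹ = (c ^ 2)⁻¹ * (1 + ‖c • y‖ ^ 2) := by
    rw [norm_smul, mul_pow, Real.norm_eq_abs, sq_abs]; field_simp; ring
  have h6 : ((c ^ 2)⁻¹) ^ (-(n : ℝ) / 2 - 1) = c ^ n * c ^ 2 := by
    rw [← Real.rpow_natCast c 2, ← Real.rpow_neg hc0.le, ← Real.rpow_mul hc0.le,
      ← Real.rpow_natCast c n, ← Real.rpow_add hc0]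
    congr 1; push_cast; ring
  rw [h5, Real.mul_rpow (by positivity) (by positivity), h6]
  simp only [hφ]
  field_simp

/-- **Cauchy–Pompeiu formula** for compactly supported Lipschitz functions, whose derivative exists
almost everywhere by Rademacher's theorem. -/
theorem cauchy_pompeiu {n : ℕ} (hn : 2 ≤ n) {v : Euc n → Cl n} {C : ℝ≥0}
    (hv : LipschitzWith C v) (hc : HasCompactSupport v) (x : Euc n) :
    ∫ y, cauchyKernel n (x - y) * dirac v y = v x := by
  have hσ := cauchyConst_pos hn
  have hlim := tendsto_integral_pole hn hv.continuous hc x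
  refine tendsto_nhds_unique ?_ hlim
  have hrepr : ∀ᶠ c : ℝ in atTop, ∫ y, (-(cauchyConst n)⁻¹ •
      vecCLM n (kernelVec n (c ^ 2)⁻¹ (x - y))) * dirac v y =
      (cauchyConst n)⁻¹ • ∫ y, (n * ((c ^ 2)⁻¹ *
      (‖x - y‖ ^ 2 + (c ^ 2)⁻¹) ^ (-(n : ℝ) / 2 - 1))) • v y := by
    filter_upwards [eventually_gt_atTop 0] with c hc0
    simp_rw [smul_mul_assoc]
    rw [integral_smul, integral_kernelVec_mul_dirac (by positivity) hv hc]
    simp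
  refine Tendsto.congr' hrepr ?_
  have hdz : ∀ y ∉ tsupport v, dirac v y = 0 := fun y hy => by
    have : fderiv ℝ v y = 0 := by
      by_contra h
      exact hy (support_fderiv_subset ℝ h)
    rw [dirac_eq, this, map_zero]
  have hmeas : ∀ ε, AEStronglyMeasurable (fun y => (-(cauchyConst n)⁻¹ •
      vecCLM n (kernelVec n ε (x - y))) * dirac v y) volume := fun ε => by
    have h1 : StronglyMeasurable fun y => kernelVec n ε (x - y) :=
      ((measurable_kernelVec n ε).comp (measurable_const.sub measurable_id)).stronglyMeasurable
    have h2 : StronglyMeasurable fun y => -(cauchyConst n)⁻¹ • vecCLM n (kernelVec n ε (x - y)) :=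
      ((vecCLM n).continuous.comp_stronglyMeasurable h1).const_smul (-(cauchyConst n)⁻¹)
    exact (mulCLM n).aestronglyMeasurable_comp₂ h2.aestronglyMeasurable
      (stronglyMeasurable_dirac v).aestronglyMeasurable
  obtain ⟨B, hB⟩ := exists_bound_integral_norm_sub_rpow hn (t := n - 1)
    (by have : (2 : ℝ) ≤ n := by exact_mod_cast hn
        linarith) (by linarith) (D := tsupport v) hc.isCompact.measure_lt_top
  refine tendsto_integral_filter_of_dominated_convergence
    ((tsupport v).indicator fun y => ‖mulCLM n‖ * ((cauchyConst n)⁻¹ * (‖vecCLM n‖ *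
      ‖x - y‖ ^ (-((n : ℝ) - 1)))) * (‖symbolCLM n‖ * C))
    (Eventually.of_forall fun c => hmeas _) ?_ ?_ ?_
  · refine Eventually.of_forall fun c => Eventually.of_forall fun y => ?_
    by_cases hy : y ∈ tsupport v
    · rw [indicator_of_mem hy]
      refine (norm_mul_le_mulCLM _ _).trans ?_
      rw [norm_smul, norm_neg, Real.norm_of_nonneg (by positivity)]
      have h1 := norm_kernelVec_le (n := n) (ε := (c ^ 2)⁻¹) (by positivity) (x - y)
      rw [show 1 - (n : ℝ) = -((n : ℝ) - 1) by ring] at h1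
      gcongr
      · exact ((vecCLM n).le_opNorm _).trans (by gcongr)
      · exact (norm_dirac_le v y).trans (by gcongr; exact norm_fderiv_le_of_lipschitz ℝ hv)
    · rw [hdz y hy, indicator_of_notMem hy]; simp
  · rw [integrable_indicator_iff hc.isCompact.measurableSet]
    exact (((((hB x).1).const_mul _).const_mul _).const_mul _).mul_const _
  · have hae : ∀ᵐ y : Euc n, y ≠ x := by
      have := nontrivial_euc hn
      simp [ae_iff]
    filter_upwards [hae] with y hy
    have hpos : (0 : ℝ) < ‖x - y‖ ^ 2 + 0 := by
      have : 0 < ‖x - y‖ := norm_pos_iff.2 (sub_ne_zero.2 hy.symm)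
      positivity
    have h1 : Tendsto (fun c : ℝ => (c ^ 2)⁻¹) atTop (𝓝 0) :=
      (tendsto_pow_atTop (by norm_num)).inv_tendsto_atTop
    have h2 : Tendsto (fun c : ℝ => kernelVec n (c ^ 2)⁻¹ (x - y)) atTop
        (𝓝 (kernelVec n 0 (x - y))) := by
      refine Tendsto.smul_const ?_ (x - y)
      exact (h1.const_add (‖x - y‖ ^ 2)).rpow_const (Or.inl hpos.ne')
    have h3 := (((vecCLM n).continuous.tendsto _).comp h2).const_smul (-(cauchyConst n)⁻¹)
    exact (((mulCLM n).flip (dirac v y)).continuous.tendsto _).comp h3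

/-! ### McShane extensions and cutoffs -/

/-- A modulus of continuity `ω` for which `ω(t)/t` is nonincreasing. -/
structure IsModulus (ω : ℝ → ℝ) : Prop where
  zero : ω 0 = 0
  nonneg : ∀ t, 0 ≤ t → 0 ≤ ω t
  mono : ∀ s t, 0 ≤ s → s ≤ t → ω s ≤ ω t
  star : ∀ s t, 0 < s → s ≤ t → s * ω t ≤ t * ω s

namespace IsModulus

variable {ω ω' : ℝ → ℝ}

theorem min (h : IsModulus ω) (h' : IsModulus ω') : IsModulus fun t => min (ω t) (ω' t) where
  zero := by simp [h.zero, h'.zero]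
  nonneg t ht := le_min (h.nonneg t ht) (h'.nonneg t ht)
  mono s t hs hst := min_le_min (h.mono s t hs hst) (h'.mono s t hs hst)
  star s t hs hst := by
    rw [mul_min_of_nonneg _ _ hs.le, mul_min_of_nonneg _ _ (hs.le.trans hst)]
    exact min_le_min (h.star s t hs hst) (h'.star s t hs hst)

theorem const_mul (h : IsModulus ω) {c : ℝ} (hc : 0 ≤ c) : IsModulus fun t => c * ω t where
  zero := by simp [h.zero]
  nonneg t ht := mul_nonneg hc (h.nonneg t ht)
  mono s t hs hst := mul_le_mul_of_nonneg_left (h.mono s t hs hst) hc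
  star s t hs hst := by
    have := mul_le_mul_of_nonneg_left (h.star s t hs hst) hc
    linarith

theorem rpow {s : ℝ} (h0 : 0 < s) (h1 : s ≤ 1) : IsModulus fun t => t ^ s where
  zero := Real.zero_rpow h0.ne'
  nonneg t ht := Real.rpow_nonneg ht s
  mono a b ha hab := Real.rpow_le_rpow ha hab h0.le
  star a b ha hab := by
    have hb : 0 < b := ha.trans_le hab
    have h2 : a ^ (1 - s) ≤ b ^ (1 - s) := Real.rpow_le_rpow ha.le hab (by linarith)
    calc a * b ^ s = a ^ s * a ^ (1 - s) * b ^ s := by rw [← Real.rpow_add ha]; simp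
      _ ≤ a ^ s * b ^ (1 - s) * b ^ s := by gcongr
      _ = b ^ (1 - s) * b ^ s * a ^ s := by ring
      _ = b * a ^ s := by rw [← Real.rpow_add hb]; simp

theorem le_add (h : IsModulus ω) {a b c : ℝ} (hc : 0 ≤ c) (ha : 0 ≤ a) (hb : 0 ≤ b)
    (habc : c ≤ a + b) : ω c ≤ ω a + ω b := by
  rcases ha.eq_or_lt with rfl | ha'
  · rw [h.zero]; linarith [h.mono c b hc (by linarith)]
  rcases hb.eq_or_lt with rfl | hb'
  · rw [h.zero]; linarith [h.mono c a hc (by linarith)]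
  have h1 := h.star a (a + b) ha' (by linarith)
  have h2 := h.star b (a + b) hb' (by linarith)
  have h3 : (a + b) * ω (a + b) ≤ (a + b) * (ω a + ω b) := by linarith
  exact (h.mono c _ hc habc).trans (le_of_mul_le_mul_left h3 (by linarith))

/-- Beyond the distance `d`, a modulus is Lipschitz with constant `ω(d)/d`. -/
theorem le_add_slope (h : IsModulus ω) {a b d : ℝ} (hd : 0 < d) (hda : d ≤ a) {e : ℝ} (he : 0 ≤ e)
    (hb : 0 ≤ b) (hbe : b ≤ a + e) : ω b ≤ ω a + ω d / d * e := by
  have ha : 0 < a := hd.trans_le hda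
  have h1 : ω b ≤ ω (a + e) := h.mono _ _ hb hbe
  have h2 : a * ω (a + e) ≤ (a + e) * ω a := h.star a (a + e) ha (by linarith)
  have h3 : d * ω a ≤ a * ω d := h.star d a hd hda
  have h4 : ω a ≤ a * (ω d / d) := by
    rw [← mul_div_assoc, le_div_iff₀ hd]; linarith
  have h5 : a * ω (a + e) ≤ a * (ω a + ω d / d * e) := by nlinarith
  exact h1.trans (le_of_mul_le_mul_left h5 ha)

end IsModulus

/-- The McShane extension of `f|_K` with modulus `ω`. -/
def mcShane {X : Type*} [PseudoMetricSpace X] (ω : ℝ → ℝ) (K : Set X) (f : X → ℝ) (x : X) : ℝ :=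
  ⨅ s : K, (f s + ω (dist x s))

section mcShane

variable {X : Type*} [PseudoMetricSpace X] {ω : ℝ → ℝ} {K : Set X} {f : X → ℝ}

theorem bddBelow_mcShane (hω : IsModulus ω)
    (hf : ∀ x ∈ K, ∀ y ∈ K, |f x - f y| ≤ ω (dist x y)) (x : X) :
    BddBelow (range fun s : K => f s + ω (dist x s)) := by
  rcases K.eq_empty_or_nonempty with rfl | ⟨s0, hs0⟩
  · simp [range_eq_empty]
  refine ⟨f s0 - ω (dist x s0), ?_⟩
  rintro _ ⟨s, rfl⟩
  have h1 := (abs_le.1 (hf s s.2 s0 hs0)).1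
  have h2 : ω (dist (s : X) s0) ≤ ω (dist x s) + ω (dist x s0) :=
    hω.le_add dist_nonneg dist_nonneg dist_nonneg (by
      rw [dist_comm x s]; exact dist_triangle _ _ _)
  linarith

theorem mcShane_le_add (hω : IsModulus ω) (hK : K.Nonempty)
    (hf : ∀ x ∈ K, ∀ y ∈ K, |f x - f y| ≤ ω (dist x y)) {x y : X} {c : ℝ}
    (h : ∀ s ∈ K, ω (dist x s) ≤ ω (dist y s) + c) : mcShane ω K f x ≤ mcShane ω K f y + c := by
  have : Nonempty K := hK.to_subtype
  rw [← sub_le_iff_le_add]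
  refine le_ciInf fun s => ?_
  have h1 := ciInf_le (bddBelow_mcShane hω hf x) s
  have h2 := h s s.2
  change mcShane ω K f x ≤ _ at h1
  linarith

theorem mcShane_eqOn (hω : IsModulus ω) (hf : ∀ x ∈ K, ∀ y ∈ K, |f x - f y| ≤ ω (dist x y)) :
    EqOn (mcShane ω K f) f K := by
  intro x hx
  have : Nonempty K := ⟨⟨x, hx⟩⟩
  refine le_antisymm ?_ (le_ciInf fun s => ?_)
  · have := ciInf_le (bddBelow_mcShane hω hf x) ⟨x, hx⟩
    simp only [dist_self, hω.zero, add_zero] at this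
    exact this
  · linarith [(abs_le.1 (hf x hx s s.2)).2]

theorem abs_mcShane_sub_le (hω : IsModulus ω) (hK : K.Nonempty)
    (hf : ∀ x ∈ K, ∀ y ∈ K, |f x - f y| ≤ ω (dist x y)) (x y : X) :
    |mcShane ω K f x - mcShane ω K f y| ≤ ω (dist x y) := by
  have key : ∀ x y, mcShane ω K f x ≤ mcShane ω K f y + ω (dist x y) := fun x y =>
    mcShane_le_add hω hK hf fun s _ => by
      rw [add_comm]; exact hω.le_add dist_nonneg dist_nonneg dist_nonneg (dist_triangle _ _ _)
  rw [abs_sub_le_iff]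
  exact ⟨by linarith [key x y], by rw [dist_comm]; linarith [key y x]⟩

/-- At distance at least `d` from `K`, the McShane extension has the Lipschitz constant `ω(d)/d`
of the modulus. -/
theorem abs_mcShane_sub_le_slope (hω : IsModulus ω) (hK : K.Nonempty)
    (hf : ∀ x ∈ K, ∀ y ∈ K, |f x - f y| ≤ ω (dist x y)) {d : ℝ} (hd : 0 < d) {x y : X}
    (hx : d ≤ Metric.infDist x K) (hy : d ≤ Metric.infDist y K) :
    |mcShane ω K f x - mcShane ω K f y| ≤ ω d / d * dist x y := by
  have key : ∀ x y, d ≤ Metric.infDist y K →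
      mcShane ω K f x ≤ mcShane ω K f y + ω d / d * dist x y := fun x y hy =>
    mcShane_le_add hω hK hf fun s hs => hω.le_add_slope hd
      (hy.trans (Metric.infDist_le_dist_of_mem hs)) dist_nonneg dist_nonneg (by
        rw [add_comm]; exact dist_triangle _ _ _)
  rw [abs_sub_le_iff]
  exact ⟨by linarith [key x y hy], by rw [dist_comm]; linarith [key y x hx]⟩

end mcShane

/-- Vector-valued McShane extension, applied coordinatewise; the constant depends only on the
target space. -/
theorem exists_mcShane_extension (X V : Type*) [PseudoMetricSpace X] [NormedAddCommGroup V]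
    [NormedSpace ℝ V] [FiniteDimensional ℝ V] :
    ∃ C : ℝ, 0 ≤ C ∧ ∀ (ω : ℝ → ℝ) (K : Set X) (f : X → V), IsModulus ω → K.Nonempty →
      (∀ x ∈ K, ∀ y ∈ K, ‖f x - f y‖ ≤ ω (dist x y)) →
      ∃ F : X → V, EqOn F f K ∧ (∀ x y, ‖F x - F y‖ ≤ C * ω (dist x y)) ∧
        ∀ d, 0 < d → ∀ x y, d ≤ Metric.infDist x K → d ≤ Metric.infDist y K →
          ‖F x - F y‖ ≤ C * (ω d / d) * dist x y := by
  let e := (Module.finBasis ℝ V).equivFunL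
  let e₁ : V →L[ℝ] Fin (Module.finrank ℝ V) → ℝ := e
  let e₂ : (Fin (Module.finrank ℝ V) → ℝ) →L[ℝ] V := e.symm
  refine ⟨‖e₂‖ * ‖e₁‖, by positivity, fun ω K f hω hK hf => ?_⟩
  have hω' : IsModulus fun t => ‖e₁‖ * ω t := hω.const_mul (norm_nonneg _)
  have hf' (i) : ∀ x ∈ K, ∀ y ∈ K,
      |e (f x) i - e (f y) i| ≤ ‖e₁‖ * ω (dist x y) := by
    intro x hx y hy
    calc |e (f x) i - e (f y) i| = ‖(e (f x - f y)) i‖ := by rw [map_sub]; rfl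
      _ ≤ ‖e (f x - f y)‖ := norm_le_pi_norm _ i
      _ ≤ ‖e₁‖ * ‖f x - f y‖ := e₁.le_opNorm _
      _ ≤ _ := by gcongr; exact hf x hx y hy
  let G : X → Fin (Module.finrank ℝ V) → ℝ := fun x i =>
    mcShane (fun t => ‖e₁‖ * ω t) K (fun y => e (f y) i) x
  have hG : ∀ x y (c : ℝ), (∀ i, |G x i - G y i| ≤ ‖e₁‖ * c) → 0 ≤ c →
      ‖e.symm (G x) - e.symm (G y)‖ ≤ ‖e₂‖ * ‖e₁‖ * c := by
    intro x y c h hc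
    rw [← map_sub, mul_assoc]
    refine (e₂.le_opNorm _).trans ?_
    gcongr
    exact (pi_norm_le_iff_of_nonneg (by positivity)).2 h
  refine ⟨fun x => e.symm (G x), fun x hx => ?_, fun x y => ?_, fun d hd x y hx hy => ?_⟩
  · rw [ContinuousLinearEquiv.symm_apply_eq]
    funext i
    exact mcShane_eqOn hω' (hf' i) hx
  · exact hG x y _ (fun i => abs_mcShane_sub_le hω' hK (hf' i) x y) (hω.nonneg _ dist_nonneg)
  · rw [mul_assoc]
    refine hG x y _ (fun i => ?_)
      (mul_nonneg (div_nonneg (hω.nonneg d hd.le) hd.le) dist_nonneg)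
    refine (abs_mcShane_sub_le_slope hω' hK (hf' i) hd hx hy).trans (le_of_eq ?_)
    ring

/-- The radial cutoff that is `1` on the ball of radius `a` around `p`, and `0` outside the ball of
radius `b`. -/
def cutoff {X : Type*} [PseudoMetricSpace X] (p : X) (a b : ℝ) (x : X) : ℝ :=
  max 0 (min 1 ((b - dist x p) / (b - a)))

section cutoff

variable {X : Type*} [PseudoMetricSpace X] {p : X} {a b : ℝ}

theorem cutoff_nonneg (x : X) : 0 ≤ cutoff p a b x := le_max_left _ _

theorem cutoff_le_one (x : X) : cutoff p a b x ≤ 1 := max_le zero_le_one (min_le_left _ _)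

theorem cutoff_eq_one (hab : a < b) {x : X} (hx : dist x p ≤ a) : cutoff p a b x = 1 := by
  have : 1 ≤ (b - dist x p) / (b - a) := by rw [le_div_iff₀ (by linarith)]; linarith
  rw [cutoff, min_eq_left this, max_eq_right zero_le_one]

theorem cutoff_eq_zero (hab : a < b) {x : X} (hx : b ≤ dist x p) : cutoff p a b x = 0 := by
  have : (b - dist x p) / (b - a) ≤ 0 := div_nonpos_of_nonpos_of_nonneg (by linarith) (by linarith)
  rw [cutoff, max_eq_left ((min_le_right _ _).trans this)]

theorem lipschitzWith_cutoff (hab : a < b) : LipschitzWith (b - a)⁻¹.toNNReal (cutoff p a b) := by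
  have h1 : LipschitzWith (b - a)⁻¹.toNNReal fun x => (b - dist x p) / (b - a) := by
    refine LipschitzWith.of_dist_le_mul fun x y => ?_
    have hpos : 0 < (b - a)⁻¹ := inv_pos.2 (by linarith)
    rw [Real.coe_toNNReal _ hpos.le, Real.dist_eq, ← sub_div, div_eq_inv_mul, abs_mul,
      abs_of_pos hpos]
    gcongr
    rw [sub_sub_sub_cancel_left, abs_sub_comm]
    exact abs_dist_sub_le x y p
  exact (h1.const_min 1).const_max 0

end cutoff

/-- The product of a Lipschitz cutoff supported in `B` and a function that is bounded and Lipschitz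
on `B` is Lipschitz. -/
theorem lipschitzOnWith_smul {X V : Type*} [PseudoMetricSpace X] [NormedAddCommGroup V]
    [NormedSpace ℝ V] {χ : X → ℝ} {u : X → V} {B T : Set X} {A L M : ℝ≥0}
    (hχ : LipschitzWith A χ) (hχ1 : ∀ x, |χ x| ≤ 1) (hχB : ∀ x ∉ B, χ x = 0)
    (hu : LipschitzOnWith L u (B ∩ T)) (huM : ∀ x ∈ B, ‖u x‖ ≤ M) :
    LipschitzOnWith (A * M + L) (fun x => χ x • u x) T := by
  have key : ∀ x ∈ T, ∀ y ∈ T, x ∈ B → dist (χ x • u x) (χ y • u y) ≤ (A * M + L) * dist x y := by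
    intro x hxT y hyT hx
    have h2 : |χ x - χ y| ≤ A * dist x y := by
      rw [← Real.dist_eq]; exact hχ.dist_le_mul x y
    by_cases hy : y ∈ B
    · have h1 : ‖u y - u x‖ ≤ L * dist x y := by
        rw [← dist_eq_norm, dist_comm]; exact hu.dist_le_mul x ⟨hx, hxT⟩ y ⟨hy, hyT⟩
      have e : χ x • u x - χ y • u y = (χ x - χ y) • u x - χ y • (u y - u x) := by module
      rw [dist_eq_norm, e]
      refine (norm_sub_le _ _).trans ?_
      rw [norm_smul, norm_smul, Real.norm_eq_abs, Real.norm_eq_abs]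
      calc _ ≤ A * dist x y * M + 1 * (L * dist x y) := by
            gcongr
            · exact huM x hx
            · exact hχ1 y
        _ = _ := by ring
    · have h3 := hχB y hy
      rw [h3, sub_zero] at h2
      rw [h3, zero_smul, dist_zero_right, norm_smul, Real.norm_eq_abs]
      calc _ ≤ A * dist x y * M := by gcongr; exact huM x hx
        _ ≤ _ := by
          have : 0 ≤ (L : ℝ) * dist x y := by positivity
          linarith
  refine LipschitzOnWith.of_dist_le_mul fun x hx y hy => ?_
  push_cast
  by_cases hxB : x ∈ B
  · exact key x hx y hy hxB
  by_cases hyB : y ∈ B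
  · rw [dist_comm, dist_comm x]; exact key y hy x hx hyB
  · rw [hχB x hxB, hχB y hyB]; simp only [zero_smul, dist_self]; positivity

/-! ### Removability of boundaries of small Hausdorff dimension -/

theorem norm_dirac_smul_le {n : ℕ} {χ : Euc n → ℝ} {w : Euc n → Cl n} {y : Euc n}
    (hχ : DifferentiableAt ℝ χ y) (hw : DifferentiableAt ℝ w y) (h0 : dirac w y = 0) :
    ‖dirac (fun z => χ z • w z) y‖ ≤ ‖symbolCLM n‖ * (‖fderiv ℝ χ y‖ * ‖w y‖) := by
  rw [dirac_eq, fderiv_fun_smul hχ hw, map_add, map_smul, ← dirac_eq, h0, smul_zero, zero_add]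
  refine ((symbolCLM n).le_opNorm _).trans ?_
  rw [ContinuousLinearMap.norm_smulRight_apply]

/-- A compact set of vanishing `s`-dimensional Hausdorff measure is covered by finitely many balls
with centres on it and arbitrarily small `∑ rᵢˢ`. -/
theorem exists_finite_ball_cover {X : Type*} [MetricSpace X] [Nonempty X]
    [MeasurableSpace X] [BorelSpace X] {S : Set X} (hS : IsCompact S) {s : ℝ} (hs : 0 < s)
    (h0 : Measure.hausdorffMeasure s S = 0) {ε : ℝ} (hε : 0 < ε) :
    ∃ (T : Finset ℕ) (x : ℕ → X) (r : ℕ → ℝ), (∀ i ∈ T, x i ∈ S ∧ 0 < r i) ∧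
      (S ⊆ ⋃ i ∈ T, Metric.ball (x i) (r i)) ∧ ∑ i ∈ T, r i ^ s ≤ ε := by
  rcases S.eq_empty_or_nonempty with rfl | ⟨p, hp⟩
  · exact ⟨∅, fun _ => Classical.arbitrary X, fun _ => 1, by simp, by simp, by simpa using hε.le⟩
  have hε2 : (0 : ℝ≥0∞) < ENNReal.ofReal (ε / 2) := by simpa using hε
  obtain ⟨δ, hδ0, hδ⟩ := ENNReal.exists_pos_sum_of_countable hε2.ne' ℕ
  rw [Measure.hausdorffMeasure_apply] at h0
  have h1 := le_of_eq h0
  have h2 := (iSup₂_le_iff.1 h1 1 one_pos)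
  have h3 := h2.trans_lt hε2
  simp only [iInf_lt_iff] at h3
  obtain ⟨t, hSt, htd, hsum⟩ := h3
  have hr : ∀ k, ∃ r : ℝ, 0 < r ∧ Metric.ediam (t k) < ENNReal.ofReal r ∧
      ENNReal.ofReal (r ^ s) ≤ (⨆ _ : (t k).Nonempty, Metric.ediam (t k) ^ s) + δ k := by
    intro k
    have hfin : Metric.ediam (t k) ≠ ∞ := ((htd k).trans_lt ENNReal.one_lt_top).ne
    set d := (Metric.ediam (t k)).toReal with hd
    have hd0 : 0 ≤ d := ENNReal.toReal_nonneg
    have hc : ContinuousAt (fun r : ℝ => r ^ s) d := Real.continuousAt_rpow_const d s (Or.inr hs.le)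
    have hlt : d ^ s < d ^ s + δ k := by have := hδ0 k; simpa using this
    have hev := (hc.eventually_lt continuousAt_const hlt).filter_mono
      (nhdsWithin_le_nhds (s := Ioi d))
    obtain ⟨r, hr1, hr2⟩ := (hev.and self_mem_nhdsWithin).exists
    have hr0 : 0 < r := hd0.trans_lt hr2
    refine ⟨r, hr0, ?_, ?_⟩
    · rw [← ENNReal.ofReal_toReal hfin]
      exact (ENNReal.ofReal_lt_ofReal_iff hr0).2 hr2
    · have e1 : ENNReal.ofReal (d ^ s) = Metric.ediam (t k) ^ s := by
        rw [← ENNReal.ofReal_rpow_of_nonneg hd0 hs.le, ENNReal.ofReal_toReal hfin]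
      have e2 : Metric.ediam (t k) ^ s ≤ ⨆ _ : (t k).Nonempty, Metric.ediam (t k) ^ s := by
        rcases (t k).eq_empty_or_nonempty with he | he
        · simp [he, hs]
        · exact le_iSup_of_le he le_rfl
      calc ENNReal.ofReal (r ^ s) ≤ ENNReal.ofReal (d ^ s + δ k) := ENNReal.ofReal_le_ofReal hr1.le
        _ = ENNReal.ofReal (d ^ s) + δ k := by
          rw [ENNReal.ofReal_add (by positivity) (by positivity)]; simp
        _ ≤ _ := by rw [e1]; gcongr
  choose r hr0 hrd hrs using hr
  have hx : ∀ k, ∃ x : X, (t k ∩ S).Nonempty → x ∈ t k ∩ S := fun k => by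
    by_cases h : (t k ∩ S).Nonempty
    · exact ⟨h.some, fun _ => h.some_mem⟩
    · exact ⟨p, fun h' => absurd h' h⟩
  choose x hx using hx
  obtain ⟨b, hb, hbf, hbS⟩ := hS.elim_finite_subcover_image (b := {k | (t k ∩ S).Nonempty})
    (c := fun k => Metric.ball (x k) (r k)) (fun _ _ => Metric.isOpen_ball) (by
      intro y hy
      obtain ⟨k, hk⟩ := mem_iUnion.1 (hSt hy)
      have hne : (t k ∩ S).Nonempty := ⟨y, hk, hy⟩
      refine mem_iUnion₂.2 ⟨k, hne, ?_⟩
      rw [← Metric.eball_ofReal, Metric.mem_eball]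
      exact (Metric.edist_le_ediam_of_mem hk (hx k hne).1).trans_lt (hrd k))
  refine ⟨hbf.toFinset, x, r, fun i hi => ⟨(hx i (hb (hbf.mem_toFinset.1 hi))).2, hr0 i⟩,
    by simpa using hbS, ?_⟩
  have hfinal : ENNReal.ofReal (∑ i ∈ hbf.toFinset, r i ^ s) ≤ ENNReal.ofReal ε := by
    rw [ENNReal.ofReal_sum_of_nonneg fun i _ => Real.rpow_nonneg (hr0 i).le s]
    calc _ ≤ ∑ i ∈ hbf.toFinset, ((⨆ _ : (t i).Nonempty, Metric.ediam (t i) ^ s) + δ i) :=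
          Finset.sum_le_sum fun i _ => hrs i
      _ ≤ ∑' i, ((⨆ _ : (t i).Nonempty, Metric.ediam (t i) ^ s) + (δ i : ℝ≥0∞)) :=
          ENNReal.sum_le_tsum _
      _ = (∑' i, ⨆ _ : (t i).Nonempty, Metric.ediam (t i) ^ s) + ∑' i, (δ i : ℝ≥0∞) :=
          ENNReal.tsum_add
      _ ≤ ENNReal.ofReal (ε / 2) + ENNReal.ofReal (ε / 2) := add_le_add hsum.le hδ.le
      _ = ENNReal.ofReal ε := by
        rw [← ENNReal.ofReal_add (by linarith) (by linarith)]; congr 1; ring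
  exact (ENNReal.ofReal_le_ofReal_iff hε.le).1 hfinal

/-- A function that is Hölder continuous on a compact set `K` and `C¹` near `K` has a Lipschitz
extension from `K` whose gradient in the complementary balls obeys the bound that the Hölder
exponent suggests. -/
theorem exists_lipschitz_extension (n : ℕ) : ∃ C : ℝ, 0 ≤ C ∧
    ∀ (K U : Set (Euc n)) (w : Euc n → Cl n) (M μ : ℝ), IsCompact K → K.Nonempty → IsOpen U →
      K ⊆ U → ContDiffOn ℝ 1 w U → 0 ≤ M → 0 < μ → μ ≤ 1 →
      (∀ x ∈ K, ∀ y ∈ K, ‖w x - w y‖ ≤ M * dist x y ^ μ) →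
      ∃ (F : Euc n → Cl n) (L : ℝ≥0), LipschitzWith L F ∧ EqOn F w K ∧
        ∀ (a : Euc n) (ρ : ℝ), Disjoint K (Metric.ball a ρ) → ∀ y ∈ Metric.ball a ρ,
          ‖fderiv ℝ F y‖ ≤ C * M * (ρ - dist y a) ^ (μ - 1) := by
  obtain ⟨C, hC, hext⟩ := exists_mcShane_extension (Euc n) (Cl n)
  refine ⟨C * 2, by positivity, fun K U w M μ hK hKne hU hKU hw hM hμ hμ1 hhol => ?_⟩
  have hloc : LocallyLipschitzOn K w := by
    intro x hx
    obtain ⟨c, t, ht, hlip⟩ := (hw.contDiffAt (hU.mem_nhds (hKU hx))).exists_lipschitzOnWith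
    exact ⟨c, t, mem_nhdsWithin_of_mem_nhds ht, hlip⟩
  obtain ⟨L, hL⟩ := hloc.exists_lipschitzOnWith_of_compact hK
  -- the linear term makes `F` globally Lipschitz without spoiling the Hölder bound
  have hω : IsModulus fun t => min (M * t ^ μ) (L * t ^ (1 : ℝ)) :=
    ((IsModulus.rpow hμ hμ1).const_mul hM).min
      ((IsModulus.rpow one_pos le_rfl).const_mul L.coe_nonneg)
  obtain ⟨F, hF1, hF2, hF3⟩ := hext _ K w hω hKne (fun x hx y hy => le_min (hhol x hx y hy) (by
    rw [Real.rpow_one, ← dist_eq_norm]; exact hL.dist_le_mul x hx y hy))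
  refine ⟨F, C.toNNReal * L, LipschitzWith.of_dist_le_mul fun x y => ?_, hF1, ?_⟩
  · rw [dist_eq_norm]
    refine (hF2 x y).trans ?_
    push_cast
    rw [Real.coe_toNNReal _ hC, mul_assoc]
    gcongr
    refine (min_le_right _ _).trans (by simp)
  · intro a ρ hdisj y hy
    rw [Metric.mem_ball] at hy
    set δ := ρ - dist y a with hδ
    have hδ0 : 0 < δ := by linarith
    have hfar : ∀ z ∈ Metric.ball y (δ / 2), δ / 2 ≤ Metric.infDist z K := by
      intro z hz
      rw [Metric.mem_ball] at hz
      refine (Metric.le_infDist hKne).2 fun k hk => ?_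
      have h1 : ρ ≤ dist k a := by
        by_contra h
        exact disjoint_left.1 hdisj hk (Metric.mem_ball.2 (not_le.1 h))
      have h2 := dist_triangle4 k z y a
      rw [dist_comm k z] at h2
      linarith
    have hlip : LipschitzOnWith (C * 2 * M * δ ^ (μ - 1)).toNNReal F (Metric.ball y (δ / 2)) := by
      refine LipschitzOnWith.of_dist_le_mul fun p hp q hq => ?_
      rw [Real.coe_toNNReal _ (by positivity), dist_eq_norm]
      refine (hF3 (δ / 2) (by positivity) p q (hfar p hp) (hfar q hq)).trans ?_
      rw [show C * 2 * M * δ ^ (μ - 1) = C * (2 * M * δ ^ (μ - 1)) by ring]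
      gcongr
      have h3 : (δ / 2) ^ (μ - 1) ≤ 2 * δ ^ (μ - 1) := by
        rw [Real.div_rpow hδ0.le (by norm_num), div_eq_inv_mul, ← Real.rpow_neg (by norm_num)]
        gcongr
        calc (2 : ℝ) ^ (-(μ - 1)) ≤ 2 ^ (1 : ℝ) :=
              Real.rpow_le_rpow_of_exponent_le (by norm_num) (by linarith)
          _ = 2 := by norm_num
      rw [div_le_iff₀ (by positivity)]
      refine (min_le_left _ _).trans ?_
      calc M * (δ / 2) ^ μ = M * ((δ / 2) ^ (μ - 1) * (δ / 2)) := by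
            rw [Real.rpow_sub_one (by positivity)]; field_simp
        _ ≤ M * (2 * δ ^ (μ - 1) * (δ / 2)) := by gcongr
        _ = _ := by ring
    have := norm_fderiv_le_of_lipschitzOn ℝ (Metric.ball_mem_nhds y (by positivity)) hlip
    rwa [Real.coe_toNNReal _ (by positivity)] at this

/-- Let `F` agree with the monogenic function `w` outside finitely many balls that cover `S`, and
let `χ` be the cutoff between the radii `R/2` and `R`. Then `∂(χ F)` is carried by these balls,
where it is bounded by the boundary-layer functions, and by the annulus where `χ` varies, where it is
`O(sup |w| / R)`. -/
theorem norm_dirac_cutoff_smul_le {n : ℕ} {S : Set (Euc n)} (hS : IsClosed S) {w F : Euc n → Cl n}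
    (hw : IsMonogenicOn w Sᶜ) {R ε A μ : ℝ} (hR : 0 < R) (hA : 0 ≤ A) (hε : 0 ≤ ε)
    (hwR : ∀ y, R / 2 ≤ ‖y‖ → ‖w y‖ ≤ ε) {T : Finset ℕ} {x : ℕ → Euc n} {r : ℕ → ℝ}
    (hr : ∀ i ∈ T, 0 < r i) (hS' : S ⊆ ⋃ i ∈ T, Metric.ball (x i) (r i))
    (hN : ∀ i ∈ T, Metric.ball (x i) (r i) ⊆ Metric.ball 0 (R / 2))
    (hF : EqOn F w (Metric.closedBall 0 R \ ⋃ i ∈ T, Metric.ball (x i) (r i)))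
    (hFd : ∀ i ∈ T, ∀ y ∈ Metric.ball (x i) (r i),
      ‖fderiv ℝ F y‖ ≤ A * (r i - dist y (x i)) ^ (μ - 1)) {y : Euc n}
    (hy1 : ‖y‖ ≠ R / 2) (hy2 : ‖y‖ ≠ R) (hy3 : ∀ i ∈ T, y ∉ Metric.sphere (x i) (r i))
    (hχ : DifferentiableAt ℝ (cutoff (0 : Euc n) (R / 2) R) y) :
    ‖dirac (fun z => cutoff 0 (R / 2) R z • F z) y‖ ≤
      ‖symbolCLM n‖ * A * ∑ i ∈ T, r i ^ (μ - 1) * layer n μ ((r i)⁻¹ • (y - x i)) +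
      (Metric.ball 0 R \ Metric.ball 0 (R / 2)).indicator
        (fun _ => ‖symbolCLM n‖ * (2 / R * ε)) y := by
  have hRlt : R / 2 < R := by linarith
  have hterm : ∀ i ∈ T, 0 ≤ r i ^ (μ - 1) * layer n μ ((r i)⁻¹ • (y - x i)) := fun i hi =>
    mul_nonneg (Real.rpow_nonneg (hr i hi).le _) (layer_nonneg _)
  have hsum0 : 0 ≤ ‖symbolCLM n‖ * A *
      ∑ i ∈ T, r i ^ (μ - 1) * layer n μ ((r i)⁻¹ • (y - x i)) :=
    mul_nonneg (by positivity) (Finset.sum_nonneg hterm)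
  have hind0 : 0 ≤ (Metric.ball (0 : Euc n) R \ Metric.ball 0 (R / 2)).indicator
        (fun _ => ‖symbolCLM n‖ * (2 / R * ε)) y := indicator_nonneg (fun _ _ => by positivity) y
  have hinner : ‖y‖ < R / 2 → dirac (fun z => cutoff 0 (R / 2) R z • F z) y = dirac F y := by
    intro h
    refine dirac_congr ?_
    filter_upwards [Metric.isOpen_ball.mem_nhds (mem_ball_zero_iff.2 h)] with z hz
    rw [cutoff_eq_one hRlt (Metric.mem_ball.1 hz).le, one_smul]
  by_cases hyN : ∃ i ∈ T, y ∈ Metric.ball (x i) (r i)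
  · obtain ⟨i, hi, hyi⟩ := hyN
    rw [hinner (mem_ball_zero_iff.1 (hN i hi hyi))]
    have h1 : ‖dirac F y‖ ≤ ‖symbolCLM n‖ * A *
        (r i ^ (μ - 1) * layer n μ ((r i)⁻¹ • (y - x i))) := by
      rw [scaled_layer_apply (hr i hi) hyi, mul_assoc]
      exact (norm_dirac_le F y).trans (by gcongr; exact hFd i hi y hyi)
    have h2 := Finset.single_le_sum hterm hi
    have h3 := mul_le_mul_of_nonneg_left h2 (by positivity : 0 ≤ ‖symbolCLM n‖ * A)
    linarith
  push Not at hyN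
  -- `y` lies outside the closed balls, so that `F = w` near `y` if `|y| < R`
  have hyN' : ∀ᶠ z in 𝓝 y, ∀ i ∈ T, z ∉ Metric.ball (x i) (r i) := by
    rw [Filter.eventually_all_finset]
    intro i hi
    have h1 : y ∈ (Metric.closedBall (x i) (r i))ᶜ := by
      have h2 := hyN i hi
      have h3 := hy3 i hi
      simp only [Metric.mem_ball, Metric.mem_sphere, mem_compl_iff, Metric.mem_closedBall,
        not_le, not_lt] at h2 h3 ⊢
      exact lt_of_le_of_ne h2 (Ne.symm h3)
    filter_upwards [Metric.isClosed_closedBall.isOpen_compl.mem_nhds h1] with z hz hz'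
    exact hz (Metric.ball_subset_closedBall hz')
  rcases lt_or_gt_of_ne hy2 with hlt | hgt
  · have hFw : F =ᶠ[𝓝 y] w := by
      filter_upwards [hyN', Metric.isOpen_ball.mem_nhds (mem_ball_zero_iff.2 hlt)] with z hz hzR
      exact hF ⟨Metric.ball_subset_closedBall hzR, by simpa using hz⟩
    have hyS : y ∈ Sᶜ := fun h => by
      obtain ⟨i, hi, hyi⟩ := mem_iUnion₂.1 (hS' h)
      exact hyN i hi hyi
    rcases lt_or_gt_of_ne hy1 with h | h
    · rw [hinner h, dirac_congr hFw, hw.2 y hyS, norm_zero]; linarith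
    · have hwd : DifferentiableAt ℝ w y :=
        (hw.1.contDiffAt (hS.isOpen_compl.mem_nhds hyS)).differentiableAt one_ne_zero
      have e1 : dirac (fun z => cutoff 0 (R / 2) R z • F z) y =
          dirac (fun z => cutoff 0 (R / 2) R z • w z) y := by
        refine dirac_congr ?_
        filter_upwards [hFw] with z hz
        rw [hz]
      have hmem : y ∈ Metric.ball (0 : Euc n) R \ Metric.ball 0 (R / 2) := by
        simp only [Set.mem_sdiff, mem_ball_zero_iff]; exact ⟨hlt, not_lt.2 h.le⟩
      rw [e1, indicator_of_mem hmem]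
      have h1 := norm_dirac_smul_le hχ hwd (hw.2 y hyS)
      have h2 : ‖fderiv ℝ (cutoff (0 : Euc n) (R / 2) R) y‖ ≤ 2 / R := by
        refine (norm_fderiv_le_of_lipschitz ℝ (lipschitzWith_cutoff hRlt)).trans ?_
        rw [Real.coe_toNNReal _ (inv_nonneg.2 (by linarith))]
        apply le_of_eq; field_simp; ring
      have h3 : ‖symbolCLM n‖ * (‖fderiv ℝ (cutoff (0 : Euc n) (R / 2) R) y‖ * ‖w y‖) ≤
          ‖symbolCLM n‖ * (2 / R * ε) := by gcongr; exact hwR y h.le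
      linarith
  · have e1 : dirac (fun z => cutoff 0 (R / 2) R z • F z) y = dirac (fun _ => (0 : Cl n)) y := by
      refine dirac_congr ?_
      have : y ∈ (Metric.closedBall (0 : Euc n) R)ᶜ := by simpa using hgt
      filter_upwards [Metric.isClosed_closedBall.isOpen_compl.mem_nhds this] with z hz
      rw [cutoff_eq_zero hRlt (by simpa using (le_of_lt (by simpa using hz))), zero_smul]
    rw [e1, dirac_eq]
    simp only [fderiv_fun_const, Pi.zero_apply, map_zero, norm_zero]
    linarith

/-- A Hölder continuous function that is monogenic off a compact set of vanishing
`(n-1+μ)`-dimensional measure and vanishes at infinity is zero. -/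
theorem eq_zero_of_monogenic_of_hausdorffMeasure {n : ℕ} (hn : 2 ≤ n) {S : Set (Euc n)}
    (hS : IsCompact S) {w : Euc n → Cl n} (hw : IsMonogenicOn w Sᶜ) {M μ : ℝ} (hM : 0 ≤ M)
    (hμ : 0 < μ) (hμ1 : μ ≤ 1) (hhol : ∀ x y, ‖w x - w y‖ ≤ M * dist x y ^ μ)
    (hinf : Tendsto w (cocompact (Euc n)) (𝓝 0))
    (hdim : Measure.hausdorffMeasure (n - 1 + μ) S = 0) {p : Euc n} (hp : p ∉ S) : w p = 0 := by
  have hn' : (2 : ℝ) ≤ n := by exact_mod_cast hn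
  have := nontrivial_euc hn
  obtain ⟨C, hC, hext⟩ := exists_lipschitz_extension n
  have hσ := cauchyConst_pos hn
  obtain ⟨d, hd, hdS⟩ : ∃ d > 0, Metric.ball p (2 * d) ⊆ Sᶜ := by
    obtain ⟨d, hd, h⟩ := Metric.isOpen_iff.1 hS.isClosed.isOpen_compl p hp
    exact ⟨d / 2, by positivity, by rwa [mul_div_cancel₀ _ two_ne_zero]⟩
  obtain ⟨R0, hR0⟩ := hS.isBounded.subset_ball (0 : Euc n)
  set c1 := ‖mulCLM n‖ * ((cauchyConst n)⁻¹ * ‖vecCLM n‖) with hc1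
  have hc10 : 0 ≤ c1 := by positivity
  set V := volume.real (Metric.ball (0 : Euc n) 1) with hV
  have hV0 : 0 ≤ V := measureReal_nonneg
  set a1 := c1 * d ^ (1 - (n : ℝ)) * (‖symbolCLM n‖ * (C * M)) * ∫ y, layer n μ y with ha1
  have ha10 : 0 ≤ a1 := mul_nonneg (by positivity) (integral_nonneg fun y => layer_nonneg y)
  set a2 := c1 * 4 ^ ((n : ℝ) - 1) * ‖symbolCLM n‖ * 2 * V with ha2
  have ha20 : 0 ≤ a2 := by positivity
  suffices h : ∀ ε > 0, ‖w p‖ ≤ a1 * ε + a2 * ε by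
    have h0 : ‖w p‖ ≤ 0 := by
      refine le_of_forall_pos_le_add fun η hη => ?_
      have h1 := h (η / (a1 + a2 + 1)) (by positivity)
      have h2 : a1 * (η / (a1 + a2 + 1)) + a2 * (η / (a1 + a2 + 1)) ≤ η := by
        rw [← add_mul, ← mul_div_assoc, div_le_iff₀ (by positivity)]; nlinarith
      linarith
    exact norm_le_zero_iff.1 h0
  intro ε hε
  obtain ⟨R, hR, hRp, hRS, hwR⟩ : ∃ R > 0, ‖p‖ ≤ R / 4 ∧ R0 + d ≤ R / 2 ∧
      ∀ y : Euc n, R / 2 ≤ ‖y‖ → ‖w y‖ ≤ ε := by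
    rw [← Metric.cobounded_eq_cocompact] at hinf
    have h1 : ∀ᶠ y in Bornology.cobounded (Euc n), ‖w y‖ ≤ ε := by
      filter_upwards [(Metric.tendsto_nhds.1 hinf) ε hε] with y hy
      rw [dist_zero_right] at hy; exact hy.le
    obtain ⟨R1, hR1⟩ := (Filter.hasBasis_cobounded_norm.eventually_iff).1 h1
    refine ⟨max (2 * R1) (max (4 * ‖p‖) (max (2 * (R0 + d)) 1)), by positivity, ?_, ?_,
      fun y hy => hR1.2 ?_⟩
    · have := (le_max_left (4 * ‖p‖) (max (2 * (R0 + d)) 1)).trans (le_max_right (2 * R1) _)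
      linarith
    · have := ((le_max_left (2 * (R0 + d)) 1).trans (le_max_right (4 * ‖p‖) _)).trans
        (le_max_right (2 * R1) _)
      linarith
    · have := le_max_left (2 * R1) (max (4 * ‖p‖) (max (2 * (R0 + d)) 1))
      simp only [mem_ofPred_eq]
      linarith
  have hs : 0 < (n : ℝ) - 1 + μ := by linarith
  -- the second bound on `∑ rᵢˢ` keeps the radii below `d`, hence the balls away from `p`
  obtain ⟨T, x, r, hTr, hTS, hTsum⟩ := exists_finite_ball_cover hS hs hdim
    (ε := min ε ((d / 2) ^ ((n : ℝ) - 1 + μ))) (lt_min hε (by positivity))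
  have hrd : ∀ i ∈ T, r i < d := by
    intro i hi
    have h1 : r i ^ ((n : ℝ) - 1 + μ) ≤ (d / 2) ^ ((n : ℝ) - 1 + μ) :=
      (Finset.single_le_sum (f := fun i => r i ^ ((n : ℝ) - 1 + μ))
        (fun j hj => Real.rpow_nonneg (hTr j hj).2.le _) hi).trans (hTsum.trans (min_le_right _ _))
    have := (Real.rpow_le_rpow_iff (hTr i hi).2.le (by positivity) hs).1 h1
    linarith
  have hNfar : ∀ i ∈ T, ∀ y ∈ Metric.ball (x i) (r i), d ≤ dist p y := by
    intro i hi y hy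
    have h1 : 2 * d ≤ dist (x i) p := by
      by_contra h
      exact hdS (Metric.mem_ball.2 (not_le.1 h)) (hTr i hi).1
    have h2 := dist_triangle (x i) y p
    rw [dist_comm (x i) y, dist_comm y p] at h2
    have := hrd i hi
    have := Metric.mem_ball.1 hy
    linarith
  have hNR : ∀ i ∈ T, Metric.ball (x i) (r i) ⊆ Metric.ball 0 (R / 2) := by
    intro i hi y hy
    have h1 := Metric.mem_ball.1 (hR0 (hTr i hi).1)
    have h2 := dist_triangle y (x i) 0
    have := hrd i hi
    have := Metric.mem_ball.1 hy
    rw [Metric.mem_ball]; linarith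
  set K := Metric.closedBall (0 : Euc n) R \ ⋃ i ∈ T, Metric.ball (x i) (r i) with hK
  have hKc : IsCompact K := (isCompact_closedBall _ _).diff
    (isOpen_biUnion fun _ _ => Metric.isOpen_ball)
  have hpK : p ∈ K := by
    refine ⟨by simp only [Metric.mem_closedBall, dist_zero_right]; linarith, fun h => ?_⟩
    obtain ⟨i, hi, hpi⟩ := mem_iUnion₂.1 h
    have := hNfar i hi p hpi
    rw [dist_self] at this; linarith
  obtain ⟨F, L, hFL, hFw, hFd⟩ := hext K Sᶜ w M μ hKc ⟨p, hpK⟩ hS.isClosed.isOpen_compl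
    (fun y hy hyS => hy.2 (hTS hyS)) hw.1 hM hμ hμ1 (fun x _ y _ => hhol x y)
  have hRlt : R / 2 < R := by linarith
  set v : Euc n → Cl n := fun z => cutoff 0 (R / 2) R z • F z with hv
  obtain ⟨B, hB⟩ := (isCompact_closedBall (0 : Euc n) R).exists_bound_of_continuousOn
    hFL.continuous.continuousOn
  have hvlip := (lipschitzOnWith_smul (χ := cutoff (0 : Euc n) (R / 2) R) (u := F)
    (B := Metric.closedBall 0 R) (T := univ) (M := B.toNNReal) (lipschitzWith_cutoff hRlt)
    (fun z => by rw [abs_of_nonneg (cutoff_nonneg z)]; exact cutoff_le_one z)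
    (fun z hz => cutoff_eq_zero hRlt (by
      rw [Metric.mem_closedBall] at hz; exact (not_le.1 hz).le))
    (hFL.lipschitzOnWith) (fun z hz => (hB z hz).trans (Real.le_coe_toNNReal B)))
  rw [lipschitzOnWith_univ] at hvlip
  have hvc : HasCompactSupport v := HasCompactSupport.intro (isCompact_closedBall 0 R)
    fun z hz => by
      rw [Metric.mem_closedBall] at hz
      simp only [hv, cutoff_eq_zero hRlt (not_le.1 hz).le, zero_smul]
  have hcp : ∫ y, cauchyKernel n (p - y) * dirac v y = v p := cauchy_pompeiu hn hvlip hvc p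
  have hvp : v p = w p := by
    simp only [hv]
    rw [cutoff_eq_one hRlt (by rw [dist_zero_right]; linarith), one_smul, hFw hpK]
  rw [hvp] at hcp
  rw [← hcp]
  -- the majorant of the Cauchy–Pompeiu integrand
  set b : Euc n → ℝ := fun y => c1 * d ^ (1 - (n : ℝ)) * (‖symbolCLM n‖ * (C * M)) *
      (∑ i ∈ T, r i ^ (μ - 1) * layer n μ ((r i)⁻¹ • (y - x i))) +
      c1 * (R / 4) ^ (1 - (n : ℝ)) * (Metric.ball (0 : Euc n) R).indicator
        (fun _ => ‖symbolCLM n‖ * (2 / R * ε)) y with hb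
  have hbi1 : Integrable fun y => ∑ i ∈ T, r i ^ (μ - 1) * layer n μ ((r i)⁻¹ • (y - x i)) :=
    integrable_finsetSum _ fun i hi => integrable_scaled_layer hn hμ (hTr i hi).2 (x i)
  have hbi2 : Integrable ((Metric.ball (0 : Euc n) R).indicator
      fun _ => ‖symbolCLM n‖ * (2 / R * ε)) :=
    (integrable_indicator_iff measurableSet_ball).2 (integrableOn_const measure_ball_lt_top.ne)
  have hbound : ‖∫ y, cauchyKernel n (p - y) * dirac v y‖ ≤ ∫ y, b y := by
    refine norm_integral_le_of_norm_le ((hbi1.const_mul _).add (hbi2.const_mul _)) ?_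
    have hsph : ∀ (a : Euc n) (ρ : ℝ), ∀ᵐ y : Euc n, y ∉ Metric.sphere a ρ := fun a ρ => by
      rw [ae_iff]; simp only [not_not, ofPred_mem_eq]; exact Measure.addHaar_sphere volume a ρ
    have hsphT : ∀ᵐ y : Euc n, ∀ i ∈ T, y ∉ Metric.sphere (x i) (r i) := by
      rw [Filter.eventually_all_finset]
      exact fun i _ => hsph (x i) (r i)
    filter_upwards [hsph 0 (R / 2), hsph 0 R, hsphT,
      (lipschitzWith_cutoff (p := (0 : Euc n)) hRlt).ae_differentiableAt (μ := volume)]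
      with y hy1 hy2 hy3 hy4
    have hdir := norm_dirac_cutoff_smul_le hS.isClosed hw (A := C * M) hR (by positivity) hε.le hwR
      (fun i hi => (hTr i hi).2) hTS hNR hFw
      (fun i hi => hFd (x i) (r i) (disjoint_left.2 fun z hz hz' =>
        hz.2 (mem_iUnion₂.2 ⟨i, hi, hz'⟩))) (by simpa using hy1) (by simpa using hy2) hy3 hy4
    refine (norm_mul_le_mulCLM _ _).trans ?_
    have hker : ‖mulCLM n‖ * ‖cauchyKernel n (p - y)‖ ≤ c1 * ‖p - y‖ ^ (1 - (n : ℝ)) := by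
      rw [hc1, mul_assoc ‖mulCLM n‖]
      gcongr
      exact norm_cauchyKernel_le hn _
    have hsum : ‖p - y‖ ^ (1 - (n : ℝ)) *
        (∑ i ∈ T, r i ^ (μ - 1) * layer n μ ((r i)⁻¹ • (y - x i))) ≤
        d ^ (1 - (n : ℝ)) * (∑ i ∈ T, r i ^ (μ - 1) * layer n μ ((r i)⁻¹ • (y - x i))) := by
      rw [Finset.mul_sum, Finset.mul_sum]
      refine Finset.sum_le_sum fun i hi => ?_
      by_cases hyi : y ∈ Metric.ball (x i) (r i)
      · have h1 : ‖p - y‖ ^ (1 - (n : ℝ)) ≤ d ^ (1 - (n : ℝ)) :=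
          Real.rpow_le_rpow_of_nonpos hd (by rw [← dist_eq_norm]; exact hNfar i hi y hyi)
            (by linarith)
        have := mul_nonneg (Real.rpow_nonneg (hTr i hi).2.le (μ - 1))
          (layer_nonneg (μ := μ) ((r i)⁻¹ • (y - x i)))
        gcongr
      · have h1 : (r i)⁻¹ • (y - x i) ∉ Metric.ball (0 : Euc n) 1 := by
          have h0 := (hTr i hi).2
          rw [mem_ball_zero_iff, norm_smul, norm_inv, Real.norm_of_nonneg h0.le, ← dist_eq_norm,
            inv_mul_lt_iff₀ h0, mul_one]
          exact hyi
        rw [layer, indicator_of_notMem h1]; simp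
    have hann : ‖p - y‖ ^ (1 - (n : ℝ)) * (Metric.ball 0 R \ Metric.ball 0 (R / 2)).indicator
        (fun _ => ‖symbolCLM n‖ * (2 / R * ε)) y ≤ (R / 4) ^ (1 - (n : ℝ)) *
        (Metric.ball (0 : Euc n) R).indicator (fun _ => ‖symbolCLM n‖ * (2 / R * ε)) y := by
      by_cases hy : y ∈ Metric.ball (0 : Euc n) R \ Metric.ball 0 (R / 2)
      · rw [indicator_of_mem hy, indicator_of_mem hy.1]
        have h1 : R / 4 ≤ ‖p - y‖ := by
          have h2 := hy.2
          rw [mem_ball_zero_iff, not_lt] at h2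
          have h3 := norm_sub_norm_le y p
          rw [norm_sub_rev] at h3
          linarith
        have h4 : ‖p - y‖ ^ (1 - (n : ℝ)) ≤ (R / 4) ^ (1 - (n : ℝ)) :=
          Real.rpow_le_rpow_of_nonpos (by positivity) h1 (by linarith)
        gcongr
      · rw [indicator_of_notMem hy, mul_zero]
        exact mul_nonneg (by positivity) (indicator_nonneg (fun _ _ => by positivity) y)
    calc ‖mulCLM n‖ * ‖cauchyKernel n (p - y)‖ * ‖dirac v y‖
        ≤ c1 * ‖p - y‖ ^ (1 - (n : ℝ)) * _ :=
          mul_le_mul hker hdir (norm_nonneg _) (by positivity)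
      _ = c1 * (‖symbolCLM n‖ * (C * M)) * (‖p - y‖ ^ (1 - (n : ℝ)) *
            (∑ i ∈ T, r i ^ (μ - 1) * layer n μ ((r i)⁻¹ • (y - x i)))) +
          c1 * (‖p - y‖ ^ (1 - (n : ℝ)) * (Metric.ball 0 R \ Metric.ball 0 (R / 2)).indicator
            (fun _ => ‖symbolCLM n‖ * (2 / R * ε)) y) := by ring
      _ ≤ _ := add_le_add (mul_le_mul_of_nonneg_left hsum (by positivity))
          (mul_le_mul_of_nonneg_left hann hc10)
      _ = b y := by simp only [hb]; ring
  refine hbound.trans ?_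
  have hint : ∫ y, b y = c1 * d ^ (1 - (n : ℝ)) * (‖symbolCLM n‖ * (C * M)) *
      (∑ i ∈ T, r i ^ ((n : ℝ) - 1 + μ) * ∫ y, layer n μ y) +
      c1 * (R / 4) ^ (1 - (n : ℝ)) * (R ^ n * V * (‖symbolCLM n‖ * (2 / R * ε))) := by
    rw [hb, integral_add (hbi1.const_mul _) (hbi2.const_mul _), integral_const_mul,
      integral_const_mul, integral_finsetSum _ fun i hi =>
        integrable_scaled_layer hn hμ (hTr i hi).2 (x i),
      Finset.sum_congr rfl fun i hi => integral_scaled_layer (hTr i hi).2 (x i),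
      integral_indicator measurableSet_ball, setIntegral_const, smul_eq_mul,
      measureReal_def, Measure.addHaar_ball _ _ hR.le, ENNReal.toReal_mul, ← measureReal_def,
      ENNReal.toReal_ofReal (by positivity), finrank_euclideanSpace_fin]
  rw [hint, ← Finset.sum_mul]
  refine add_le_add ?_ (le_of_eq ?_)
  · have h1 : ∑ i ∈ T, r i ^ ((n : ℝ) - 1 + μ) ≤ ε := hTsum.trans (min_le_left _ _)
    have h2 : 0 ≤ ∫ y, layer n μ y := integral_nonneg fun y => layer_nonneg y
    calc _ ≤ c1 * d ^ (1 - (n : ℝ)) * (‖symbolCLM n‖ * (C * M)) * (ε * ∫ y, layer n μ y) := by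
          gcongr
      _ = _ := by rw [ha1]; ring
  · have h1 : (R / 4) ^ (1 - (n : ℝ)) * R ^ n = R * 4 ^ ((n : ℝ) - 1) := by
      rw [Real.div_rpow hR.le (by norm_num), ← Real.rpow_natCast R n, div_mul_eq_mul_div,
        ← Real.rpow_add hR, div_eq_mul_inv, ← Real.rpow_neg (by norm_num)]
      congr 2
      · simp
      · ring
    calc _ = c1 * ((R / 4) ^ (1 - (n : ℝ)) * R ^ n) * V * (‖symbolCLM n‖ * (2 / R * ε)) := by ring
      _ = _ := by rw [h1, ha2]; field_simp

/-! ### The Cauchy transform -/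

/-- The Cauchy (Teodorescu) transform `T f`, a right inverse of the Dirac operator. -/
def cauchyTransform {n : ℕ} (f : Euc n → Cl n) (x : Euc n) : Cl n :=
  ∫ y, cauchyKernel n (x - y) * f y

theorem ae_ne_euc {n : ℕ} (hn : 2 ≤ n) (x : Euc n) : ∀ᵐ y : Euc n, y ≠ x := by
  have := nontrivial_euc hn
  simp [ae_iff]

theorem stronglyMeasurable_cauchyKernel (n : ℕ) : StronglyMeasurable (cauchyKernel n) :=
  ((vecCLM n).continuous.comp_stronglyMeasurable
    (measurable_kernelVec n 0).stronglyMeasurable).const_smul (-(cauchyConst n)⁻¹)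

theorem aestronglyMeasurable_cauchyKernel_mul {n : ℕ} {f : Euc n → Cl n}
    (hf : AEStronglyMeasurable f) (x : Euc n) :
    AEStronglyMeasurable fun y => cauchyKernel n (x - y) * f y :=
  (mulCLM n).aestronglyMeasurable_comp₂ ((stronglyMeasurable_cauchyKernel n).comp_measurable
    (measurable_const.sub measurable_id)).aestronglyMeasurable hf

theorem integrable_cauchyKernel_mul {n : ℕ} (hn : 2 ≤ n) {f : Euc n → Cl n}
    (hf : AEStronglyMeasurable f) {x : Euc n}
    (hfx : Integrable fun y => ‖x - y‖ ^ (1 - (n : ℝ)) * ‖f y‖) :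
    Integrable fun y => cauchyKernel n (x - y) * f y := by
  refine (hfx.const_mul (‖mulCLM n‖ * ((cauchyConst n)⁻¹ * ‖vecCLM n‖))).mono'
    (aestronglyMeasurable_cauchyKernel_mul hf x) (Eventually.of_forall fun y => ?_)
  refine (norm_mul_le_mulCLM _ _).trans ?_
  calc _ ≤ ‖mulCLM n‖ * ((cauchyConst n)⁻¹ * ‖vecCLM n‖ * ‖x - y‖ ^ (1 - (n : ℝ))) * ‖f y‖ := by
        gcongr; exact norm_cauchyKernel_le hn _
    _ = _ := by ring

/-- The weakly singular potentials `∫ |x - y|^{-t} |f(y)| dy` of `f ∈ L^q` are bounded uniformly in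
`x`, by Young's inequality, as long as `t q' < n` for the conjugate exponent `q'`. -/
theorem exists_bound_integral_norm_sub_rpow_mul {n : ℕ} (hn : 2 ≤ n) {D : Set (Euc n)}
    (hDm : MeasurableSet D) (hD : volume D < ∞) {f : Euc n → Cl n} (hf : AEStronglyMeasurable f)
    (hfD : ∀ y ∉ D, f y = 0) {q q' t : ℝ} (hq : q'.HolderConjugate q)
    (hfq : Integrable fun y => ‖f y‖ ^ q) (ht0 : 0 ≤ t) (ht : t * q' < n) :
    ∃ C : ℝ, ∀ x : Euc n, Integrable (fun y => ‖x - y‖ ^ (-t) * ‖f y‖) ∧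
      ∫ y, ‖x - y‖ ^ (-t) * ‖f y‖ ≤ C := by
  have hq'0 : 0 < q' := hq.pos
  have hq0 : 0 < q := hq.symm.pos
  obtain ⟨C, hC⟩ := exists_bound_integral_norm_sub_rpow hn (by positivity) ht hD
  have hle : ∀ x y : Euc n, ‖x - y‖ ^ (-t) * ‖f y‖ ≤
      D.indicator (fun y => ‖x - y‖ ^ (-(t * q'))) y * q'⁻¹ + ‖f y‖ ^ q * q⁻¹ := by
    intro x y
    by_cases hy : y ∈ D
    · rw [indicator_of_mem hy]
      have := Real.young_inequality_of_nonneg (a := ‖x - y‖ ^ (-t)) (b := ‖f y‖) (by positivity)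
        (norm_nonneg _) hq
      rwa [← Real.rpow_mul (norm_nonneg _), neg_mul, div_eq_mul_inv, div_eq_mul_inv] at this
    · rw [hfD y hy, indicator_of_notMem hy]
      simp [Real.zero_rpow hq0.ne']
  have hi : ∀ x, Integrable fun y =>
      D.indicator (fun y => ‖x - y‖ ^ (-(t * q'))) y * q'⁻¹ + ‖f y‖ ^ q * q⁻¹ := fun x =>
    (((hC x).1.integrable_indicator hDm).mul_const _).add (hfq.mul_const _)
  have hi' : ∀ x : Euc n, Integrable fun y => ‖x - y‖ ^ (-t) * ‖f y‖ := fun x => by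
    refine (hi x).mono' ?_ (Eventually.of_forall fun y => ?_)
    · have : Measurable fun y : Euc n => ‖x - y‖ ^ (-t) := by fun_prop
      exact this.aestronglyMeasurable.mul hf.norm
    · rw [Real.norm_of_nonneg (by positivity)]; exact hle x y
  refine ⟨C * q'⁻¹ + (∫ y, ‖f y‖ ^ q) * q⁻¹, fun x => ⟨hi' x, ?_⟩⟩
  refine (integral_mono (hi' x) (hi x) (hle x)).trans ?_
  rw [integral_add (((hC x).1.integrable_indicator hDm).mul_const _) (hfq.mul_const _),
    integral_mul_const, integral_mul_const, integral_indicator hDm]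
  gcongr
  exact (hC x).2

theorem norm_cauchyKernel_sub_le {n : ℕ} (hn : 2 ≤ n) {s : ℝ} (hs0 : 0 ≤ s) (hs1 : s ≤ 1)
    {a b : Euc n} (ha : a ≠ 0) (hb : b ≠ 0) :
    ‖cauchyKernel n a - cauchyKernel n b‖ ≤
      (cauchyConst n)⁻¹ * ‖vecCLM n‖ * ((n + 2) * 2 ^ (n + 1) * ‖a - b‖ ^ s *
      (‖a‖ ^ (1 - (n : ℝ) - s) + ‖b‖ ^ (1 - (n : ℝ) - s))) := by
  have hσ := cauchyConst_pos hn
  rw [cauchyKernel, cauchyKernel, ← smul_sub, ← map_sub, norm_smul, norm_neg,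
    Real.norm_of_nonneg (by positivity), mul_assoc]
  gcongr
  exact ((vecCLM n).le_opNorm _).trans (by gcongr; exact norm_kernelVec_sub_le hs0 hs1 ha hb)

/-- The Cauchy transform is Hölder continuous with exponent `s` as soon as the potentials of order
`n - 1 + s` of the density are bounded. -/
theorem exists_holder_cauchyTransform {n : ℕ} (hn : 2 ≤ n) {f : Euc n → Cl n}
    (hf : AEStronglyMeasurable f)
    (hf1 : ∀ x : Euc n, Integrable fun y => ‖x - y‖ ^ (1 - (n : ℝ)) * ‖f y‖)
    {s C : ℝ} (hs0 : 0 ≤ s) (hs1 : s ≤ 1)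
    (hfs : ∀ x : Euc n, Integrable (fun y => ‖x - y‖ ^ (-((n : ℝ) - 1 + s)) * ‖f y‖) ∧
      ∫ y, ‖x - y‖ ^ (-((n : ℝ) - 1 + s)) * ‖f y‖ ≤ C) :
    ∃ M : ℝ, 0 ≤ M ∧ ∀ x y, ‖cauchyTransform f x - cauchyTransform f y‖ ≤ M * dist x y ^ s := by
  have hσ := cauchyConst_pos hn
  set A := ‖mulCLM n‖ * ((cauchyConst n)⁻¹ * ‖vecCLM n‖ * ((n + 2) * 2 ^ (n + 1))) with hA
  have hA0 : 0 ≤ A := by positivity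
  have hC0 : 0 ≤ C := (integral_nonneg fun y => by positivity).trans (hfs 0).2
  refine ⟨A * (2 * C), by positivity, fun x y => ?_⟩
  rw [cauchyTransform, cauchyTransform, ← integral_sub (integrable_cauchyKernel_mul hn hf (hf1 x))
    (integrable_cauchyKernel_mul hn hf (hf1 y))]
  have hb := ((hfs x).1.add (hfs y).1).const_mul (A * dist x y ^ s)
  refine (norm_integral_le_of_norm_le hb ?_).trans ?_
  · filter_upwards [ae_ne_euc hn x, ae_ne_euc hn y] with z hzx hzy
    rw [← sub_mul]
    refine (norm_mul_le_mulCLM _ _).trans ?_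
    have h1 := norm_cauchyKernel_sub_le hn hs0 hs1 (sub_ne_zero.2 hzx.symm) (sub_ne_zero.2 hzy.symm)
    rw [sub_sub_sub_cancel_right, ← dist_eq_norm x y,
      show 1 - (n : ℝ) - s = -((n : ℝ) - 1 + s) by ring] at h1
    refine (mul_le_mul_of_nonneg_right (mul_le_mul_of_nonneg_left h1
      (norm_nonneg (mulCLM n))) (norm_nonneg (f z))).trans (le_of_eq ?_)
    simp only [Pi.add_apply, hA]
    ring
  · simp only [Pi.add_apply]
    rw [integral_const_mul, integral_add (hfs x).1 (hfs y).1]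
    have := (hfs x).2
    have := (hfs y).2
    calc _ ≤ A * dist x y ^ s * (C + C) := by gcongr
      _ = _ := by ring

theorem tendsto_cauchyTransform_cocompact {n : ℕ} (hn : 2 ≤ n) {f : Euc n → Cl n}
    (hf : Integrable f) {r : ℝ} (hfr : ∀ y ∉ Metric.ball 0 r, f y = 0) :
    Tendsto (cauchyTransform f) (cocompact (Euc n)) (𝓝 0) := by
  have hσ := cauchyConst_pos hn
  have hn' : (2 : ℝ) ≤ n := by exact_mod_cast hn
  rw [← Metric.cobounded_eq_cocompact]
  set A := ‖mulCLM n‖ * ((cauchyConst n)⁻¹ * ‖vecCLM n‖) * ∫ y, ‖f y‖ with hA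
  have hlim : Tendsto (fun x : Euc n => A * (‖x‖ - r) ^ (-((n : ℝ) - 1)))
      (Bornology.cobounded (Euc n)) (𝓝 0) := by
    have h1 : Tendsto (fun x : Euc n => ‖x‖ - r) (Bornology.cobounded (Euc n)) atTop :=
      tendsto_atTop_add_const_right _ _ tendsto_norm_cobounded_atTop
    simpa using ((tendsto_rpow_neg_atTop (by linarith : 0 < (n : ℝ) - 1)).comp h1).const_mul A
  refine squeeze_zero_norm' ?_ hlim
  filter_upwards [tendsto_norm_cobounded_atTop.eventually_gt_atTop r] with x hx
  have hx' : 0 < ‖x‖ - r := by linarith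
  have hb := hf.norm.const_mul (‖mulCLM n‖ * ((cauchyConst n)⁻¹ * ‖vecCLM n‖) *
    (‖x‖ - r) ^ (-((n : ℝ) - 1)))
  refine (norm_integral_le_of_norm_le hb (Eventually.of_forall fun y => ?_)).trans (le_of_eq ?_)
  · by_cases hy : y ∈ Metric.ball (0 : Euc n) r
    · refine (norm_mul_le_mulCLM _ _).trans ?_
      have h1 := norm_cauchyKernel_le hn (x - y)
      have h2 : ‖x - y‖ ^ (1 - (n : ℝ)) ≤ (‖x‖ - r) ^ (-((n : ℝ) - 1)) := by
        rw [neg_sub]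
        refine Real.rpow_le_rpow_of_nonpos hx' ?_ (by linarith)
        have := norm_sub_norm_le x y
        have := mem_ball_zero_iff.1 hy
        linarith
      calc _ ≤ ‖mulCLM n‖ * ((cauchyConst n)⁻¹ * ‖vecCLM n‖ * (‖x‖ - r) ^ (-((n : ℝ) - 1))) *
            ‖f y‖ := by gcongr; exact h1.trans (by gcongr)
        _ = _ := by ring
    · simp [hfr y hy]
  · rw [integral_const_mul, hA]; ring

/-- The derivative of the Cauchy kernel. -/
def cauchyKernelDeriv (n : ℕ) (x : Euc n) : Euc n →L[ℝ] Cl n :=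
  -(cauchyConst n)⁻¹ • (vecCLM n ∘L kernelDeriv n 0 x)

theorem norm_sq_add_zero_pos {n : ℕ} {x : Euc n} (hx : x ≠ 0) : 0 < ‖x‖ ^ 2 + (0 : ℝ) := by
  have := norm_pos_iff.2 hx
  positivity

theorem hasFDerivAt_cauchyKernel {n : ℕ} {x : Euc n} (hx : x ≠ 0) :
    HasFDerivAt (cauchyKernel n) (cauchyKernelDeriv n x) x :=
  ((vecCLM n).hasFDerivAt.comp x
    (hasFDerivAt_kernelVec (norm_sq_add_zero_pos hx))).const_smul (-(cauchyConst n)⁻¹)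

theorem continuousAt_cauchyKernelDeriv {n : ℕ} {x : Euc n} (hx : x ≠ 0) :
    ContinuousAt (cauchyKernelDeriv n) x :=
  (continuousAt_const.clm_comp
    (continuousAt_kernelDeriv (norm_sq_add_zero_pos hx))).const_smul (-(cauchyConst n)⁻¹)

theorem norm_cauchyKernelDeriv_le {n : ℕ} (hn : 2 ≤ n) {x : Euc n} (hx : x ≠ 0) :
    ‖cauchyKernelDeriv n x‖ ≤
      (cauchyConst n)⁻¹ * ‖vecCLM n‖ * ((n + 1) * ‖x‖ ^ (-(n : ℝ))) := by
  have hσ := cauchyConst_pos hn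
  rw [cauchyKernelDeriv, norm_smul, norm_neg, Real.norm_of_nonneg (by positivity), mul_assoc]
  gcongr
  exact (ContinuousLinearMap.opNorm_comp_le _ _).trans
    (by gcongr; exact norm_kernelDeriv_zero_le hx)

theorem symbolCLM_cauchyKernelDeriv_mul {n : ℕ} {x : Euc n} (hx : x ≠ 0) (a : Cl n) :
    symbolCLM n ((mulCLM n).flip a ∘L cauchyKernelDeriv n x) = 0 := by
  have h := sum_gen_mul_kernelDeriv (norm_sq_add_zero_pos hx)
  simp only [zero_mul, mul_zero, neg_zero, zero_smul] at h
  have h2 : ∑ j, gen n j * cauchyKernelDeriv n x (stdVec n j) = 0 := by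
    simp only [cauchyKernelDeriv, _root_.smul_apply,
      ContinuousLinearMap.comp_apply, mul_smul_comm]
    rw [← Finset.smul_sum, h, smul_zero]
  rw [symbolCLM_apply]
  simp only [ContinuousLinearMap.comp_apply, ContinuousLinearMap.flip_apply, mulCLM_apply,
    ← mul_assoc]
  rw [← Finset.sum_mul, h2, zero_mul]

theorem stronglyMeasurable_cauchyKernelDeriv (n : ℕ) : StronglyMeasurable (cauchyKernelDeriv n) :=
  (measurable_of_continuousOn_compl_singleton 0 fun _ hx =>
    (continuousAt_cauchyKernelDeriv hx).continuousWithinAt).stronglyMeasurable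

/-- Where its density vanishes, a Cauchy transform is monogenic. -/
theorem isMonogenicOn_cauchyTransform {n : ℕ} (hn : 2 ≤ n) {f : Euc n → Cl n} (hf : Integrable f)
    {p : Euc n} {ρ : ℝ} (hρ : 0 < ρ) (hfp : ∀ y ∈ Metric.ball p (2 * ρ), f y = 0)
    (hf1 : ∀ x : Euc n, Integrable fun y => cauchyKernel n (x - y) * f y) :
    IsMonogenicOn (cauchyTransform f) (Metric.ball p ρ) := by
  have hσ := cauchyConst_pos hn
  have hfar : ∀ x ∈ Metric.ball p ρ, ∀ y, f y ≠ 0 → ρ ≤ ‖x - y‖ := by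
    intro x hx y hy
    have h1 : 2 * ρ ≤ dist y p := by
      by_contra h
      exact hy (hfp y (Metric.mem_ball.2 (not_le.1 h)))
    have h2 := dist_triangle y x p
    rw [dist_comm y x, dist_eq_norm x y] at h2
    have := Metric.mem_ball.1 hx
    linarith
  set F' : Euc n → Euc n → Euc n →L[ℝ] Cl n := fun x y =>
    (mulCLM n).flip (f y) ∘L cauchyKernelDeriv n (x - y) with hF'
  have hF'm : ∀ x, AEStronglyMeasurable (F' x) := by
    intro x
    have h1 : AEStronglyMeasurable fun y => (mulCLM n).flip (f y) :=
      (mulCLM n).flip.continuous.comp_aestronglyMeasurable hf.1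
    have h2 : AEStronglyMeasurable fun y => cauchyKernelDeriv n (x - y) :=
      ((stronglyMeasurable_cauchyKernelDeriv n).comp_measurable
        (measurable_const.sub measurable_id)).aestronglyMeasurable
    exact (ContinuousLinearMap.compL ℝ (Euc n) (Cl n) (Cl n)).aestronglyMeasurable_comp₂ h1 h2
  set A := ‖(mulCLM n).flip‖ * ((cauchyConst n)⁻¹ * ‖vecCLM n‖ * ((n + 1) * ρ ^ (-(n : ℝ))))
  have hbound : ∀ x ∈ Metric.ball p ρ, ∀ y, ‖F' x y‖ ≤ A * ‖f y‖ := by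
    intro x hx y
    by_cases hy : f y = 0
    · simp [hF', hy]
    have h1 := hfar x hx y hy
    have h2 : x - y ≠ 0 := norm_pos_iff.1 (hρ.trans_le h1)
    refine (ContinuousLinearMap.opNorm_comp_le _ _).trans ?_
    have h3 : ‖x - y‖ ^ (-(n : ℝ)) ≤ ρ ^ (-(n : ℝ)) :=
      Real.rpow_le_rpow_of_nonpos hρ h1 (by simp)
    calc _ ≤ ‖(mulCLM n).flip‖ * ‖f y‖ *
          ((cauchyConst n)⁻¹ * ‖vecCLM n‖ * ((n + 1) * ρ ^ (-(n : ℝ)))) := by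
          gcongr
          · exact (mulCLM n).flip.le_opNorm _
          · exact (norm_cauchyKernelDeriv_le hn h2).trans (by gcongr)
      _ = _ := by ring
  have hder : ∀ x ∈ Metric.ball p ρ,
      HasFDerivAt (cauchyTransform f) (∫ y, F' x y) x := by
    intro x hx
    refine hasFDerivAt_integral_of_dominated_of_fderiv_le (s := Metric.ball p ρ)
      (bound := fun y => A * ‖f y‖) (Metric.isOpen_ball.mem_nhds hx)
      (Eventually.of_forall fun x => (hf1 x).1) (hf1 x) (hF'm x)
      (Eventually.of_forall fun y x hx => hbound x hx y) (hf.norm.const_mul _)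
      (Eventually.of_forall fun y z hz => ?_)
    by_cases hy : f y = 0
    · simp only [hF', hy, mul_zero, map_zero, ContinuousLinearMap.zero_comp]
      exact hasFDerivAt_const 0 z
    have h2 : z - y ≠ 0 := norm_pos_iff.1 (hρ.trans_le (hfar z hz y hy))
    have h3 : HasFDerivAt (fun z => cauchyKernel n (z - y)) (cauchyKernelDeriv n (z - y)) z := by
      exact ((hasFDerivAt_cauchyKernel h2).comp z ((hasFDerivAt_id z).sub_const y)).congr_fderiv
        (ContinuousLinearMap.comp_id _)
    exact ((mulCLM n).flip (f y)).hasFDerivAt.comp z h3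
  have hcont : ContinuousOn (fun x => ∫ y, F' x y) (Metric.ball p ρ) := by
    intro x hx
    refine (continuousAt_of_dominated (bound := fun y => A * ‖f y‖)
      (Eventually.of_forall hF'm) ?_ (hf.norm.const_mul _)
      (Eventually.of_forall fun y => ?_)).continuousWithinAt
    · filter_upwards [Metric.isOpen_ball.mem_nhds hx] with z hz
      exact Eventually.of_forall fun y => hbound z hz y
    by_cases hy : f y = 0
    · simp only [hF', hy, map_zero, ContinuousLinearMap.zero_comp]
      exact continuousAt_const
    have h2 : x - y ≠ 0 := norm_pos_iff.1 (hρ.trans_le (hfar x hx y hy))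
    have h3 : ContinuousAt (fun z => cauchyKernelDeriv n (z - y)) x :=
      ContinuousAt.comp (g := cauchyKernelDeriv n) (continuousAt_cauchyKernelDeriv h2)
        (by fun_prop)
    exact continuousAt_const.clm_comp h3
  refine ⟨?_, fun x hx => ?_⟩
  · have h1 := (contDiffOn_succ_iff_fderiv_of_isOpen (𝕜 := ℝ) (n := 0) (f := cauchyTransform f)
      (Metric.isOpen_ball (x := p) (ε := ρ))).2
      ⟨fun x hx => (hder x hx).differentiableAt.differentiableWithinAt, by simp, by
        rw [contDiffOn_zero]
        exact hcont.congr fun x hx => (hder x hx).fderiv⟩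
    simpa using h1
  · have hi : Integrable (F' x) :=
      (hf.norm.const_mul A).mono' (hF'm x) (Eventually.of_forall (hbound x hx))
    rw [dirac_eq, (hder x hx).fderiv, ← ContinuousLinearMap.integral_comp_comm _ hi]
    rw [← integral_zero (Euc n) (Cl n)]
    refine integral_congr_ae (Eventually.of_forall fun y => ?_)
    by_cases hy : f y = 0
    · simp [hF', hy]
    · exact symbolCLM_cauchyKernelDeriv_mul
        (norm_pos_iff.1 (hρ.trans_le (hfar x hx y hy))) _

/-! ### Local structure of `u - T(∂u)` -/

theorem IsMonogenicOn.congr {n : ℕ} {u v : Euc n → Cl n} {U : Set (Euc n)} (hU : IsOpen U)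
    (hu : IsMonogenicOn u U) (h : EqOn v u U) : IsMonogenicOn v U :=
  ⟨hu.1.congr h, fun x hx => by
    rw [dirac_congr (h.eventuallyEq_of_mem (hU.mem_nhds hx)), hu.2 x hx]⟩

theorem isMonogenicOn_of_locally {n : ℕ} {u : Euc n → Cl n} {U : Set (Euc n)}
    (h : ∀ x ∈ U, ∃ V, IsOpen V ∧ x ∈ V ∧ IsMonogenicOn u V) : IsMonogenicOn u U := by
  refine ⟨fun x hx => ?_, fun x hx => ?_⟩ <;> obtain ⟨V, hV, hxV, hu⟩ := h x hx
  · exact (hu.1.contDiffAt (hV.mem_nhds hxV)).contDiffWithinAt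
  · exact hu.2 x hxV

theorem IsMonogenicOn.differentiableAt {n : ℕ} {u : Euc n → Cl n} {U : Set (Euc n)}
    (hu : IsMonogenicOn u U) (hU : IsOpen U) {x : Euc n} (hx : x ∈ U) : DifferentiableAt ℝ u x :=
  (hu.1.contDiffAt (hU.mem_nhds hx)).differentiableAt one_ne_zero

theorem IsMonogenicOn.sub {n : ℕ} {u v : Euc n → Cl n} {U : Set (Euc n)} (hU : IsOpen U)
    (hu : IsMonogenicOn u U) (hv : IsMonogenicOn v U) : IsMonogenicOn (fun x => u x - v x) U := by
  refine ⟨hu.1.sub hv.1, fun x hx => ?_⟩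
  rw [dirac_eq, fderiv_fun_sub (hu.differentiableAt hU hx) (hv.differentiableAt hU hx), map_sub,
    ← dirac_eq, ← dirac_eq, hu.2 x hx, hv.2 x hx, sub_zero]

theorem isMonogenicOn_const {n : ℕ} (c : Cl n) (U : Set (Euc n)) :
    IsMonogenicOn (fun _ => c) U :=
  ⟨contDiffOn_const, fun x _ => by rw [dirac_eq]; simp⟩

theorem integrable_rpow_mul_norm_dirac {n : ℕ} (hn : 2 ≤ n) {v : Euc n → Cl n} {L : ℝ≥0}
    (hv : LipschitzWith L v) (hc : HasCompactSupport v) {t : ℝ} (ht0 : 0 ≤ t) (ht : t < n)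
    (x : Euc n) : Integrable fun y => ‖x - y‖ ^ (-t) * ‖dirac v y‖ := by
  obtain ⟨C, hC⟩ := exists_bound_integral_norm_sub_rpow hn ht0 ht hc.isCompact.measure_lt_top
  have hm : Measurable fun y : Euc n => ‖x - y‖ ^ (-t) := by fun_prop
  refine integrable_of_bound_on_compact hc.isCompact
    (hm.aestronglyMeasurable.mul (stronglyMeasurable_dirac v).norm.aestronglyMeasurable)
    (fun y hy => ?_) ((hC x).1.mul_const (‖symbolCLM n‖ * L)) fun y _ => ?_
  · have : fderiv ℝ v y = 0 := by
      by_contra h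
      exact hy (support_fderiv_subset ℝ h)
    rw [dirac_eq, this, map_zero, norm_zero, mul_zero]
  · rw [Real.norm_of_nonneg (by positivity)]
    gcongr
    exact (norm_dirac_le v y).trans (by gcongr; exact norm_fderiv_le_of_lipschitz ℝ hv)

/-- If `∂u = f` near `p`, then `u - T f` is monogenic near `p`: by the Cauchy–Pompeiu formula for a
localisation `v` of `u`, it is the Cauchy transform of `∂v - f`, which vanishes near `p`. -/
theorem isMonogenicOn_sub_cauchyTransform {n : ℕ} (hn : 2 ≤ n) {u f : Euc n → Cl n}
    (hf : Integrable f) (hf1 : ∀ x : Euc n, Integrable fun y => ‖x - y‖ ^ (1 - (n : ℝ)) * ‖f y‖)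
    {p : Euc n} {ρ : ℝ} (hρ : 0 < ρ) {L : ℝ≥0} (hu : LipschitzOnWith L u (Metric.ball p ρ))
    (huf : ∀ y ∈ Metric.ball p ρ, f y = dirac u y) :
    IsMonogenicOn (fun x => u x - cauchyTransform f x) (Metric.ball p (ρ / 4)) := by
  have hn' : (2 : ℝ) ≤ n := by exact_mod_cast hn
  have hlt : ρ / 2 < ρ := by linarith
  set v : Euc n → Cl n := fun z => cutoff p (ρ / 2) ρ z • u z with hv
  have hub : ∀ y ∈ Metric.ball p ρ, ‖u y‖ ≤ (‖u p‖ + L * ρ).toNNReal := by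
    intro y hy
    rw [Real.coe_toNNReal _ (by positivity)]
    have h1 := hu.dist_le_mul y hy p (Metric.mem_ball_self hρ)
    have h2 : (L : ℝ) * dist y p ≤ L * ρ := by gcongr; exact (Metric.mem_ball.1 hy).le
    have h3 := norm_sub_norm_le (u y) (u p)
    rw [dist_eq_norm] at h1
    linarith
  have hvlip := lipschitzOnWith_smul (T := univ) (B := Metric.ball p ρ)
    (lipschitzWith_cutoff (p := p) hlt)
    (fun z => by rw [abs_of_nonneg (cutoff_nonneg z)]; exact cutoff_le_one z)
    (fun z hz => cutoff_eq_zero hlt (not_lt.1 hz)) (by simpa using hu) hub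
  rw [lipschitzOnWith_univ] at hvlip
  change LipschitzWith _ v at hvlip
  have hvc : HasCompactSupport v := HasCompactSupport.intro (isCompact_closedBall p ρ)
    fun z hz => by
      rw [Metric.mem_closedBall] at hz
      simp only [hv, cutoff_eq_zero hlt (not_le.1 hz).le, zero_smul]
  have hvu : EqOn v u (Metric.ball p (ρ / 2)) := fun z hz => by
    simp only [hv]
    rw [cutoff_eq_one hlt (Metric.mem_ball.1 hz).le, one_smul]
  have hdv : Integrable (dirac v) := by
    have := integrable_rpow_mul_norm_dirac hn hvlip hvc le_rfl (by positivity) 0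
    simp only [neg_zero, Real.rpow_zero, one_mul] at this
    exact (integrable_norm_iff (stronglyMeasurable_dirac v).aestronglyMeasurable).1 this
  have hi1 (x : Euc n) : Integrable fun y => cauchyKernel n (x - y) * dirac v y := by
    refine integrable_cauchyKernel_mul hn hdv.1 ?_
    have := integrable_rpow_mul_norm_dirac hn hvlip hvc (t := n - 1) (by linarith) (by linarith) x
    rwa [neg_sub] at this
  have hi2 (x : Euc n) : Integrable fun y => cauchyKernel n (x - y) * f y :=
    integrable_cauchyKernel_mul hn hf.1 (hf1 x)
  have hT : ∀ x, cauchyTransform (fun y => dirac v y - f y) x = v x - cauchyTransform f x := by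
    intro x
    rw [← cauchy_pompeiu hn hvlip hvc x, cauchyTransform, cauchyTransform,
      ← integral_sub (hi1 x) (hi2 x)]
    simp only [mul_sub]
  have hmon := isMonogenicOn_cauchyTransform hn (hdv.sub hf) (p := p) (ρ := ρ / 4)
    (by positivity) (fun y hy => by
      have hy' : y ∈ Metric.ball p (ρ / 2) := by
        rwa [show 2 * (ρ / 4) = ρ / 2 by ring] at hy
      simp only [Pi.sub_apply]
      rw [dirac_congr (hvu.eventuallyEq_of_mem (Metric.isOpen_ball.mem_nhds hy')),
        huf y (Metric.ball_subset_ball hlt.le hy'), sub_self])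
    (fun x => by
      simp only [Pi.sub_apply, mul_sub]
      exact (hi1 x).sub (hi2 x))
  refine hmon.congr Metric.isOpen_ball fun x hx => ?_
  have : cauchyTransform (dirac v - f) x = v x - cauchyTransform f x := hT x
  simp only [this]
  rw [hvu (Metric.ball_subset_ball (by linarith) hx)]

/-! ### Extension of the boundary data -/

/-- A Hölder function on a compact set `S` has a compactly supported Hölder extension that is
locally Lipschitz off `S`, with the constant `O(1 + dist(y, S)^{ν-1})` near `y`. -/
theorem exists_compactlySupported_extension {n : ℕ} {S : Set (Euc n)} (hS : IsCompact S)
    (hSne : S.Nonempty) {r : ℝ} (hr : S ⊆ Metric.ball 0 r) {ν M : ℝ} (hν : 0 < ν) (hν1 : ν ≤ 1)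
    (hM : 0 ≤ M) {g : Euc n → Cl n} (hg : ∀ x ∈ S, ∀ y ∈ S, ‖g x - g y‖ ≤ M * dist x y ^ ν) :
    ∃ (u : Euc n → Cl n) (A r' : ℝ), 0 ≤ A ∧ EqOn u g S ∧ r' < r ∧
      (∀ y, r' ≤ ‖y‖ → u y = 0) ∧
      (∀ μ, 0 < μ → μ ≤ ν → ∃ C, 0 ≤ C ∧ ∀ x y, ‖u x - u y‖ ≤ C * dist x y ^ μ) ∧
      ∀ y ∉ S, LipschitzOnWith (A * (1 + Metric.infDist y S ^ (ν - 1))).toNNReal u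
        (Metric.ball y (Metric.infDist y S / 2)) := by
  obtain ⟨C, hC, hext⟩ := exists_mcShane_extension (Euc n) (Cl n)
  have hω : IsModulus fun t => M * t ^ ν := (IsModulus.rpow hν hν1).const_mul hM
  obtain ⟨G, hG1, hG2, hG3⟩ := hext _ S g hω hSne hg
  obtain ⟨r1, hr1, hSr1⟩ := exists_lt_subset_ball hS.isClosed hr
  obtain ⟨r', hr1', hr'⟩ := exists_between hr1
  have hGc : Continuous G := by
    refine continuous_iff_continuousAt.2 fun x => ?_
    rw [ContinuousAt, tendsto_iff_norm_sub_tendsto_zero]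
    refine squeeze_zero (fun _ => norm_nonneg _) (fun y => hG2 y x) ?_
    have : Tendsto (fun y => C * (M * dist y x ^ ν)) (𝓝 x) (𝓝 (C * (M * dist x x ^ ν))) := by
      have h1 : Tendsto (fun y => dist y x) (𝓝 x) (𝓝 (dist x x)) :=
        (continuous_id.dist continuous_const).tendsto x
      exact (((h1.rpow_const (Or.inr hν.le))).const_mul M).const_mul C
    simpa [Real.zero_rpow hν.ne'] using this
  obtain ⟨B, hB⟩ := (isCompact_closedBall (0 : Euc n) r').exists_bound_of_continuousOn
    hGc.continuousOn
  set B' := max B 0 with hB'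
  have hB'0 : 0 ≤ B' := le_max_right _ _
  have hBG : ∀ z ∈ Metric.closedBall (0 : Euc n) r', ‖G z‖ ≤ B' :=
    fun z hz => (hB z hz).trans (le_max_left _ _)
  set χ := cutoff (0 : Euc n) r1 r' with hχ
  set a := (r' - r1)⁻¹ with ha
  have ha0 : 0 ≤ a := inv_nonneg.2 (by linarith)
  have hχlip : LipschitzWith a.toNNReal χ := lipschitzWith_cutoff hr1'
  have hχ0 : ∀ y, r' ≤ ‖y‖ → χ y = 0 := fun y hy => cutoff_eq_zero hr1' (by simpa using hy)
  have hχabs : ∀ z, |χ z| ≤ 1 := fun z => by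
    rw [abs_of_nonneg (cutoff_nonneg z)]; exact cutoff_le_one z
  refine ⟨fun z => χ z • G z, max (a * B') (C * M * 2), r', by positivity, fun x hx => ?_, hr',
    fun y hy => ?_, fun μ hμ hμν => ?_, fun y hy => ?_⟩
  · simp only [hχ]
    rw [cutoff_eq_one hr1' (Metric.mem_ball.1 (hSr1 hx)).le, one_smul, hG1 hx]
  · simp only [hχ0 y hy, zero_smul]
  · refine ⟨2 * B' + (a * B' + C * M), by positivity, ?_⟩
    have hubd : ∀ z, ‖χ z • G z‖ ≤ B' := fun z => by
      by_cases hz : ‖z‖ ≤ r'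
      · rw [norm_smul, Real.norm_eq_abs]
        calc _ ≤ 1 * B' := by gcongr; exacts [hχabs z, hBG z (by simpa using hz)]
          _ = _ := one_mul _
      · rw [hχ0 z (not_le.1 hz).le, zero_smul, norm_zero]; exact hB'0
    have key : ∀ x y, ‖x‖ ≤ r' → dist x y ≤ 1 →
        ‖χ x • G x - χ y • G y‖ ≤ (a * B' + C * M) * dist x y ^ μ := by
      intro x y hx hxy
      have e : χ x • G x - χ y • G y = (χ x - χ y) • G x + χ y • (G x - G y) := by module
      have h1 : |χ x - χ y| ≤ a * dist x y := by
        have := hχlip.dist_le_mul x y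
        rwa [Real.coe_toNNReal _ ha0, Real.dist_eq] at this
      rcases eq_or_ne x y with rfl | hne
      · rw [sub_self, norm_zero]; positivity
      have hd : 0 < dist x y := dist_pos.2 hne
      have h2 : dist x y ≤ dist x y ^ μ := by
        have := Real.rpow_le_rpow_of_exponent_ge hd hxy (hμν.trans hν1)
        rwa [Real.rpow_one] at this
      have h3 : dist x y ^ ν ≤ dist x y ^ μ := Real.rpow_le_rpow_of_exponent_ge hd hxy hμν
      rw [e]
      refine (norm_add_le _ _).trans ?_
      rw [norm_smul, norm_smul, Real.norm_eq_abs, Real.norm_eq_abs]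
      calc _ ≤ a * dist x y * B' + 1 * (C * (M * dist x y ^ ν)) := by
            gcongr
            · exact hBG x (by simpa using hx)
            · exact hχabs y
            · exact hG2 x y
        _ ≤ a * dist x y ^ μ * B' + 1 * (C * (M * dist x y ^ μ)) := by gcongr
        _ = _ := by ring
    intro x y
    have hp : 0 ≤ dist x y ^ μ := by positivity
    rcases le_total 1 (dist x y) with h | h
    · have h1 : 1 ≤ dist x y ^ μ := Real.one_le_rpow h hμ.le
      calc _ ≤ B' + B' := (norm_sub_le _ _).trans (add_le_add (hubd x) (hubd y))
        _ ≤ (2 * B') * 1 + 0 := by linarith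
        _ ≤ (2 * B') * dist x y ^ μ + (a * B' + C * M) * dist x y ^ μ := by gcongr; positivity
        _ = _ := by ring
    · have hle : (a * B' + C * M) * dist x y ^ μ ≤ (2 * B' + (a * B' + C * M)) * dist x y ^ μ := by
        refine mul_le_mul_of_nonneg_right ?_ hp
        linarith
      by_cases hx : ‖x‖ ≤ r'
      · exact (key x y hx h).trans hle
      by_cases hy : ‖y‖ ≤ r'
      · rw [norm_sub_rev]
        rw [dist_comm] at h hle ⊢
        exact (key y x hy h).trans hle
      · simp only [hχ0 x (not_le.1 hx).le, hχ0 y (not_le.1 hy).le, zero_smul, sub_self, norm_zero]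
        positivity
  · set δ := Metric.infDist y S with hδ
    have hδ0 : 0 < δ := (hS.isClosed.notMem_iff_infDist_pos hSne).1 hy
    have hfar : ∀ z ∈ Metric.ball y (δ / 2), δ / 2 ≤ Metric.infDist z S := by
      intro z hz
      have h1 := Metric.infDist_le_infDist_add_dist (s := S) (x := y) (y := z)
      have h2 := Metric.mem_ball.1 hz
      rw [dist_comm] at h2
      linarith
    have hGlip : LipschitzOnWith (C * M * 2 * δ ^ (ν - 1)).toNNReal G (Metric.ball y (δ / 2)) := by
      refine LipschitzOnWith.of_dist_le_mul fun p hp q hq => ?_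
      rw [Real.coe_toNNReal _ (by positivity), dist_eq_norm]
      refine (hG3 (δ / 2) (by positivity) p q (hfar p hp) (hfar q hq)).trans ?_
      refine mul_le_mul_of_nonneg_right ?_ dist_nonneg
      rw [show C * M * 2 * δ ^ (ν - 1) = C * (M * (2 * δ ^ (ν - 1))) by ring]
      gcongr
      rw [div_le_iff₀ (by positivity), mul_assoc M]
      gcongr
      rw [show 2 * δ ^ (ν - 1) * (δ / 2) = δ ^ (ν - 1) * δ by ring, Real.rpow_sub_one hδ0.ne',
        div_mul_cancel₀ _ hδ0.ne']
      exact Real.rpow_le_rpow (by positivity) (by linarith) hν.le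
    have := lipschitzOnWith_smul (M := B'.toNNReal) (B := Metric.closedBall 0 r') hχlip hχabs
      (fun z hz => hχ0 z (by simpa using (le_of_lt (by simpa using hz))))
      (hGlip.mono (inter_subset_right (s := Metric.closedBall 0 r')))
      (fun z hz => by rw [Real.coe_toNNReal _ hB'0]; exact hBG z hz)
    refine this.weaken ?_
    rw [← NNReal.coe_le_coe]
    push_cast
    rw [Real.coe_toNNReal _ ha0, Real.coe_toNNReal _ hB'0, Real.coe_toNNReal _ (by positivity),
      Real.coe_toNNReal _ (by positivity), mul_add, mul_one]
    gcongr
    · exact le_max_left _ _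
    · exact le_max_right _ _

/-! ### Existence -/

/-- If `|∂u|` is `O(1 + dist^{ν-1})` and `I_p` is finite with `p ≥ (1-ν) q`, then `∂u ∈ L^q`. -/
theorem integrable_rpow_of_distIntegral {n : ℕ} {S D : Set (Euc n)} (hSc : IsClosed S)
    (hSne : S.Nonempty) (hDm : MeasurableSet D) (hD : volume D < ∞) (hDS : Disjoint D S)
    {f : Euc n → Cl n} (hf : AEStronglyMeasurable f) (hfD : ∀ y ∉ D, f y = 0) {A ν p q : ℝ}
    (hA : 0 ≤ A) (hν1 : ν ≤ 1) (hq : 0 < q) (hp : (1 - ν) * q ≤ p)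
    (hfA : ∀ y ∈ D, ‖f y‖ ≤ A * (1 + Metric.infDist y S ^ (ν - 1)))
    (hI : distIntegral S D p < ∞) : Integrable fun y => ‖f y‖ ^ q := by
  have hm : AEStronglyMeasurable fun y => ‖f y‖ ^ q :=
    (hf.norm.aemeasurable.pow_const q).aestronglyMeasurable
  refine ⟨hm, ?_⟩
  rw [hasFiniteIntegral_iff_ofReal (Eventually.of_forall fun y => by positivity)]
  have hle : ∀ y, ENNReal.ofReal (‖f y‖ ^ q) ≤ D.indicator (fun y => ENNReal.ofReal ((2 * A) ^ q) *
      (1 + ENNReal.ofReal (1 / Metric.infDist y S ^ p))) y := by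
    intro y
    by_cases hy : y ∈ D
    · rw [indicator_of_mem hy]
      have hδ : 0 < Metric.infDist y S :=
        (hSc.notMem_iff_infDist_pos hSne).1 (disjoint_left.1 hDS hy)
      set δ := Metric.infDist y S
      have h1 : ‖f y‖ ^ q ≤ (2 * A) ^ q * (1 + 1 / δ ^ p) := by
        rcases le_total 1 δ with h | h
        · have h2 : δ ^ (ν - 1) ≤ 1 := Real.rpow_le_one_of_one_le_of_nonpos h (by linarith)
          have h3 : ‖f y‖ ≤ 2 * A := (hfA y hy).trans (by nlinarith)
          calc ‖f y‖ ^ q ≤ (2 * A) ^ q * 1 := by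
                rw [mul_one]; exact Real.rpow_le_rpow (norm_nonneg _) h3 hq.le
            _ ≤ _ := by
              gcongr
              have : 0 ≤ 1 / δ ^ p := by positivity
              linarith
        · have h2 : 1 ≤ δ ^ (ν - 1) :=
            Real.one_le_rpow_of_pos_of_le_one_of_nonpos hδ h (by linarith)
          have h3 : ‖f y‖ ≤ 2 * A * δ ^ (ν - 1) := (hfA y hy).trans (by nlinarith)
          have h4 : (δ ^ (ν - 1)) ^ q ≤ 1 / δ ^ p := by
            rw [← Real.rpow_mul hδ.le, one_div, ← Real.rpow_neg hδ.le]
            exact Real.rpow_le_rpow_of_exponent_ge hδ h (by linarith)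
          calc ‖f y‖ ^ q ≤ (2 * A * δ ^ (ν - 1)) ^ q :=
                Real.rpow_le_rpow (norm_nonneg _) h3 hq.le
            _ = (2 * A) ^ q * (δ ^ (ν - 1)) ^ q := Real.mul_rpow (by positivity) (by positivity)
            _ ≤ (2 * A) ^ q * (1 + 1 / δ ^ p) := by gcongr; linarith
      refine (ENNReal.ofReal_le_ofReal h1).trans (le_of_eq ?_)
      rw [ENNReal.ofReal_mul (by positivity), ENNReal.ofReal_add (by norm_num) (by positivity),
        ENNReal.ofReal_one]
    · rw [hfD y hy, indicator_of_notMem hy, norm_zero, Real.zero_rpow hq.ne', ENNReal.ofReal_zero]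
  refine (lintegral_mono hle).trans_lt ?_
  rw [lintegral_indicator hDm, lintegral_const_mul' _ _ ENNReal.ofReal_ne_top,
    lintegral_add_left measurable_const]
  refine ENNReal.mul_lt_top ENNReal.ofReal_lt_top (ENNReal.add_lt_top.2 ⟨?_, hI⟩)
  simpa using hD

/-- The potential that solves the jump problem: `χ_D u - T(χ_D ∂u)`, where `u` extends the
boundary data `g`. It is monogenic off `S = ∂D`, vanishes at infinity and jumps by `g` across
`S`. -/
theorem exists_jump_potential {n : ℕ} (hn : 2 ≤ n) {D : Set (Euc n)} (hD : IsOpen D)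
    (hSne : (frontier D).Nonempty) {r : ℝ} (hr : frontier D ⊆ Metric.ball 0 r)
    (hSc : IsCompact (frontier D)) {ν M μ s p : ℝ} (hν : 0 < ν) (hν1 : ν ≤ 1) (hM : 0 ≤ M)
    {g : Euc n → Cl n}
    (hg : ∀ x ∈ frontier D, ∀ y ∈ frontier D, ‖g x - g y‖ ≤ M * dist x y ^ ν)
    (hμ : 0 < μ) (hμs : μ < s) (hs1 : s < 1) (hμν : μ ≤ ν) (hp : (1 - ν) * (n / (1 - s)) ≤ p)
    (hI : distIntegral (frontier D) (D ∩ Metric.ball 0 r) p < ∞) :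
    ∃ (u φ : Euc n → Cl n) (C : ℝ), 0 ≤ C ∧ (∀ x y, ‖u x - u y‖ ≤ C * dist x y ^ μ) ∧
      (∀ x y, ‖φ x - φ y‖ ≤ C * dist x y ^ μ) ∧ EqOn u g (frontier D) ∧
      IsMonogenicOn (fun x => D.indicator u x - φ x) (frontier D)ᶜ ∧
      Tendsto (fun x => D.indicator u x - φ x) (cocompact (Euc n)) (𝓝 0) := by
  have hn' : (2 : ℝ) ≤ n := by exact_mod_cast hn
  set S := frontier D with hS
  have hDS : Disjoint D S := (disjoint_frontier_iff_isOpen.2 hD).symm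
  obtain ⟨u, A, r', hA, hug, hr', hu0, huμ, huL⟩ :=
    exists_compactlySupported_extension hSc hSne hr hν hν1 hM hg
  obtain ⟨C1, hC1, huC⟩ := huμ μ hμ hμν
  set D0 := D ∩ Metric.ball (0 : Euc n) r with hD0
  have hD0m : MeasurableSet D0 := hD.measurableSet.inter measurableSet_ball
  have hD0v : volume D0 < ∞ := (measure_mono inter_subset_right).trans_lt measure_ball_lt_top
  set f : Euc n → Cl n := D.indicator (dirac u) with hf
  have hfm : AEStronglyMeasurable f :=
    ((stronglyMeasurable_dirac u).indicator hD.measurableSet).aestronglyMeasurable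
  have hdu0 : ∀ y ∉ Metric.ball (0 : Euc n) r, dirac u y = 0 := by
    intro y hy
    rw [mem_ball_zero_iff, not_lt] at hy
    have h1 : u =ᶠ[𝓝 y] fun _ => 0 := by
      have h2 : y ∈ (Metric.closedBall (0 : Euc n) r')ᶜ := by
        simp only [mem_compl_iff, Metric.mem_closedBall, dist_zero_right, not_le]; linarith
      filter_upwards [Metric.isClosed_closedBall.isOpen_compl.mem_nhds h2] with z hz
      refine hu0 z ?_
      simp only [mem_compl_iff, Metric.mem_closedBall, dist_zero_right, not_le] at hz
      exact hz.le
    rw [dirac_congr h1, dirac_eq]; simp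
  have hf0 : ∀ y ∉ D0, f y = 0 := by
    intro y hy
    by_cases hyD : y ∈ D
    · rw [hf, indicator_of_mem hyD, hdu0 y fun h => hy ⟨hyD, h⟩]
    · rw [hf, indicator_of_notMem hyD]
  have hfA : ∀ y ∈ D0, ‖f y‖ ≤ ‖symbolCLM n‖ * A * (1 + Metric.infDist y S ^ (ν - 1)) := by
    intro y hy
    have hyS : y ∉ S := disjoint_left.1 hDS hy.1
    have hδ := (hSc.isClosed.notMem_iff_infDist_pos hSne).1 hyS
    rw [hf, indicator_of_mem hy.1, mul_assoc]
    have h1 := norm_fderiv_le_of_lipschitzOn ℝ (Metric.ball_mem_nhds y (by positivity)) (huL y hyS)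
    rw [Real.coe_toNNReal _ (by positivity)] at h1
    exact (norm_dirac_le u y).trans (by gcongr)
  have h1s : 0 < 1 - s := by linarith
  have hq0 : 0 < (n : ℝ) / (1 - s) := by positivity
  -- `q = n / (1 - s)`, so that the potentials of order `t` are bounded for `t < n / q' = n - 1 + s`
  have hconj : ((n : ℝ) / (n - 1 + s)).HolderConjugate (n / (1 - s)) := by
    rw [Real.holderConjugate_iff]
    refine ⟨by rw [one_lt_div (by linarith)]; linarith, ?_⟩
    rw [inv_div, inv_div, ← add_div, show (n : ℝ) - 1 + s + (1 - s) = n by ring]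
    exact div_self (by positivity)
  have hfq := integrable_rpow_of_distIntegral hSc.isClosed hSne hD0m hD0v
    (hDS.mono_left inter_subset_left) hfm hf0 (by positivity) hν1 hq0 hp hfA hI
  have hpot : ∀ t : ℝ, 0 ≤ t → t < n - 1 + s → ∃ C : ℝ, ∀ x : Euc n,
      Integrable (fun y => ‖x - y‖ ^ (-t) * ‖f y‖) ∧ ∫ y, ‖x - y‖ ^ (-t) * ‖f y‖ ≤ C :=
    fun t ht0 ht => exists_bound_integral_norm_sub_rpow_mul hn hD0m hD0v hfm hf0 hconj hfq ht0 (by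
      rw [← mul_div_assoc, div_lt_iff₀ (by linarith), mul_comm]
      gcongr)
  have hfi : Integrable f := by
    obtain ⟨C, hC⟩ := hpot 0 le_rfl (by linarith)
    have := (hC 0).1
    simp only [neg_zero, Real.rpow_zero, one_mul] at this
    exact (integrable_norm_iff hfm).1 this
  have hf1 : ∀ x : Euc n, Integrable fun y => ‖x - y‖ ^ (1 - (n : ℝ)) * ‖f y‖ := by
    obtain ⟨C, hC⟩ := hpot (n - 1) (by linarith) (by linarith)
    intro x
    have := (hC x).1
    rwa [neg_sub] at this
  obtain ⟨C2, hC2⟩ := hpot (n - 1 + μ) (by linarith) (by linarith)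
  obtain ⟨C3, hC3, hTC⟩ := exists_holder_cauchyTransform hn hfm hf1 hμ.le (hμs.trans hs1).le hC2
  refine ⟨u, cauchyTransform f, max C1 C3, by positivity, fun x y => (huC x y).trans ?_,
    fun x y => (hTC x y).trans ?_, hug, isMonogenicOn_of_locally fun x hx => ?_, ?_⟩
  · gcongr; exact le_max_left _ _
  · gcongr; exact le_max_right _ _
  · have hδ := (hSc.isClosed.notMem_iff_infDist_pos hSne).1 hx
    by_cases hxD : x ∈ D
    · obtain ⟨ρ, hρ, hρD⟩ := Metric.isOpen_iff.1 hD x hxD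
      set ρ' := min ρ (Metric.infDist x S / 2) with hρ'
      have hρ'0 : 0 < ρ' := lt_min hρ (by positivity)
      have hsub : Metric.ball x ρ' ⊆ D := (Metric.ball_subset_ball (min_le_left _ _)).trans hρD
      have heq : EqOn (D.indicator u) u (Metric.ball x ρ') := fun z hz =>
        indicator_of_mem (hsub hz) u
      refine ⟨_, Metric.isOpen_ball, Metric.mem_ball_self (by positivity : 0 < ρ' / 4),
        isMonogenicOn_sub_cauchyTransform hn hfi hf1 hρ'0 (L := _)
          (fun z hz w hw => by
            rw [heq hz, heq hw]
            exact huL x hx (Metric.ball_subset_ball (min_le_right _ _) hz)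
              (Metric.ball_subset_ball (min_le_right _ _) hw)) fun z hz => ?_⟩
      rw [hf, indicator_of_mem (hsub hz),
        dirac_congr (heq.eventuallyEq_of_mem (Metric.isOpen_ball.mem_nhds hz))]
    · have hxc : x ∈ (closure D)ᶜ := fun h => hx (by
        rw [hS, hD.frontier_eq]; exact ⟨h, hxD⟩)
      obtain ⟨ρ, hρ, hρD⟩ := Metric.isOpen_iff.1 isClosed_closure.isOpen_compl x hxc
      have hsub : ∀ z ∈ Metric.ball x ρ, z ∉ D := fun z hz h => hρD hz (subset_closure h)
      have heq : EqOn (D.indicator u) (fun _ => 0) (Metric.ball x ρ) := fun z hz =>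
        indicator_of_notMem (hsub z hz) u
      refine ⟨_, Metric.isOpen_ball, Metric.mem_ball_self (by positivity : 0 < ρ / 4),
        isMonogenicOn_sub_cauchyTransform hn hfi hf1 hρ (L := 0)
          ((LipschitzOnWith.of_dist_le_mul fun z hz w hw => by
            rw [heq hz, heq hw]; simp)) fun z hz => ?_⟩
      rw [hf, indicator_of_notMem (hsub z hz),
        dirac_congr (heq.eventuallyEq_of_mem (Metric.isOpen_ball.mem_nhds hz)), dirac_eq]
      simp
  · have h1 := tendsto_cauchyTransform_cocompact hn hfi (r := r) fun y hy => hf0 y fun h => hy h.2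
    have h2 : Tendsto (D.indicator u) (cocompact (Euc n)) (𝓝 0) := by
      refine tendsto_const_nhds.congr' ?_
      filter_upwards [(isCompact_closedBall (0 : Euc n) r').compl_mem_cocompact] with z hz
      simp only [mem_compl_iff, Metric.mem_closedBall, dist_zero_right, not_le] at hz
      by_cases hzD : z ∈ D
      · rw [indicator_of_mem hzD, hu0 z hz.le]
      · rw [indicator_of_notMem hzD]
    simpa using h2.sub h1

/-- A finite integral `I_p` over a domain that contains a ball touching the boundary forces
`p ≤ n`. -/
theorem le_of_distIntegral_lt_top {n : ℕ} (hn : 2 ≤ n) {S D : Set (Euc n)} (hS : IsClosed S)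
    (hDS : Disjoint D S) {a x : Euc n} (hx : x ∈ S) (hax : a ≠ x)
    (hball : Metric.ball a (dist a x) ⊆ D) {p : ℝ} (hI : distIntegral S D p < ∞) : p ≤ n := by
  have := nontrivial_euc hn
  by_contra! hpn
  have hp0 : 0 < p := lt_of_le_of_lt (by positivity) hpn
  set d := dist a x with hd
  have hd0 : 0 < d := dist_pos.2 hax
  set V := volume.real (Metric.ball (0 : Euc n) 1) with hV
  have hV0 : 0 < V := ENNReal.toReal_pos (Metric.measure_ball_pos volume 0 one_pos).ne'
    measure_ball_lt_top.ne
  -- the homothetic copies, with centre `x`, of the touching ball carry integrals of size `t^{n-p}`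
  have key : ∀ t : ℝ, 0 < t → t ≤ 1 →
      V * d ^ (n : ℝ) * (2 * d) ^ (-p) * t ^ (-(p - n)) ≤ (distIntegral S D p).toReal := by
    intro t ht ht1
    set c := x + t • (a - x) with hc
    have hca : dist c a = (1 - t) * d := by
      rw [dist_eq_norm, show c - a = (1 - t) • (x - a) by rw [hc]; module, norm_smul,
        Real.norm_of_nonneg (by linarith), ← dist_eq_norm, dist_comm, hd]
    have hcx : dist c x = t * d := by
      rw [dist_eq_norm, hc, add_sub_cancel_left, norm_smul, Real.norm_of_nonneg ht.le,
        ← dist_eq_norm]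
    have hsub : Metric.ball c (t * d) ⊆ D := (Metric.ball_subset_ball' (by
      rw [hca]; linarith)).trans hball
    have hlow : ∀ y ∈ Metric.ball c (t * d),
        ENNReal.ofReal ((2 * d * t) ^ (-p)) ≤ ENNReal.ofReal (1 / Metric.infDist y S ^ p) := by
      intro y hy
      have hδ : 0 < Metric.infDist y S :=
        (hS.notMem_iff_infDist_pos ⟨x, hx⟩).1 (disjoint_left.1 hDS (hsub hy))
      refine ENNReal.ofReal_le_ofReal ?_
      rw [one_div, ← Real.rpow_neg hδ.le]
      refine Real.rpow_le_rpow_of_nonpos hδ ?_ (by linarith)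
      have h1 := Metric.infDist_le_dist_of_mem (x := y) hx
      have h2 := dist_triangle y c x
      have h3 := Metric.mem_ball.1 hy
      linarith
    have h1 : ENNReal.ofReal ((2 * d * t) ^ (-p)) * volume (Metric.ball c (t * d)) ≤
        distIntegral S D p := by
      rw [← setLIntegral_const]
      exact (setLIntegral_mono' measurableSet_ball hlow).trans (lintegral_mono_set hsub)
    have h2 := ENNReal.toReal_mono hI.ne h1
    rw [ENNReal.toReal_mul, ENNReal.toReal_ofReal (by positivity),
      Measure.addHaar_ball _ _ (by positivity), ENNReal.toReal_mul,
      ENNReal.toReal_ofReal (by positivity), finrank_euclideanSpace_fin, ← measureReal_def] at h2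
    refine le_trans (le_of_eq ?_) h2
    rw [Real.mul_rpow (by positivity) ht.le, mul_pow, ← Real.rpow_natCast t,
      ← Real.rpow_natCast d, show -(p - (n : ℝ)) = -p + n by ring, Real.rpow_add ht]
    ring
  have hlim : Tendsto (fun t : ℝ => V * d ^ (n : ℝ) * (2 * d) ^ (-p) * t ^ (-(p - n)))
      (𝓝[>] 0) atTop :=
    (tendsto_rpow_neg_nhdsGT_zero (by linarith)).const_mul_atTop (by positivity)
  have hev := hlim.eventually_gt_atTop (distIntegral S D p).toReal
  have h01 : ∀ᶠ t : ℝ in 𝓝[>] 0, t ∈ Ioo (0 : ℝ) 1 := Ioo_mem_nhdsGT one_pos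
  obtain ⟨t, ht1, ht2⟩ := (hev.and h01).exists
  exact absurd (key t ht2.1 ht2.2.le) (not_le.2 ht1)

theorem _root_.IsPreconnected.subset_of_disjoint_frontier {X : Type*} [TopologicalSpace X]
    {s D : Set X} (hs : IsPreconnected s) (hD : IsOpen D) (hsD : (s ∩ D).Nonempty)
    (hdisj : Disjoint s (frontier D)) : s ⊆ D := by
  refine hs.subset_left_of_subset_union hD isClosed_closure.isOpen_compl
    (disjoint_left.2 fun x hx hx' => hx' (subset_closure hx)) (fun x hx => ?_) hsD
  by_contra h
  rw [mem_union, not_or, notMem_compl_iff] at h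
  exact disjoint_left.1 hdisj hx (by rw [hD.frontier_eq]; exact ⟨h.2, h.1⟩)

/-- In an open set `D`, finiteness of `I_p` near the boundary forces `p ≤ n`. -/
theorem le_of_distIntegral_frontier_lt_top {n : ℕ} (hn : 2 ≤ n) {D : Set (Euc n)} (hD : IsOpen D)
    (hSne : (frontier D).Nonempty) (hSc : IsCompact (frontier D)) {r : ℝ}
    (hr : frontier D ⊆ Metric.ball 0 r) {p : ℝ}
    (hI : distIntegral (frontier D) (D ∩ Metric.ball 0 r) p < ∞) : p ≤ n := by
  have hDS : Disjoint D (frontier D) := (disjoint_frontier_iff_isOpen.2 hD).symm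
  obtain ⟨x0, hx0⟩ := hSne
  obtain ⟨η, hη, hηr⟩ := Metric.isOpen_iff.1 Metric.isOpen_ball x0 (hr hx0)
  obtain ⟨a, haD, ha⟩ := Metric.mem_closure_iff.1 (frontier_subset_closure hx0) (η / 2)
    (by positivity)
  obtain ⟨x, hx, hax⟩ := hSc.exists_infDist_eq_dist ⟨x0, hx0⟩ a
  have hd : dist a x < η / 2 := by
    rw [← hax]
    exact (Metric.infDist_le_dist_of_mem hx0).trans_lt (by rwa [dist_comm])
  have hne : a ≠ x := fun h => disjoint_left.1 hDS haD (h ▸ hx)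
  refine le_of_distIntegral_lt_top hn hSc.isClosed (hDS.mono_left inter_subset_left) hx hne
    (fun y hy => ⟨?_, hηr ?_⟩) hI
  · have hsub : Metric.ball a (dist a x) ⊆ D := by
      refine (convex_ball a _).isPreconnected.subset_of_disjoint_frontier hD
        ⟨a, Metric.mem_ball_self (dist_pos.2 hne), haD⟩ (disjoint_left.2 fun z hz hzS => ?_)
      have h1 := Metric.infDist_le_dist_of_mem (x := a) hzS
      rw [hax, dist_comm a z] at h1
      exact absurd (Metric.mem_ball.1 hz) (not_lt.2 h1)
    exact hsub hy
  · have h1 := dist_triangle y a x0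
    have h2 := Metric.mem_ball.1 hy
    rw [dist_comm] at ha
    rw [Metric.mem_ball]; linarith

/-! ### The jump problem -/

theorem IsHolderOn.exists_norm_sub_le {n : ℕ} {ν : ℝ≥0} {f : Euc n → Cl n} {E : Set (Euc n)}
    (h : IsHolderOn ν f E) :
    ∃ M : ℝ, 0 ≤ M ∧ ∀ x ∈ E, ∀ y ∈ E, ‖f x - f y‖ ≤ M * dist x y ^ (ν : ℝ) := by
  obtain ⟨M, hM⟩ := h
  refine ⟨M, M.coe_nonneg, fun x hx y hy => ?_⟩
  rw [← dist_eq_norm]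
  exact hM.dist_le hx hy

theorem isHolderOn_of_norm_sub_le {n : ℕ} {ν : ℝ≥0} {f : Euc n → Cl n} {E : Set (Euc n)} {M : ℝ}
    (hM : 0 ≤ M) (h : ∀ x y, ‖f x - f y‖ ≤ M * dist x y ^ (ν : ℝ)) : IsHolderOn ν f E := by
  refine ⟨M.toNNReal, fun x _ y _ => ?_⟩
  rw [edist_dist, edist_dist, ENNReal.ofReal_rpow_of_nonneg dist_nonneg ν.coe_nonneg,
    ← ENNReal.ofReal_coe_nnreal, Real.coe_toNNReal _ hM, ← ENNReal.ofReal_mul hM]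
  exact ENNReal.ofReal_le_ofReal (by rw [dist_eq_norm]; exact h x y)

/-- Hölder functions on both sides of `∂Ω` that agree on `∂Ω` glue to a Hölder function: a segment
from one side to the other meets `∂Ω`. -/
theorem exists_holder_glue {n : ℕ} {Ω : Set (Euc n)} (hΩ : IsOpen Ω)
    (hfr : frontier Ω ⊆ closure (exteriorOf Ω)) {μ : ℝ} (hμ : 0 ≤ μ) {f₁ f₂ : Euc n → Cl n}
    {M₁ M₂ : ℝ} (hM₁ : 0 ≤ M₁) (hM₂ : 0 ≤ M₂)
    (h₁ : ∀ x ∈ closure Ω, ∀ y ∈ closure Ω, ‖f₁ x - f₁ y‖ ≤ M₁ * dist x y ^ μ)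
    (h₂ : ∀ x ∈ closure (exteriorOf Ω), ∀ y ∈ closure (exteriorOf Ω),
      ‖f₂ x - f₂ y‖ ≤ M₂ * dist x y ^ μ)
    (h : ∀ x ∈ frontier Ω, f₁ x = f₂ x) {w : Euc n → Cl n} (hw₁ : EqOn w f₁ (closure Ω))
    (hw₂ : EqOn w f₂ (closure Ω)ᶜ) (x y : Euc n) : ‖w x - w y‖ ≤ (M₁ + M₂) * dist x y ^ μ := by
  have key : ∀ x ∈ closure Ω, ∀ y ∈ (closure Ω)ᶜ, ‖w x - w y‖ ≤ (M₁ + M₂) * dist x y ^ μ := by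
    intro x hx y hy
    obtain ⟨z, hz, hzΩ⟩ : ∃ z ∈ segment ℝ x y, z ∈ frontier Ω := by
      by_contra! hcon
      have hxΩ : x ∈ Ω := by
        by_contra hx'
        exact hcon x (left_mem_segment ℝ x y) (by rw [hΩ.frontier_eq]; exact ⟨hx, hx'⟩)
      have hsub := (convex_segment x y).isPreconnected.subset_of_disjoint_frontier hΩ
        ⟨x, left_mem_segment ℝ x y, hxΩ⟩ (disjoint_left.2 hcon)
      exact hy (subset_closure (hsub (right_mem_segment ℝ x y)))
    have hd := dist_add_dist_of_mem_segment hz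
    have e : w x - w y = (f₁ x - f₁ z) + (f₂ z - f₂ y) := by
      rw [hw₁ hx, hw₂ hy, h z hzΩ]; abel
    have hxz : dist x z ≤ dist x y := by linarith [dist_nonneg (x := z) (y := y)]
    have hzy : dist z y ≤ dist x y := by linarith [dist_nonneg (x := x) (y := z)]
    rw [e, add_mul]
    refine (norm_add_le _ _).trans (add_le_add ?_ ?_)
    · exact (h₁ x hx z (frontier_subset_closure hzΩ)).trans (by gcongr)
    · exact (h₂ z (hfr hzΩ) y (subset_closure hy)).trans (by gcongr)
  have hp : 0 ≤ dist x y ^ μ := by positivity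
  by_cases hx : x ∈ closure Ω <;> by_cases hy : y ∈ closure Ω
  · rw [hw₁ hx, hw₁ hy]
    exact (h₁ x hx y hy).trans (by gcongr; linarith)
  · exact key x hx y hy
  · rw [norm_sub_rev, dist_comm]; exact key y hy x hx
  · rw [hw₂ hx, hw₂ hy]
    exact (h₂ x (subset_closure hx) y (subset_closure hy)).trans (by gcongr; linarith)

theorem isOpen_exteriorOf {n : ℕ} (Ω : Set (Euc n)) : IsOpen (exteriorOf Ω) :=
  isClosed_closure.isOpen_compl

theorem compl_frontier_eq {n : ℕ} {Ω : Set (Euc n)} (hΩ : IsOpen Ω) :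
    (frontier Ω)ᶜ = Ω ∪ exteriorOf Ω := by
  rw [hΩ.frontier_eq, sdiff_eq, compl_inter, compl_compl, union_comm]; rfl

theorem IsJordanDomain.isCompact_frontier {n : ℕ} {Ω : Set (Euc n)} (hΩ : IsJordanDomain Ω) :
    IsCompact (frontier Ω) :=
  hΩ.isBounded.isCompact_closure.of_isClosed_subset isClosed_frontier frontier_subset_closure

theorem IsJordanDomain.nonempty_frontier {n : ℕ} (hn : 2 ≤ n) {Ω : Set (Euc n)}
    (hΩ : IsJordanDomain Ω) : (frontier Ω).Nonempty := by
  have := nontrivial_euc hn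
  refine nonempty_frontier_iff.2 ⟨hΩ.isConnected.nonempty, fun h => ?_⟩
  have h1 := hΩ.isBounded
  rw [h] at h1
  exact NormedSpace.unbounded_univ ℝ (Euc n) h1

theorem IsJordanDomain.frontier_subset_closure_exterior {n : ℕ} {Ω : Set (Euc n)}
    (hΩ : IsJordanDomain Ω) : frontier Ω ⊆ closure (exteriorOf Ω) := by
  rw [← hΩ.frontier_exterior]; exact frontier_subset_closure

/-- Two solutions of the same jump problem agree: their difference extends to a function that is
Hölder continuous across the boundary. -/
theorem IsJumpSolution.eqOn {n : ℕ} (hn : 2 ≤ n) {Ω : Set (Euc n)} (hΩ : IsJordanDomain Ω)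
    {g : Euc n → Cl n} {c : Cl n} {μ : ℝ≥0} (hμ0 : 0 < μ) (hμ1 : μ ≤ 1)
    (hdim : Measure.hausdorffMeasure ((n : ℝ) - 1 + μ) (frontier Ω) = 0) {Φ Ψ : Euc n → Cl n}
    (hΦ : IsJumpSolution Ω g c μ Φ) (hΨ : IsJumpSolution Ω g c μ Ψ) :
    EqOn Φ Ψ (frontier Ω)ᶜ := by
  classical
  obtain ⟨Φp, Φm, hΦp, hΦm, hΦph, hΦmh, hΦj⟩ := hΦ.jump
  obtain ⟨Ψp, Ψm, hΨp, hΨm, hΨph, hΨmh, hΨj⟩ := hΨ.jump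
  obtain ⟨A1, hA1, hA1'⟩ := hΦph.exists_norm_sub_le
  obtain ⟨A2, hA2, hA2'⟩ := hΨph.exists_norm_sub_le
  obtain ⟨B1, hB1, hB1'⟩ := hΦmh.exists_norm_sub_le
  obtain ⟨B2, hB2, hB2'⟩ := hΨmh.exists_norm_sub_le
  have hsub : ∀ {f f' : Euc n → Cl n} {E : Set (Euc n)} {M M' : ℝ},
      (∀ x ∈ E, ∀ y ∈ E, ‖f x - f y‖ ≤ M * dist x y ^ (μ : ℝ)) →
      (∀ x ∈ E, ∀ y ∈ E, ‖f' x - f' y‖ ≤ M' * dist x y ^ (μ : ℝ)) → ∀ x ∈ E, ∀ y ∈ E,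
      ‖(f x - f' x) - (f y - f' y)‖ ≤ (M + M') * dist x y ^ (μ : ℝ) := by
    intro f f' E M M' h h' x hx y hy
    rw [sub_sub_sub_comm, add_mul]
    exact (norm_sub_le _ _).trans (add_le_add (h x hx y hy) (h' x hx y hy))
  set w : Euc n → Cl n := fun x => if x ∈ closure Ω then Φp x - Ψp x else Φm x - Ψm x with hw
  have hw₁ : EqOn w (fun x => Φp x - Ψp x) (closure Ω) := fun x hx => if_pos hx
  have hw₂ : EqOn w (fun x => Φm x - Ψm x) (closure Ω)ᶜ := fun x hx => if_neg hx
  have hwΦ : EqOn w (fun x => Φ x - Ψ x) (frontier Ω)ᶜ := by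
    intro x hx
    rw [compl_frontier_eq hΩ.isOpen] at hx
    rcases hx with hx | hx
    · rw [hw₁ (subset_closure hx)]; simp only [hΦp hx, hΨp hx]
    · rw [hw₂ hx]; simp only [hΦm hx, hΨm hx]
  have hhol := exists_holder_glue hΩ.isOpen hΩ.frontier_subset_closure_exterior μ.coe_nonneg
    (add_nonneg hA1 hA2) (add_nonneg hB1 hB2) (hsub hA1' hA2') (hsub hB1' hB2')
    (fun x hx => by
      have h1 := hΦj x hx
      rw [← hΨj x hx] at h1
      rw [sub_eq_sub_iff_sub_eq_sub]; exact h1) hw₁ hw₂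
  have hSo : IsOpen (frontier Ω)ᶜ := isClosed_frontier.isOpen_compl
  have hmon : IsMonogenicOn w (frontier Ω)ᶜ :=
    (hΦ.monogenic.sub hSo hΨ.monogenic).congr hSo hwΦ
  have hinf : Tendsto w (cocompact (Euc n)) (𝓝 0) := by
    have h1 := hΦ.at_infinity.sub hΨ.at_infinity
    rw [sub_self] at h1
    refine h1.congr' ?_
    filter_upwards [hΩ.isCompact_frontier.compl_mem_cocompact] with x hx using (hwΦ hx).symm
  intro x hx
  have h0 := eq_zero_of_monogenic_of_hausdorffMeasure hn hΩ.isCompact_frontier hmon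
    (by positivity) (by exact_mod_cast hμ0) (by exact_mod_cast hμ1) hhol hinf hdim hx
  rw [hwΦ hx] at h0
  exact sub_eq_zero.1 h0

theorem exists_lt_of_lt_sSup {A : Set ℝ} {a : ℝ} (ha : 0 ≤ a) (h : a < sSup A) :
    ∃ p ∈ A, a < p := by
  refine exists_lt_of_lt_csSup ?_ h
  by_contra hne
  rw [not_nonempty_iff_eq_empty] at hne
  rw [hne, Real.sSup_empty] at h
  linarith

/-- Existence for the jump problem, provided that `I_p` is finite on one side of the boundary for
a sufficiently large `p`. -/
theorem exists_isJumpSolution {n : ℕ} (hn : 2 ≤ n) {Ω : Set (Euc n)} (hΩ : IsJordanDomain Ω)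
    {r : ℝ} (hr : frontier Ω ⊆ Metric.ball 0 r) {ν μ : ℝ≥0} (hν0 : 0 < ν) (hν1 : ν ≤ 1)
    (hμ0 : 0 < μ) {g : Euc n → Cl n} (hg : IsHolderOn ν g (frontier Ω)) {s p : ℝ}
    (hμs : (μ : ℝ) < s) (hs1 : s < 1) (hp : (1 - (ν : ℝ)) * (n / (1 - s)) < p)
    (hI : distIntegral (frontier Ω) Ω p < ∞ ∨
      distIntegral (frontier Ω) (exteriorOf Ω ∩ Metric.ball 0 r) p < ∞) (c : Cl n) :
    ∃ Φ : Euc n → Cl n, IsJumpSolution Ω g c μ Φ := by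
  obtain ⟨M, hM, hg'⟩ := hg.exists_norm_sub_le
  have hSc := hΩ.isCompact_frontier
  have hSne := hΩ.nonempty_frontier hn
  have h1s : 0 < 1 - s := by linarith
  have hn0 : (0 : ℝ) < n := by positivity
  -- the bound `p ≤ n` makes `μ < s < ν`, so that the `ν`-Hölder extension of `g` is `μ`-Hölder
  have hμν : p ≤ n → (μ : ℝ) ≤ ν := by
    intro hpn
    have h1 := hp.trans_le hpn
    rw [← mul_div_assoc, div_lt_iff₀ h1s, mul_comm] at h1
    have := lt_of_mul_lt_mul_left h1 hn0.le
    linarith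
  have hcΩ : ∀ x ∈ exteriorOf Ω, x ∉ Ω := fun x hx h => hx (subset_closure h)
  have hconst : Tendsto (fun _ : Euc n => c) (cocompact (Euc n)) (𝓝 c) := tendsto_const_nhds
  have hSo : IsOpen (frontier Ω)ᶜ := isClosed_frontier.isOpen_compl
  rcases hI with hI | hI
  · have hI' : distIntegral (frontier Ω) (Ω ∩ Metric.ball 0 r) p < ∞ :=
      (lintegral_mono_set inter_subset_left).trans_lt hI
    have hpn := le_of_distIntegral_frontier_lt_top hn hΩ.isOpen hSne hSc hr hI'
    obtain ⟨u, φ, C, hC, hu, hφ, hug, hmon, hlim⟩ := exists_jump_potential hn hΩ.isOpen hSne hr hSc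
      (by exact_mod_cast hν0) (by exact_mod_cast hν1) hM hg' (by exact_mod_cast hμ0) hμs hs1
      (hμν hpn) hp.le hI'
    refine ⟨fun x => c - (0 - (Ω.indicator u x - φ x)), ?_, ?_, fun x => c + (u x - φ x),
      fun x => c - φ x, fun x hx => ?_, fun x hx => ?_, ?_, ?_, fun x hx => ?_⟩
    · exact (isMonogenicOn_const c _).sub hSo ((isMonogenicOn_const 0 _).sub hSo hmon)
    · have := hconst.sub (hlim.const_sub 0)
      simpa using this
    · simp only [indicator_of_mem hx, zero_sub, sub_neg_eq_add]
    · simp [indicator_of_notMem fun h => hcΩ x hx h]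
    · refine isHolderOn_of_norm_sub_le (M := C + C) (by positivity) fun x y => ?_
      rw [add_sub_add_left_eq_sub, sub_sub_sub_comm, add_mul]
      exact (norm_sub_le _ _).trans (add_le_add (hu x y) (hφ x y))
    · refine isHolderOn_of_norm_sub_le (M := C) hC fun x y => ?_
      rw [sub_sub_sub_cancel_left, norm_sub_rev]
      exact hφ x y
    · simp only [add_sub_sub_cancel, sub_add_cancel, hug hx]
  · have hfe := hΩ.frontier_exterior
    rw [← hfe] at hI hr hSc hSne hg'
    have hpn := le_of_distIntegral_frontier_lt_top hn (isOpen_exteriorOf Ω) hSne hSc hr hI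
    obtain ⟨u, φ, C, hC, hu, hφ, hug, hmon, hlim⟩ := exists_jump_potential hn
      (isOpen_exteriorOf Ω) hSne hr hSc
      (by exact_mod_cast hν0) (by exact_mod_cast hν1) hM hg' (by exact_mod_cast hμ0) hμs hs1
      (hμν hpn) hp.le hI
    rw [hfe] at hmon hug
    refine ⟨fun x => c - ((exteriorOf Ω).indicator u x - φ x), ?_, ?_, fun x => c + φ x,
      fun x => c - (u x - φ x), fun x hx => ?_, fun x hx => ?_, ?_, ?_, fun x hx => ?_⟩
    · exact (isMonogenicOn_const c _).sub hSo hmon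
    · simpa using hconst.sub hlim
    · simp [indicator_of_notMem fun h => hcΩ x h hx]
    · simp [indicator_of_mem hx]
    · refine isHolderOn_of_norm_sub_le (M := C) hC fun x y => ?_
      rw [add_sub_add_left_eq_sub]
      exact hφ x y
    · refine isHolderOn_of_norm_sub_le (M := C + C) (by positivity) fun x y => ?_
      rw [sub_sub_sub_cancel_left, norm_sub_rev, sub_sub_sub_comm, add_mul]
      exact (norm_sub_le _ _).trans (add_le_add (hu x y) (hφ x y))
    · simp only [add_sub_sub_cancel, add_sub_cancel, hug hx]

end CliffordJump

end

theorem mainTheorem2 (n : ℕ) (hn : 2 ≤ n)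
    (Ω : Set (CliffordJump.Euc n)) (hΩ : CliffordJump.IsJordanDomain Ω)
    (r : ℝ) (hr : frontier Ω ⊆ Metric.ball 0 r)
    (ν μ : ℝ≥0) (hν0 : 0 < ν) (hν1 : ν ≤ 1) (hμ0 : 0 < μ)
    (g : CliffordJump.Euc n → CliffordJump.Cl n)
    (hg : CliffordJump.IsHolderOn ν g (frontier Ω))
    (hν : 1 - CliffordJump.marcinkiewicz Ω r / n < (ν : ℝ))
    (hμ_lower : (dimH (frontier Ω)).toReal - ((n : ℝ) - 1) < (μ : ℝ))
    (hμ_upper : (μ : ℝ) < 1 - n * (1 - (ν : ℝ)) / CliffordJump.marcinkiewicz Ω r)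
    (c : CliffordJump.Cl n) :
    (∃ Φ : CliffordJump.Euc n → CliffordJump.Cl n, CliffordJump.IsJumpSolution Ω g c μ Φ) ∧
    ∀ Φ Ψ : CliffordJump.Euc n → CliffordJump.Cl n,
      CliffordJump.IsJumpSolution Ω g c μ Φ → CliffordJump.IsJumpSolution Ω g c μ Ψ →
        EqOn Φ Ψ (frontier Ω)ᶜ := by
  have hn' : (2 : ℝ) ≤ n := by exact_mod_cast hn
  have hν1' : (ν : ℝ) ≤ 1 := by exact_mod_cast hν1
  have hμ0' : (0 : ℝ) < μ := by exact_mod_cast hμ0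
  set m := CliffordJump.marcinkiewicz Ω r with hm
  -- if `m` vanished, `hν` would read `1 < ν`
  have hm0 : 0 < m := by
    by_contra h
    have : m / n ≤ 0 := div_nonpos_of_nonpos_of_nonneg (not_lt.1 h) (by linarith)
    linarith
  obtain ⟨s, hμs, hs⟩ := exists_between hμ_upper
  have hfrac : 0 ≤ n * (1 - (ν : ℝ)) / m :=
    div_nonneg (mul_nonneg (by linarith) (by linarith)) hm0.le
  have hs1 : s < 1 := by linarith
  have hlt : (1 - (ν : ℝ)) * (n / (1 - s)) < m := by
    have h1 : n * (1 - (ν : ℝ)) / m < 1 - s := by linarith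
    rw [div_lt_iff₀ hm0] at h1
    rw [← mul_div_assoc, div_lt_iff₀ (by linarith)]
    linarith
  have h0 : 0 ≤ (1 - (ν : ℝ)) * (n / (1 - s)) :=
    mul_nonneg (by linarith) (div_nonneg (by linarith) (by linarith))
  refine ⟨?_, fun Φ Ψ hΦ hΨ => hΦ.eqOn hn hΩ hμ0 (by exact_mod_cast (hμs.trans hs1).le) ?_ hΨ⟩
  · rw [hm, CliffordJump.marcinkiewicz, lt_max_iff] at hlt
    rcases hlt with h | h
    · obtain ⟨p, hpI, hp⟩ := CliffordJump.exists_lt_of_lt_sSup h0 h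
      exact CliffordJump.exists_isJumpSolution hn hΩ hr hν0 hν1 hμ0 hg hμs hs1 hp (Or.inl hpI) c
    · obtain ⟨p, hpI, hp⟩ := CliffordJump.exists_lt_of_lt_sSup h0 h
      exact CliffordJump.exists_isJumpSolution hn hΩ hr hν0 hν1 hμ0 hg hμs hs1 hp (Or.inr hpI) c
  · have hfin : dimH (frontier Ω) < ∞ := by
      refine (dimH_mono (subset_univ _)).trans_lt ?_
      rw [Real.dimH_univ_eq_finrank]
      exact ENNReal.natCast_lt_top _
    have hd : dimH (frontier Ω) < (((n : ℝ) - 1 + μ).toNNReal : ℝ≥0∞) := by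
      rw [← ENNReal.ofReal_toReal hfin.ne]
      exact (ENNReal.ofReal_lt_ofReal_iff (by linarith)).2 (by linarith)
    have := hausdorffMeasure_of_dimH_lt hd
    rwa [Real.coe_toNNReal _ (by linarith)] at this
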